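/- Let $\sigma:\mathbb{R}\to\mathbb{R}$ be an activation function that is smooth ($\sigma\in C^\infty(\mathbb{R})$), Lipschitz continuous and not a polynomial; on vectors $\sigma$ acts componentwise. Let $\Omega\subset\mathbb{R}^d$ be a bounded domain with Lipschitz boundary, i.e. $\Omega$ is open and bounded and near each boundary point it is, in suitable rotated Cartesian coordinates, the set of points lying strictly above the graph of a Lipschitz function. A neural network with one hidden layer of width $w$ is a map $z\mapsto A_2\,\sigma(A_1z+b_1)+b_2$ with matrices $A_1,A_2$ and vectors $b_1,b_2$ of matching sizes, the hidden vector lying in $\mathbb{R}^w$. An averaging neural operator with channel dimension $d_c$, from $\mathbb{R}^k$-valued to $\mathbb{R}^{k'}$-valued functions on $\Omega$, is a map of the form \[ \Psi(u)(x)=Q(v(x),x),\qquad v(x)=\sigma\Big(W\,w(x)+b+\frac{1}{|\Omega|}\int_\Omega w(y)\,dy\Big),\qquad w(x)=R(u(x),x), \] where $W\in\mathbb{R}^{d_c\times d_c}$, $b\in\mathbb{R}^{d_c}$, and $R:\mathbb{R}^k\times\mathbb{R}^d\to\mathbb{R}^{d_c}$ and $Q:\mathbb{R}^{d_c}\times\mathbb{R}^d\to\mathbb{R}^{k'}$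 are neural networks with one hidden layer of width $d_c$. Let $s,s'\ge 0$ be integers, let $p,p'\in[1,\infty)$, let $\Psi^\dagger:W^{s,p}(\Omega;\mathbb{R}^k)\to W^{s',p'}(\Omega;\mathbb{R}^{k'})$ be a continuous (in general nonlinear) operator, and let $\mathsf K\subset W^{s,p}(\Omega;\mathbb{R}^k)$ be compact with $\sup_{u\in\mathsf K}\|u\|_{L^\infty(\Omega)}<\infty$. Then for every $\epsilon>0$ there exist a channel dimension $d_c$ and an averaging neural operator $\Psi$ with channel dimension $d_c$ that maps $W^{s,p}(\Omega;\mathbb{R}^k)$ into $W^{s',p'}(\Omega;\mathbb{R}^{k'})$ and satisfies \[ \sup_{u\in\mathsf K}\|\Psi^\dagger(u)-\Psi(u)\|_{W^{s',p'}}\le\epsilon . \] -/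

import Mathlib

open MeasureTheory Set
open scoped ENNReal NNReal ContDiff

noncomputable section

namespace ANO

/-- `ℝⁿ` with its Euclidean norm. -/
abbrev E (n : ℕ) : Type := EuclideanSpace ℝ (Fin n)

/-! ### Lipschitz domains -/

/-- The boundary of `Ω` is locally the graph of a Lipschitz function, with `Ω` on one side of it.
For a unit vector `e`, every `x` splits into its height `⟪e, x⟫` and its horizontal part
`x - ⟪e, x⟫ e`; near each boundary point, `Ω` is the set of points lying strictly above the graph
of a Lipschitz function `γ` of the horizontal part. -/
def HasLipschitzBoundary {d : ℕ} (Ω : Set (E d)) : Prop :=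
  ∀ z ∈ frontier Ω, ∃ e : E d, ‖e‖ = 1 ∧ ∃ (γ : E d → ℝ) (L : ℝ≥0), LipschitzWith L γ ∧
    ∃ r > 0, ∀ x ∈ Metric.ball z r, x ∈ Ω ↔ γ (x - inner ℝ e x • e) < inner ℝ e x

/-! ### Sobolev spaces -/

/-- The classical partial derivative `∂ᵢ φ`. -/
def partialDeriv {d : ℕ} (i : Fin d) (φ : E d → ℝ) : E d → ℝ :=
  fun x => fderiv ℝ φ x (EuclideanSpace.single i 1)

/-- The classical derivative `∂₀^{α₀} ⋯ ∂_{d-1}^{α_{d-1}} φ`. -/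
def multiDeriv {d : ℕ} (α : Fin d → ℕ) (φ : E d → ℝ) : E d → ℝ :=
  (List.finRange d).foldr (fun i g => (partialDeriv i)^[α i] g) φ

/-- `φ ∈ C_c^∞(Ω)`. -/
structure IsTestFunction {d : ℕ} (Ω : Set (E d)) (φ : E d → ℝ) : Prop where
  contDiff : ContDiff ℝ ∞ φ
  hasCompactSupport : HasCompactSupport φ
  tsupport_subset : tsupport φ ⊆ Ω

/-- `g` is the weak derivative `D^α f` on `Ω`:
`∫_Ω (D^α φ) f = (-1)^|α| ∫_Ω φ g` for all `φ ∈ C_c^∞(Ω)`. -/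
def IsWeakDeriv {d k : ℕ} (Ω : Set (E d)) (α : Fin d → ℕ) (f g : E d → E k) : Prop :=
  ∀ φ : E d → ℝ, IsTestFunction Ω φ →
    ∫ x in Ω, multiDeriv α φ x • f x = (-1 : ℝ) ^ (∑ i, α i) • ∫ x in Ω, φ x • g x

/-- Multi-indices `α ∈ ℕ^d` with `|α| ≤ s`. -/
abbrev MultiIndex (d s : ℕ) : Type := {α : Fin d → Fin (s + 1) // ∑ i, (α i : ℕ) ≤ s}

/-- The underlying function `Fin d → ℕ` of a multi-index. -/
def MultiIndex.exponents {d s : ℕ} (α : MultiIndex d s) : Fin d → ℕ := fun i => (α.1 i : ℕ)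

/-- The multi-index `0`. -/
def MultiIndex.zero (d s : ℕ) : MultiIndex d s := ⟨fun _ => 0, by simp⟩

/-- `L^p(Ω; ℝ^k)`. -/
abbrev LpOn {d : ℕ} (Ω : TopologicalSpace.Opens (E d)) (p : ℝ≥0∞) (k : ℕ) : Type :=
  Lp (E k) p (volume.restrict (Ω : Set (E d)))

lemma IsTestFunction.partialDeriv {d : ℕ} {Ω : Set (E d)} {φ : E d → ℝ}
    (h : IsTestFunction Ω φ) (i : Fin d) : IsTestFunction Ω (partialDeriv i φ) := by
  refine ⟨?_, ?_, ?_⟩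
  · have h1 : ContDiff ℝ ∞ (fderiv ℝ φ) := h.contDiff.fderiv_right (by simp)
    exact h1.clm_apply contDiff_const
  · exact h.hasCompactSupport.fderiv_apply ℝ _
  · exact (tsupport_fderiv_apply_subset ℝ _).trans h.tsupport_subset

lemma IsTestFunction.multiDeriv {d : ℕ} {Ω : Set (E d)} {φ : E d → ℝ}
    (h : IsTestFunction Ω φ) (α : Fin d → ℕ) : IsTestFunction Ω (multiDeriv α φ) := by
  unfold ANO.multiDeriv
  induction List.finRange d with
  | nil => exact h
  | cons i l ih =>
    simp only [List.foldr_cons]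
    generalize List.foldr (fun i g => (ANO.partialDeriv i)^[α i] g) φ l = g at ih
    induction α i with
    | zero => exact ih
    | succ n ihn =>
      rw [Function.iterate_succ_apply']
      exact ihn.partialDeriv i

lemma IsTestFunction.integrable_smul {d k : ℕ} {Ω : TopologicalSpace.Opens (E d)} {p : ℝ≥0∞}
    [hp : Fact (1 ≤ p)] {φ : E d → ℝ} (h : IsTestFunction (Ω : Set (E d)) φ) (f : LpOn Ω p k) :
    Integrable (fun x => φ x • f x) (volume.restrict (Ω : Set (E d))) :=
  ((Lp.memLp f).locallyIntegrable hp.out).integrable_smul_left_of_hasCompactSupport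
    h.contDiff.continuous h.hasCompactSupport

lemma IsWeakDeriv.add {d k : ℕ} {Ω : TopologicalSpace.Opens (E d)} {p : ℝ≥0∞} [Fact (1 ≤ p)]
    {α : Fin d → ℕ} {f f' g g' : LpOn Ω p k} (h : IsWeakDeriv Ω α f g)
    (h' : IsWeakDeriv Ω α f' g') : IsWeakDeriv Ω α ⇑(f + f') ⇑(g + g') := by
  intro φ hφ
  have e1 : ∫ x in (Ω : Set (E d)), multiDeriv α φ x • (f + f') x =
      ∫ x in (Ω : Set (E d)), (multiDeriv α φ x • f x + multiDeriv α φ x • f' x) := by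
    refine integral_congr_ae ?_
    filter_upwards [Lp.coeFn_add f f'] with x hx
    rw [hx, Pi.add_apply, smul_add]
  have e2 : ∫ x in (Ω : Set (E d)), φ x • (g + g') x =
      ∫ x in (Ω : Set (E d)), (φ x • g x + φ x • g' x) := by
    refine integral_congr_ae ?_
    filter_upwards [Lp.coeFn_add g g'] with x hx
    rw [hx, Pi.add_apply, smul_add]
  rw [e1, e2, integral_add ((hφ.multiDeriv α).integrable_smul f)
    ((hφ.multiDeriv α).integrable_smul f'), integral_add (hφ.integrable_smul g)
    (hφ.integrable_smul g'), h φ hφ, h' φ hφ, smul_add]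

lemma IsWeakDeriv.smul {d k : ℕ} {Ω : TopologicalSpace.Opens (E d)} {p : ℝ≥0∞} [Fact (1 ≤ p)]
    {α : Fin d → ℕ} {f g : LpOn Ω p k} (c : ℝ) (h : IsWeakDeriv Ω α f g) :
    IsWeakDeriv Ω α ⇑(c • f) ⇑(c • g) := by
  intro φ hφ
  have e1 : ∫ x in (Ω : Set (E d)), multiDeriv α φ x • (c • f) x =
      ∫ x in (Ω : Set (E d)), c • (multiDeriv α φ x • f x) := by
    refine integral_congr_ae ?_
    filter_upwards [Lp.coeFn_smul c f] with x hx
    rw [hx, Pi.smul_apply, smul_comm]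
  have e2 : ∫ x in (Ω : Set (E d)), φ x • (c • g) x =
      ∫ x in (Ω : Set (E d)), c • (φ x • g x) := by
    refine integral_congr_ae ?_
    filter_upwards [Lp.coeFn_smul c g] with x hx
    rw [hx, Pi.smul_apply, smul_comm]
  rw [e1, e2, integral_smul, integral_smul, h φ hφ, smul_comm]

lemma IsWeakDeriv.unique {d k : ℕ} {Ω : TopologicalSpace.Opens (E d)} {p : ℝ≥0∞}
    [hp : Fact (1 ≤ p)] {α : Fin d → ℕ} {f : E d → E k} {g g' : LpOn Ω p k}
    (h : IsWeakDeriv Ω α f g) (h' : IsWeakDeriv Ω α f g') : g = g' := by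
  have hloc : LocallyIntegrable ⇑(g - g') (volume.restrict (Ω : Set (E d))) :=
    (Lp.memLp (g - g')).locallyIntegrable hp.out
  have key := Ω.isOpen.ae_eq_zero_of_integral_contDiff_smul_eq_zero
    (μ := volume.restrict (Ω : Set (E d))) (hloc.locallyIntegrableOn _) (by
      intro φ h1 h2 h3
      have hφ : IsTestFunction (Ω : Set (E d)) φ := ⟨h1, h2, h3⟩
      have e2 : ∫ x in (Ω : Set (E d)), φ x • (g - g') x =
          ∫ x in (Ω : Set (E d)), (φ x • g x - φ x • g' x) := by
        refine integral_congr_ae ?_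
        filter_upwards [Lp.coeFn_sub g g'] with x hx
        rw [hx, Pi.sub_apply, smul_sub]
      rw [e2, integral_sub (hφ.integrable_smul g) (hφ.integrable_smul g'), sub_eq_zero]
      have := (h φ hφ).symm.trans (h' φ hφ)
      exact (smul_right_injective (E k) (pow_ne_zero _ (by norm_num : (-1 : ℝ) ≠ 0))) this)
  refine Lp.ext ?_
  filter_upwards [key, Lp.coeFn_sub g g', ae_restrict_mem Ω.isOpen.measurableSet]
    with x hx hs hm
  have := hx hm
  rw [hs, Pi.sub_apply, sub_eq_zero] at this
  exact this

lemma isWeakDeriv_zero_index {d s k : ℕ} {Ω : Set (E d)} (f : E d → E k) :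
    IsWeakDeriv Ω (MultiIndex.zero d s).exponents f f := by
  intro φ _
  have : multiDeriv (MultiIndex.zero d s).exponents φ = φ := by
    unfold multiDeriv
    induction List.finRange d with
    | nil => rfl
    | cons i l ih => rw [List.foldr_cons, ih]; rfl
  rw [this]
  simp [MultiIndex.exponents, MultiIndex.zero]

/-- The linear subspace of those `f ∈ L^p(Ω; ℝ^k)` all of whose weak derivatives `D^α f`,
`|α| ≤ s`, exist and lie in `L^p(Ω; ℝ^k)`. -/
def sobolevSubmodule {d : ℕ} (Ω : TopologicalSpace.Opens (E d)) (s : ℕ) (p : ℝ≥0∞)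
    [Fact (1 ≤ p)] (k : ℕ) : Submodule ℝ (LpOn Ω p k) where
  carrier := {f | ∀ α : MultiIndex d s, ∃ g : LpOn Ω p k, IsWeakDeriv Ω α.exponents f g}
  add_mem' := by
    intro f f' hf hf' α
    obtain ⟨g, hg⟩ := hf α
    obtain ⟨g', hg'⟩ := hf' α
    exact ⟨g + g', hg.add hg'⟩
  zero_mem' := by
    intro α
    refine ⟨(0 : ℝ) • (0 : LpOn Ω p k), fun φ _ => ?_⟩
    have e (ψ : E d → ℝ) : ∫ x in (Ω : Set (E d)), ψ x • (0 : LpOn Ω p k) x = 0 := by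
      rw [← integral_zero (E d) (E k) (μ := volume.restrict (Ω : Set (E d)))]
      refine integral_congr_ae ?_
      filter_upwards [Lp.coeFn_zero (E k) p (volume.restrict (Ω : Set (E d)))] with x hx
      rw [hx, Pi.zero_apply, smul_zero]
    rw [smul_zero, e, e, smul_zero]
  smul_mem' := by
    intro c f hf α
    obtain ⟨g, hg⟩ := hf α
    exact ⟨c • g, hg.smul c⟩

/-- The Sobolev space `W^{s,p}(Ω; ℝ^k)`, as a type of its own, since its norm is not that of
`L^p`. -/
def Sobolev {d : ℕ} (Ω : TopologicalSpace.Opens (E d)) (s : ℕ) (p : ℝ≥0∞)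
    [Fact (1 ≤ p)] (k : ℕ) : Type :=
  ↥(sobolevSubmodule Ω s p k)

namespace Sobolev

variable {d : ℕ} {Ω : TopologicalSpace.Opens (E d)} {s : ℕ} {p : ℝ≥0∞} [Fact (1 ≤ p)] {k : ℕ}

instance : AddCommGroup (Sobolev Ω s p k) :=
  inferInstanceAs (AddCommGroup ↥(sobolevSubmodule Ω s p k))

instance : Module ℝ (Sobolev Ω s p k) :=
  inferInstanceAs (Module ℝ ↥(sobolevSubmodule Ω s p k))

/-- The inclusion `W^{s,p}(Ω; ℝ^k) → L^p(Ω; ℝ^k)`. -/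
def toLp : Sobolev Ω s p k →ₗ[ℝ] LpOn Ω p k := (sobolevSubmodule Ω s p k).subtype

lemma exists_weakDeriv (u : Sobolev Ω s p k) (α : MultiIndex d s) :
    ∃ g : LpOn Ω p k, IsWeakDeriv Ω α.exponents (toLp u) g :=
  Subtype.property (p := (· ∈ sobolevSubmodule Ω s p k)) u α

/-- The weak derivative `D^α u ∈ L^p(Ω; ℝ^k)`. -/
def weakDeriv (u : Sobolev Ω s p k) (α : MultiIndex d s) : LpOn Ω p k :=
  (exists_weakDeriv u α).choose

lemma isWeakDeriv_weakDeriv (u : Sobolev Ω s p k) (α : MultiIndex d s) :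
    IsWeakDeriv Ω α.exponents (toLp u) (weakDeriv u α) :=
  (exists_weakDeriv u α).choose_spec

lemma weakDeriv_eq {u : Sobolev Ω s p k} {α : MultiIndex d s} {g : LpOn Ω p k}
    (h : IsWeakDeriv Ω α.exponents (toLp u) g) : weakDeriv u α = g :=
  (isWeakDeriv_weakDeriv u α).unique h

lemma weakDeriv_zero_index (u : Sobolev Ω s p k) :
    weakDeriv u (MultiIndex.zero d s) = toLp u :=
  weakDeriv_eq (isWeakDeriv_zero_index _)

/-- `u ↦ (D^α u)_{|α| ≤ s}`, into the `ℓ^p`-sum of copies of `L^p(Ω; ℝ^k)`. -/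
def jet : Sobolev Ω s p k →ₗ[ℝ] PiLp p (fun _ : MultiIndex d s => LpOn Ω p k) where
  toFun u := WithLp.toLp p (weakDeriv u)
  map_add' u v := by
    ext α : 1
    refine weakDeriv_eq ?_
    rw [map_add]
    exact (isWeakDeriv_weakDeriv u α).add (isWeakDeriv_weakDeriv v α)
  map_smul' c u := by
    ext α : 1
    refine weakDeriv_eq ?_
    rw [map_smul]
    exact (isWeakDeriv_weakDeriv u α).smul c

lemma jet_injective : Function.Injective (jet : Sobolev Ω s p k →ₗ[ℝ] _) := by
  intro u v h
  have h0 : weakDeriv u (MultiIndex.zero d s) = weakDeriv v (MultiIndex.zero d s) :=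
    congrFun (congrArg WithLp.ofLp h) (MultiIndex.zero d s)
  rw [weakDeriv_zero_index, weakDeriv_zero_index] at h0
  exact Subtype.ext h0

/-- The norm `‖u‖_{W^{s,p}} = (∑_{|α| ≤ s} ‖D^α u‖_{L^p}^p)^{1/p}` (see `norm_eq`). -/
instance : NormedAddCommGroup (Sobolev Ω s p k) :=
  NormedAddCommGroup.induced _ _ (jet : Sobolev Ω s p k →ₗ[ℝ] _) jet_injective

instance : NormedSpace ℝ (Sobolev Ω s p k) :=
  NormedSpace.induced ℝ _ _ (jet : Sobolev Ω s p k →ₗ[ℝ] _)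

lemma norm_eq (hp : p ≠ ⊤) (u : Sobolev Ω s p k) :
    ‖u‖ = (∑ α : MultiIndex d s, ‖weakDeriv u α‖ ^ p.toReal) ^ (1 / p.toReal) :=
  PiLp.norm_eq_sum
    (ENNReal.toReal_pos (zero_lt_one.trans_le (Fact.out : 1 ≤ p)).ne' hp) (jet u)

end Sobolev

/-! ### Averaging neural operators -/

/-- Weights and biases of a neural network `ℝ^ι → ℝ^o` with one hidden layer of width `w`. -/
structure ShallowNet (ι : Type) (w o : ℕ) where
  innerWeight : Matrix (Fin w) ι ℝ
  innerBias : Fin w → ℝ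
  outerWeight : Matrix (Fin o) (Fin w) ℝ
  outerBias : Fin o → ℝ

/-- The function `z ↦ A₂ σ(A₁ z + b₁) + b₂` computed by the network, `σ` acting
componentwise. -/
def ShallowNet.eval {ι : Type} [Fintype ι] {w o : ℕ} (N : ShallowNet ι w o) (σ : ℝ → ℝ)
    (z : ι → ℝ) : Fin o → ℝ :=
  N.outerWeight.mulVec (fun j => σ ((N.innerWeight.mulVec z + N.innerBias) j)) + N.outerBias

/-- Parameters of an averaging neural operator with channel dimension `dc`, for functions on a
subset of `ℝ^d`, with input values in `ℝ^k` and output values in `ℝ^k'`: the lifting network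
`R : ℝ^k × ℝ^d → ℝ^dc`, the weight matrix and bias of the hidden layer, and the projection
network `Q : ℝ^dc × ℝ^d → ℝ^k'`; `R` and `Q` have one hidden layer, of width `dc`. -/
structure AveragingNeuralOperator (d k k' dc : ℕ) where
  R : ShallowNet (Fin k ⊕ Fin d) dc dc
  W : Matrix (Fin dc) (Fin dc) ℝ
  b : Fin dc → ℝ
  Q : ShallowNet (Fin dc ⊕ Fin d) dc k'

namespace AveragingNeuralOperator

variable {d k k' dc : ℕ}

/-- The lifting layer `u ↦ R(u(x), x)`. -/
def lift (N : AveragingNeuralOperator d k k' dc) (σ : ℝ → ℝ) (u : E d → E k) :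
    E d → Fin dc → ℝ :=
  fun x => N.R.eval σ (Sum.elim (u x) x)

/-- The hidden layer `v ↦ σ(W v(x) + b + ⨍_Ω v(y) dy)`. -/
def hidden (N : AveragingNeuralOperator d k k' dc) (σ : ℝ → ℝ) (Ω : Set (E d))
    (v : E d → Fin dc → ℝ) : E d → Fin dc → ℝ :=
  fun x j => σ ((N.W.mulVec (v x) + N.b + ⨍ y in Ω, v y) j)

/-- The projection layer `v ↦ Q(v(x), x)`. -/
def project (N : AveragingNeuralOperator d k k' dc) (σ : ℝ → ℝ) (v : E d → Fin dc → ℝ) :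
    E d → E k' :=
  fun x => WithLp.toLp 2 (N.Q.eval σ (Sum.elim (v x) x))

/-- The averaging neural operator `Q ∘ L ∘ R`, on functions. -/
def eval (N : AveragingNeuralOperator d k k' dc) (σ : ℝ → ℝ) (Ω : Set (E d)) (u : E d → E k) :
    E d → E k' :=
  N.project σ (N.hidden σ Ω (N.lift σ u))

end AveragingNeuralOperator

/-- The map `Ψ : W^{s,p}(Ω; ℝ^k) → W^{s',p'}(Ω; ℝ^k')` is an averaging neural operator with
activation function `σ`. -/
def IsAveragingNeuralOperator {d k k' s s' : ℕ} {p p' : ℝ≥0∞} [Fact (1 ≤ p)] [Fact (1 ≤ p')]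
    {Ω : TopologicalSpace.Opens (E d)} (σ : ℝ → ℝ)
    (Ψ : Sobolev Ω s p k → Sobolev Ω s' p' k') : Prop :=
  ∃ (dc : ℕ) (N : AveragingNeuralOperator d k k' dc), ∀ u : Sobolev Ω s p k,
    (Sobolev.toLp (Ψ u) : E d → E k') =ᵐ[volume.restrict (Ω : Set (E d))]
      N.eval σ Ω (Sobolev.toLp u : E d → E k)

end ANO

end

/-! If the weight matrix `W` vanishes, the hidden layer produces a vector that no longer depends on
`x`. Its entries are numbers `σ (α m + β)`, where `m` is the average over `Ω` of a neuron `σ (a ⬝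
(u(y), y) + b)`. Call these numbers features of `u`. The projection network then acts on finitely
many features and on `x`, so it suffices to approximate by sums of terms `σ (y(u) + ⟪w, x⟫ + b) • c`
with `y` in the span `Y` of the features (`featureNet`, `eval_featureOperator`).

Let `V` be the closure of these sums in `C(K, W^{s',p'})`. Difference quotients in the parameters
converge in the Sobolev norm uniformly on `K`, so `V` contains the parameter derivatives.
Differentiating `y` in a direction `y' ∈ Y` multiplies by `y'(u)`, and differentiating `w` in a
coordinate direction multiplies by `xᵢ`; both raise the order of the derivative of `σ` by one
(`smul_ridge_deriv_mem`). After `n` steps `V` contains `q(u) m(x) σ⁽ⁿ⁾(y(u) + ⟪w, x⟫ + b) • c`, with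
`q` a product of elements of `Y` and `m` a monomial. Now put `y = 0` and `w = 0`. No derivative of
`σ` vanishes identically, since `σ` is not a polynomial, so a suitable `b` makes the factor a
nonzero constant and `q(u) m(x) • c` lies in `V` (`submodule_eq_top_of_ridgeMap`).

Three density results finish the argument. By Stone–Weierstrass the products `q` span a dense
subspace of `C(K)`, provided that the features separate points. Polynomials are dense in the Sobolev
space (`submodule_eq_top_of_monomials`). The functions `q • ξ` with constant `ξ` span a dense
subspace of `C(K, W^{s',p'})`, by a partition of unity (`submodule_eq_top_of_smul_const`).

Features separate points by a dual form of the same argument (`exists_feature_ne`). If `u` and `v`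
have equal features, differentiating the averages of `σ (t uᵢ + ⟪w, y⟫ + b)` at `t = 0` shows that
`uᵢ - vᵢ` is orthogonal to all `σ' (⟪w, y⟫ + b)`. Differentiating in `w` makes it orthogonal to all
monomials, so it vanishes.

Density of polynomials has two stages. A Lipschitz boundary gives a local cone condition, so that
mollifiers shifted along the axis of the cone stay inside `Ω`; a partition of unity then gives
density of smooth functions (`closure_smoothSubmodule`). Convolution with powers of the Landau
kernel turns smooth functions into polynomials, with uniform control of derivatives
(`exists_polyFun_near`). -/

noncomputable section

namespace ANO

/-! ### Iterated directional derivatives -/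

section DirectionalDerivatives

variable {Z Z' : Type*} [NormedAddCommGroup Z] [NormedSpace ℝ Z]
  [NormedAddCommGroup Z'] [NormedSpace ℝ Z'] {d : ℕ}

/-- The derivative of `f` in the direction `v`. -/
def dirDeriv (v : Z) (f : Z → ℝ) : Z → ℝ := fun z => fderiv ℝ f z v

/-- The iterated directional derivative of multi-order `α` along the directions `v i`. -/
def iterDirDeriv (v : Fin d → Z) (α : Fin d → ℕ) (f : Z → ℝ) : Z → ℝ :=
  (List.finRange d).foldr (fun i g => (dirDeriv (v i))^[α i] g) f

/-- The standard basis vectors of `ℝ^d`. -/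
abbrev stdVec (d : ℕ) (i : Fin d) : E d := EuclideanSpace.single i 1

lemma multiDeriv_eq_iterDirDeriv (α : Fin d → ℕ) (f : E d → ℝ) :
    multiDeriv α f = iterDirDeriv (stdVec d) α f := rfl

/-- A relation preserved by the directional derivatives is preserved by the iterated ones. -/
lemma iterDirDeriv_rel {R : (Z → ℝ) → (Z' → ℝ) → Prop} {v : Fin d → Z} {v' : Fin d → Z'}
    {f : Z → ℝ} {f' : Z' → ℝ} (h0 : R f f')
    (hs : ∀ i g g', R g g' → R (dirDeriv (v i) g) (dirDeriv (v' i) g')) (α : Fin d → ℕ) :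
    R (iterDirDeriv v α f) (iterDirDeriv v' α f') := by
  unfold iterDirDeriv
  induction List.finRange d with
  | nil => exact h0
  | cons i l ih =>
    simp only [List.foldr_cons]
    generalize List.foldr (fun i g => (dirDeriv (v i))^[α i] g) f l = g at ih ⊢
    generalize List.foldr (fun i g => (dirDeriv (v' i))^[α i] g) f' l = g' at ih ⊢
    induction α i with
    | zero => exact ih
    | succ n ihn =>
      rw [Function.iterate_succ_apply', Function.iterate_succ_apply']
      exact hs i _ _ ihn

lemma contDiff_dirDeriv {f : Z → ℝ} (hf : ContDiff ℝ ∞ f) (v : Z) :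
    ContDiff ℝ ∞ (dirDeriv v f) := by
  have h1 : ContDiff ℝ ∞ (fderiv ℝ f) := hf.fderiv_right (by simp)
  exact h1.clm_apply contDiff_const

lemma contDiff_iterDirDeriv {f : Z → ℝ} (hf : ContDiff ℝ ∞ f) (v : Fin d → Z) (α : Fin d → ℕ) :
    ContDiff ℝ ∞ (iterDirDeriv v α f) :=
  iterDirDeriv_rel (R := fun g (_ : Z → ℝ) => ContDiff ℝ ∞ g) (v' := v) (f' := f) hf
    (fun i _ _ h => contDiff_dirDeriv h (v i)) α

lemma dirDeriv_comm {f : Z → ℝ} (hf : ContDiff ℝ ∞ f) (v w : Z) :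
    dirDeriv v (dirDeriv w f) = dirDeriv w (dirDeriv v f) := by
  have h1 : ContDiff ℝ ∞ (fderiv ℝ f) := hf.fderiv_right (by simp)
  have h2 : Differentiable ℝ (fderiv ℝ f) := h1.differentiable (by simp)
  have key (a b : Z) (z : Z) : dirDeriv a (dirDeriv b f) z = fderiv ℝ (fderiv ℝ f) z a b := by
    unfold dirDeriv
    rw [fderiv_clm_apply (h2 z) (differentiableAt_const b)]
    simp
  ext z
  rw [key, key]
  exact (hf.contDiffAt.isSymmSndFDerivAt (by
    simp only [minSmoothness_of_isRCLikeNormedField]; exact WithTop.coe_le_coe.2 (le_top : (2 : ℕ∞) ≤ ⊤))).eq v w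

lemma dirDeriv_iterDirDeriv {f : Z → ℝ} (hf : ContDiff ℝ ∞ f) (w : Z) (v : Fin d → Z)
    (α : Fin d → ℕ) :
    dirDeriv w (iterDirDeriv v α f) = iterDirDeriv v α (dirDeriv w f) :=
  (iterDirDeriv_rel (R := fun g g' => ContDiff ℝ ∞ g ∧ dirDeriv w g = g') (v := v) (v' := v)
    ⟨hf, rfl⟩ (fun i g g' h => ⟨contDiff_dirDeriv h.1 _, by rw [dirDeriv_comm h.1, h.2]⟩) α).2

lemma iterDirDeriv_zero (v : Fin d → Z) (f : Z → ℝ) : iterDirDeriv v 0 f = f := by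
  unfold iterDirDeriv
  induction List.finRange d with
  | nil => rfl
  | cons i l ih => rw [List.foldr_cons, ih]; rfl

/-- Derivatives are applied in the fixed order of `List.finRange d`. Since they commute, the
additional one can be moved innermost, which is the form needed for induction on multi-indices. -/
lemma iterDirDeriv_add_single {f : Z → ℝ} (hf : ContDiff ℝ ∞ f) (v : Fin d → Z)
    (α : Fin d → ℕ) (i : Fin d) :
    iterDirDeriv v (α + Pi.single i 1) f = iterDirDeriv v α (dirDeriv (v i) f) := by
  unfold iterDirDeriv
  -- On a list without repetitions the raised exponent is met exactly once if `i` occurs and never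
  -- otherwise. Smoothness and commutation are carried along because the case of a new head needs
  -- them.
  have aux : ∀ l : List (Fin d), l.Nodup →
      ContDiff ℝ ∞ (l.foldr (fun j g => (dirDeriv (v j))^[α j] g) f) ∧
      dirDeriv (v i) (l.foldr (fun j g => (dirDeriv (v j))^[α j] g) f) =
        l.foldr (fun j g => (dirDeriv (v j))^[α j] g) (dirDeriv (v i) f) ∧
      l.foldr (fun j g => (dirDeriv (v j))^[(α + Pi.single i 1 : Fin d → ℕ) j] g) f =
        if i ∈ l then l.foldr (fun j g => (dirDeriv (v j))^[α j] g) (dirDeriv (v i) f)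
        else l.foldr (fun j g => (dirDeriv (v j))^[α j] g) f := by
    intro l hl
    induction l with
    | nil => exact ⟨hf, rfl, by simp⟩
    | cons j l ih =>
      obtain ⟨h1, h2, h3⟩ := ih hl.of_cons
      have it : ∀ n, ContDiff ℝ ∞ ((dirDeriv (v j))^[n]
          (l.foldr (fun j g => (dirDeriv (v j))^[α j] g) f)) ∧
          dirDeriv (v i) ((dirDeriv (v j))^[n] (l.foldr (fun j g => (dirDeriv (v j))^[α j] g) f)) =
            (dirDeriv (v j))^[n] (l.foldr (fun j g => (dirDeriv (v j))^[α j] g)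
              (dirDeriv (v i) f)) := by
        intro n
        induction n with
        | zero => exact ⟨h1, h2⟩
        | succ n ihn =>
          simp only [Function.iterate_succ_apply']
          exact ⟨contDiff_dirDeriv ihn.1 _, by rw [dirDeriv_comm ihn.1, ihn.2]⟩
      simp only [List.foldr_cons]
      refine ⟨(it _).1, (it _).2, ?_⟩
      rw [h3]
      by_cases hij : i = j
      · subst hij
        have hil : i ∉ l := (List.nodup_cons.mp hl).1
        rw [if_neg hil, if_pos List.mem_cons_self]
        simp only [Pi.add_apply, Pi.single_eq_same, Function.iterate_succ_apply']
        exact (it _).2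
      · have : (α + Pi.single i 1 : Fin d → ℕ) j = α j := by
          simp [Pi.single_eq_of_ne (Ne.symm hij)]
        rw [this]
        by_cases hil : i ∈ l
        · rw [if_pos hil, if_pos (List.mem_cons_of_mem _ hil)]
        · rw [if_neg hil, if_neg (by simp [hij, hil])]
  have := (aux (List.finRange d) (List.nodup_finRange d)).2.2
  rwa [if_pos (List.mem_finRange i)] at this

/-- Induction on multi-indices, raising one entry at a time. -/
lemma multiIndex_induction {P : (Fin d → ℕ) → Prop} (h0 : P 0)
    (hs : ∀ α i, P α → P (α + Pi.single i 1)) (α : Fin d → ℕ) : P α := by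
  obtain ⟨n, hn⟩ : ∃ n, ∑ i, α i = n := ⟨_, rfl⟩
  induction n generalizing α with
  | zero =>
    have : α = 0 := by
      funext i
      exact (Finset.sum_eq_zero_iff.mp hn) i (Finset.mem_univ i)
    rwa [this]
  | succ n ih =>
    obtain ⟨i, hi⟩ : ∃ i, α i ≠ 0 := by
      by_contra! h
      simp [h] at hn
    have hα : α = (α - Pi.single i 1) + Pi.single i 1 := by
      funext j
      by_cases hj : j = i
      · subst hj; simp; omega
      · simp [Pi.single_eq_of_ne hj]
    rw [hα]
    refine hs _ _ (ih _ ?_)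
    rw [hα] at hn
    simp only [Pi.add_apply, Finset.sum_add_distrib, Finset.sum_pi_single', Finset.mem_univ,
      if_true] at hn
    omega

lemma sum_add_single (α : Fin d → ℕ) (i : Fin d) :
    ∑ j, (α + Pi.single i 1 : Fin d → ℕ) j = ∑ j, α j + 1 := by
  simp [Finset.sum_add_distrib]

lemma dirDeriv_comp_affine {f : Z' → ℝ} (hf : ContDiff ℝ ∞ f) (z₀ : Z') (L : Z →L[ℝ] Z') (v : Z) :
    dirDeriv v (fun x => f (z₀ + L x)) = fun x => dirDeriv (L v) f (z₀ + L x) := by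
  ext x
  have h1 : HasFDerivAt (fun x => z₀ + L x) L x := L.hasFDerivAt.const_add z₀
  have h2 := ((hf.differentiable (by simp)) (z₀ + L x)).hasFDerivAt.comp x h1
  unfold dirDeriv
  have h3 : fderiv ℝ (fun x => f (z₀ + L x)) x = _ := h2.fderiv
  rw [h3]; rfl

lemma iterDirDeriv_comp_affine {f : Z' → ℝ} (hf : ContDiff ℝ ∞ f) (z₀ : Z') (L : Z →L[ℝ] Z')
    (v : Fin d → Z) (α : Fin d → ℕ) :
    iterDirDeriv v α (fun x => f (z₀ + L x)) =
      fun x => iterDirDeriv (fun i => L (v i)) α f (z₀ + L x) :=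
  (iterDirDeriv_rel (R := fun g g' => ContDiff ℝ ∞ g' ∧ g = fun x => g' (z₀ + L x))
    (v := v) (v' := fun i => L (v i)) ⟨hf, rfl⟩
    (fun i g g' h => ⟨contDiff_dirDeriv h.1 _, by rw [h.2, dirDeriv_comp_affine h.1]⟩) α).2

lemma dirDeriv_add {f g : Z → ℝ} (hf : ContDiff ℝ ∞ f) (hg : ContDiff ℝ ∞ g) (v : Z) :
    dirDeriv v (f + g) = dirDeriv v f + dirDeriv v g := by
  ext z
  simp only [dirDeriv, Pi.add_apply]
  rw [fderiv_add (hf.differentiable (by simp) z) (hg.differentiable (by simp) z)]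
  rfl

lemma dirDeriv_smul {f : Z → ℝ} (hf : ContDiff ℝ ∞ f) (c : ℝ) (v : Z) :
    dirDeriv v (c • f) = c • dirDeriv v f := by
  ext z
  simp only [dirDeriv, Pi.smul_apply]
  rw [fderiv_const_smul (hf.differentiable (by simp) z)]
  rfl

lemma iterDirDeriv_add {f g : Z → ℝ} (hf : ContDiff ℝ ∞ f) (hg : ContDiff ℝ ∞ g)
    (v : Fin d → Z) (α : Fin d → ℕ) :
    iterDirDeriv v α (f + g) = iterDirDeriv v α f + iterDirDeriv v α g := by
  induction α using multiIndex_induction generalizing f g with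
  | h0 => simp [iterDirDeriv_zero]
  | hs α i ih =>
    rw [iterDirDeriv_add_single hf, iterDirDeriv_add_single hg,
      iterDirDeriv_add_single (f := f + g) (hf.add hg), dirDeriv_add hf hg,
      ih (contDiff_dirDeriv hf _) (contDiff_dirDeriv hg _)]

lemma iterDirDeriv_smul {f : Z → ℝ} (hf : ContDiff ℝ ∞ f) (c : ℝ)
    (v : Fin d → Z) (α : Fin d → ℕ) :
    iterDirDeriv v α (c • f) = c • iterDirDeriv v α f := by
  induction α using multiIndex_induction generalizing f with
  | h0 => simp [iterDirDeriv_zero]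
  | hs α i ih =>
    rw [iterDirDeriv_add_single hf, iterDirDeriv_add_single (f := c • f) (hf.const_smul c),
      dirDeriv_smul hf, ih (contDiff_dirDeriv hf _)]

/-- Supplies the sign that arises when a kernel `ρ (x - y)` is differentiated in `y` instead of `x`.
-/
lemma iterDirDeriv_neg_directions {f : Z → ℝ} (hf : ContDiff ℝ ∞ f)
    (v : Fin d → Z) (α : Fin d → ℕ) :
    iterDirDeriv (fun i => -v i) α f = (-1 : ℝ) ^ (∑ i, α i) • iterDirDeriv v α f := by
  induction α using multiIndex_induction generalizing f with
  | h0 => simp [iterDirDeriv_zero]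
  | hs α i ih =>
    have h : dirDeriv (-v i) f = (-1 : ℝ) • dirDeriv (v i) f := by
      ext z; simp [dirDeriv]
    rw [iterDirDeriv_add_single hf, iterDirDeriv_add_single hf, h,
      iterDirDeriv_smul (contDiff_dirDeriv hf _), ih (contDiff_dirDeriv hf _), smul_smul,
      sum_add_single, pow_succ']

lemma hasCompactSupport_dirDeriv {f : Z → ℝ} (hf : HasCompactSupport f) (v : Z) :
    HasCompactSupport (dirDeriv v f) := hf.fderiv_apply ℝ v

lemma hasCompactSupport_iterDirDeriv {f : Z → ℝ} (hf : HasCompactSupport f)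
    (v : Fin d → Z) (α : Fin d → ℕ) : HasCompactSupport (iterDirDeriv v α f) :=
  iterDirDeriv_rel (R := fun g (_ : Z → ℝ) => HasCompactSupport g) (v' := v) (f' := f) hf
    (fun i _ _ h => hasCompactSupport_dirDeriv h (v i)) α

lemma tsupport_iterDirDeriv_subset (f : Z → ℝ) (v : Fin d → Z) (α : Fin d → ℕ) :
    tsupport (iterDirDeriv v α f) ⊆ tsupport f :=
  iterDirDeriv_rel (R := fun g (_ : Z → ℝ) => tsupport g ⊆ tsupport f) (v' := v) (f' := f)
    Subset.rfl (fun _ _ _ h => (tsupport_fderiv_apply_subset ℝ _).trans h) α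

end DirectionalDerivatives

/-! ### Derivatives of convolutions -/

section Convolution

variable {d : ℕ}

open Convolution in
-- All derivatives fall on the smooth kernel, so `g` need only be locally integrable.
lemma dirDeriv_convolution {ρ g : E d → ℝ} (hρ : ContDiff ℝ ∞ ρ) (hc : HasCompactSupport ρ)
    (hg : LocallyIntegrable g volume) (v : E d) :
    dirDeriv v (fun x => ∫ y, ρ (x - y) * g y) = fun x => ∫ y, dirDeriv v ρ (x - y) * g y := by
  have conv (f : E d → ℝ) : (fun x => ∫ y, f (x - y) * g y) =
      MeasureTheory.convolution g f (ContinuousLinearMap.lsmul ℝ ℝ) volume := by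
    ext x
    simp only [MeasureTheory.convolution, ContinuousLinearMap.lsmul_apply, smul_eq_mul]
    congr 1; ext y; ring
  ext x
  have h1 := hc.hasFDerivAt_convolution_right (ContinuousLinearMap.lsmul ℝ ℝ) hg
    (hρ.of_le (by simp) : ContDiff ℝ 1 ρ) x
  rw [conv]
  unfold dirDeriv
  rw [h1.fderiv, convolution_precompR_apply _ hg (hc.fderiv ℝ)
    (hρ.continuous_fderiv (by simp))]
  simp only [MeasureTheory.convolution, ContinuousLinearMap.lsmul_apply, smul_eq_mul]
  congr 1; ext y; ring

lemma contDiff_convolution {ρ g : E d → ℝ} (hρ : ContDiff ℝ ∞ ρ) (hc : HasCompactSupport ρ)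
    (hg : LocallyIntegrable g volume) : ContDiff ℝ ∞ (fun x => ∫ y, ρ (x - y) * g y) := by
  have conv : (fun x => ∫ y, ρ (x - y) * g y) =
      MeasureTheory.convolution g ρ (ContinuousLinearMap.lsmul ℝ ℝ) volume := by
    ext x
    simp only [MeasureTheory.convolution, ContinuousLinearMap.lsmul_apply, smul_eq_mul]
    congr 1; ext y; ring
  rw [conv]
  exact hc.contDiff_convolution_right _ hg hρ

lemma iterDirDeriv_convolution {ρ g : E d → ℝ} (hρ : ContDiff ℝ ∞ ρ) (hc : HasCompactSupport ρ)
    (hg : LocallyIntegrable g volume) (v : Fin d → E d) (α : Fin d → ℕ) :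
    iterDirDeriv v α (fun x => ∫ y, ρ (x - y) * g y) =
      fun x => ∫ y, iterDirDeriv v α ρ (x - y) * g y :=
  (iterDirDeriv_rel (R := fun f ρ => (ContDiff ℝ ∞ ρ ∧ HasCompactSupport ρ) ∧
    f = fun x => ∫ y, ρ (x - y) * g y) (v := v) (v' := v) ⟨⟨hρ, hc⟩, rfl⟩
    (fun i f ρ h => ⟨⟨contDiff_dirDeriv h.1.1 _, hasCompactSupport_dirDeriv h.1.2 _⟩, by
      rw [h.2, dirDeriv_convolution h.1.1 h.1.2 hg]⟩) α).2

end Convolution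

/-! ### Smooth functions as elements of Sobolev spaces -/

section SmoothFunctions

variable {d : ℕ}

/-- Smooth functions on `ℝ^d`. -/
def smoothFun (d : ℕ) : Submodule ℝ (E d → ℝ) where
  carrier := {g | ContDiff ℝ ∞ g}
  add_mem' {f g} hf hg := ContDiff.add (show ContDiff ℝ ∞ f from hf) (show ContDiff ℝ ∞ g from hg)
  zero_mem' := show ContDiff ℝ ∞ (fun _ => 0) from contDiff_const
  smul_mem' c f hf := (show ContDiff ℝ ∞ f from hf).const_smul c

lemma contDiff_smoothFun (g : smoothFun d) : ContDiff ℝ ∞ g.1 := g.2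

lemma multiDeriv_smul (α : Fin d → ℕ) (a : ℝ) (g : smoothFun d) (x : E d) :
    multiDeriv α (a • g).1 x = a * multiDeriv α g.1 x :=
  congrFun (iterDirDeriv_smul (contDiff_smoothFun g) a (stdVec d) α) x

lemma multiDeriv_add (α : Fin d → ℕ) (f g : smoothFun d) (x : E d) :
    multiDeriv α (f + g).1 x = multiDeriv α f.1 x + multiDeriv α g.1 x :=
  congrFun (iterDirDeriv_add (contDiff_smoothFun f) (contDiff_smoothFun g) (stdVec d) α) x

lemma multiDeriv_sub (α : Fin d → ℕ) (f g : smoothFun d) (x : E d) :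
    multiDeriv α (f - g).1 x = multiDeriv α f.1 x - multiDeriv α g.1 x := by
  have : f - g = f + (-1 : ℝ) • g := by module
  rw [this, multiDeriv_add, multiDeriv_smul]
  ring

/-- Integration by parts, one derivative at a time; compact support of `φ` removes the boundary
terms. -/
lemma integral_iterDirDeriv_mul {φ g : E d → ℝ} (hφ : ContDiff ℝ ∞ φ) (hc : HasCompactSupport φ)
    (hg : ContDiff ℝ ∞ g) (v : Fin d → E d) (α : Fin d → ℕ) :
    ∫ x, iterDirDeriv v α φ x * g x =
      (-1 : ℝ) ^ (∑ i, α i) * ∫ x, φ x * iterDirDeriv v α g x := by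
  induction α using multiIndex_induction generalizing φ with
  | h0 => simp [iterDirDeriv_zero]
  | hs α i ih =>
    have hD : ContDiff ℝ ∞ (iterDirDeriv v α g) := contDiff_iterDirDeriv hg v α
    rw [iterDirDeriv_add_single hφ, ih (contDiff_dirDeriv hφ _) (hasCompactSupport_dirDeriv hc _),
      iterDirDeriv_add_single hg, ← dirDeriv_iterDirDeriv hg, sum_add_single]
    have h := integral_mul_fderiv_eq_neg_fderiv_mul_of_integrable (μ := volume)
      (f := φ) (g := iterDirDeriv v α g) (v := v i)
      (((contDiff_dirDeriv hφ (v i)).continuous.mul hD.continuous).integrable_of_hasCompactSupport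
        (hasCompactSupport_dirDeriv hc (v i)).mul_right)
      ((hφ.continuous.mul (contDiff_dirDeriv hD (v i)).continuous).integrable_of_hasCompactSupport
        hc.mul_right)
      ((hφ.continuous.mul hD.continuous).integrable_of_hasCompactSupport hc.mul_right)
      (fun x _ => hφ.differentiable (by simp) x) (fun x _ => hD.differentiable (by simp) x)
    unfold dirDeriv
    rw [h]
    ring

lemma setIntegral_eq_of_tsupport_subset {F : Type*} [NormedAddCommGroup F] [NormedSpace ℝ F]
    {Ω : Set (E d)} {φ : E d → ℝ} (h : tsupport φ ⊆ Ω) (f : E d → F) :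
    ∫ x in Ω, φ x • f x = ∫ x, φ x • f x := by
  refine setIntegral_eq_integral_of_forall_compl_eq_zero fun x hx => ?_
  rw [image_eq_zero_of_notMem_tsupport fun h' => hx (h h'), zero_smul]

/-- Classical derivatives of smooth functions are weak derivatives. -/
lemma isWeakDeriv_of_contDiff {k : ℕ} (Ω : Set (E d)) {g : E d → ℝ} (hg : ContDiff ℝ ∞ g)
    (c : E k) (α : Fin d → ℕ) :
    IsWeakDeriv Ω α (fun x => g x • c) (fun x => multiDeriv α g x • c) := by
  intro φ hφ
  rw [setIntegral_eq_of_tsupport_subset (hφ.multiDeriv α).tsupport_subset,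
    setIntegral_eq_of_tsupport_subset hφ.tsupport_subset]
  simp only [smul_smul]
  rw [integral_smul_const, integral_smul_const, smul_smul]
  congr 1
  exact integral_iterDirDeriv_mul hφ.contDiff hφ.hasCompactSupport hg _ α

lemma IsWeakDeriv.congr {k : ℕ} {Ω : Set (E d)} {α : Fin d → ℕ} {f f' g g' : E d → E k}
    (h : IsWeakDeriv Ω α f g) (hf : f =ᵐ[volume.restrict Ω] f') (hg : g =ᵐ[volume.restrict Ω] g') :
    IsWeakDeriv Ω α f' g' := by
  intro φ hφ
  rw [← integral_congr_ae (hf.mono fun x hx => by simp only [hx] :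
      (fun x => multiDeriv α φ x • f x) =ᵐ[volume.restrict Ω] fun x => multiDeriv α φ x • f' x),
    ← integral_congr_ae (hg.mono fun x hx => by simp only [hx] :
      (fun x => φ x • g x) =ᵐ[volume.restrict Ω] fun x => φ x • g' x)]
  exact h φ hφ

variable {Ω : TopologicalSpace.Opens (E d)} {s : ℕ} {p : ℝ≥0∞} {k : ℕ}

lemma isFiniteMeasure_restrict_of_isBounded (hΩ : Bornology.IsBounded (Ω : Set (E d))) :
    IsFiniteMeasure (volume.restrict (Ω : Set (E d))) :=
  ⟨by rw [Measure.restrict_apply_univ]; exact hΩ.measure_lt_top⟩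

lemma exists_bound_of_continuous (hΩ : Bornology.IsBounded (Ω : Set (E d)))
    {F : Type*} [NormedAddCommGroup F] {g : E d → F} (hg : Continuous g) :
    ∃ C, ∀ x ∈ closure (Ω : Set (E d)), ‖g x‖ ≤ C := by
  obtain ⟨C, hC⟩ := hΩ.isCompact_closure.exists_bound_of_continuousOn hg.continuousOn
  exact ⟨C, hC⟩

lemma memLp_of_continuous (hΩ : Bornology.IsBounded (Ω : Set (E d))) {g : E d → E k}
    (hg : Continuous g) : MemLp g p (volume.restrict (Ω : Set (E d))) := by
  have := isFiniteMeasure_restrict_of_isBounded hΩ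
  obtain ⟨C, hC⟩ := exists_bound_of_continuous hΩ hg
  refine MemLp.of_bound hg.aestronglyMeasurable C ?_
  filter_upwards [ae_restrict_mem Ω.isOpen.measurableSet] with x hx
  exact hC x (subset_closure hx)

variable [Fact (1 ≤ p)]

/-- An element of the Sobolev space from a function and its weak derivatives. -/
def Sobolev.mk (f : E d → E k) (hf : MemLp f p (volume.restrict (Ω : Set (E d))))
    (h : ∀ α : MultiIndex d s, ∃ g, MemLp g p (volume.restrict (Ω : Set (E d))) ∧
      IsWeakDeriv Ω α.exponents f g) : Sobolev Ω s p k :=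
  ⟨hf.toLp f, fun α => by
    obtain ⟨g, hg, hw⟩ := h α
    exact ⟨hg.toLp g, hw.congr hf.coeFn_toLp.symm hg.coeFn_toLp.symm⟩⟩

lemma Sobolev.toLp_mk {f : E d → E k} (hf : MemLp f p (volume.restrict (Ω : Set (E d))))
    (h : ∀ α : MultiIndex d s, ∃ g, MemLp g p (volume.restrict (Ω : Set (E d))) ∧
      IsWeakDeriv Ω α.exponents f g) :
    (toLp (mk f hf h) : E d → E k) =ᵐ[volume.restrict (Ω : Set (E d))] f :=
  hf.coeFn_toLp

lemma Sobolev.ext_ae {u v : Sobolev Ω s p k}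
    (h : (toLp u : E d → E k) =ᵐ[volume.restrict (Ω : Set (E d))] toLp v) : u = v :=
  Subtype.ext (Lp.ext h)

lemma Sobolev.weakDeriv_ae_eq {u : Sobolev Ω s p k} {f g : E d → E k} {α : MultiIndex d s}
    (hu : (toLp u : E d → E k) =ᵐ[volume.restrict (Ω : Set (E d))] f)
    (hg : MemLp g p (volume.restrict (Ω : Set (E d)))) (h : IsWeakDeriv Ω α.exponents f g) :
    (weakDeriv u α : E d → E k) =ᵐ[volume.restrict (Ω : Set (E d))] g := by
  rw [weakDeriv_eq (h.congr hu.symm hg.coeFn_toLp.symm)]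
  exact hg.coeFn_toLp

/-- The triangle inequality for the decomposition of the jet into its components. It replaces the
`ℓ^p` norm by a sum that needs no case distinction on `p`. -/
lemma Sobolev.norm_le_sum (u : Sobolev Ω s p k) : ‖u‖ ≤ ∑ α, ‖weakDeriv u α‖ := by
  classical
  have h : jet u = ∑ α, PiLp.single p α (weakDeriv u α) := by
    ext α : 1
    simp [jet]
  change ‖jet u‖ ≤ _
  rw [h]
  refine (norm_sum_le _ _).trans (le_of_eq ?_)
  simp [PiLp.norm_single]

lemma Sobolev.norm_toLp_le (u : Sobolev Ω s p k) : ‖toLp u‖ ≤ ‖u‖ := by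
  rw [← weakDeriv_zero_index]
  exact PiLp.norm_apply_le (jet u) (MultiIndex.zero d s)

lemma Sobolev.weakDeriv_sub (u v : Sobolev Ω s p k) (α : MultiIndex d s) :
    weakDeriv (u - v) α = weakDeriv u α - weakDeriv v α := by
  have := congrArg (fun j => j α) (map_sub (jet : Sobolev Ω s p k →ₗ[ℝ] _) u v)
  exact this

/-- The element `x ↦ g x • c` of the Sobolev space of a bounded domain, for `g` smooth on `ℝ^d`. -/
def smoothSobolev (hΩ : Bornology.IsBounded (Ω : Set (E d))) (s : ℕ) (p : ℝ≥0∞) [Fact (1 ≤ p)]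
    (c : E k) : smoothFun d →ₗ[ℝ] Sobolev Ω s p k where
  toFun g := Sobolev.mk (fun x => g.1 x • c)
    (memLp_of_continuous hΩ ((contDiff_smoothFun g).continuous.smul continuous_const))
    (fun α => ⟨fun x => multiDeriv α.exponents g.1 x • c,
      memLp_of_continuous hΩ ((contDiff_iterDirDeriv (contDiff_smoothFun g) _ _).continuous.smul continuous_const),
      isWeakDeriv_of_contDiff _ (contDiff_smoothFun g) c _⟩)
  map_add' f g := by
    refine Sobolev.ext_ae ?_
    rw [map_add]
    filter_upwards [Sobolev.toLp_mk (Ω := Ω) (s := s) (p := p) (f := fun x => (f + g).1 x • c) _ _,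
      Sobolev.toLp_mk (Ω := Ω) (s := s) (p := p) (f := fun x => f.1 x • c) _ _,
      Sobolev.toLp_mk (Ω := Ω) (s := s) (p := p) (f := fun x => g.1 x • c) _ _,
      Lp.coeFn_add (Sobolev.toLp (Sobolev.mk (Ω := Ω) (s := s) (p := p) (fun x => f.1 x • c) _ _))
        (Sobolev.toLp (Sobolev.mk (Ω := Ω) (s := s) (p := p) (fun x => g.1 x • c) _ _))]
      with x h1 h2 h3 h4
    rw [h4, h1, Pi.add_apply, h2, h3, ← add_smul]
    rfl
  map_smul' a f := by
    refine Sobolev.ext_ae ?_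
    rw [map_smul]
    filter_upwards [Sobolev.toLp_mk (Ω := Ω) (s := s) (p := p) (f := fun x => (a • f).1 x • c) _ _,
      Sobolev.toLp_mk (Ω := Ω) (s := s) (p := p) (f := fun x => f.1 x • c) _ _,
      Lp.coeFn_smul a
        (Sobolev.toLp (Sobolev.mk (Ω := Ω) (s := s) (p := p) (fun x => f.1 x • c) _ _))]
      with x h1 h2 h4
    simp only [RingHom.id_apply]
    rw [h4, h1, Pi.smul_apply, h2, smul_smul]
    rfl

variable (hΩ : Bornology.IsBounded (Ω : Set (E d)))

lemma toLp_smoothSobolev (c : E k) (g : smoothFun d) :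
    (Sobolev.toLp (smoothSobolev hΩ s p c g) : E d → E k)
      =ᵐ[volume.restrict (Ω : Set (E d))] fun x => g.1 x • c :=
  (memLp_of_continuous hΩ ((contDiff_smoothFun g).continuous.smul continuous_const)).coeFn_toLp

lemma weakDeriv_smoothSobolev (c : E k) (g : smoothFun d) (α : MultiIndex d s) :
    (Sobolev.weakDeriv (smoothSobolev hΩ s p c g) α : E d → E k)
      =ᵐ[volume.restrict (Ω : Set (E d))] fun x => multiDeriv α.exponents g.1 x • c :=
  Sobolev.weakDeriv_ae_eq (toLp_smoothSobolev hΩ c g)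
    (memLp_of_continuous hΩ ((contDiff_iterDirDeriv (contDiff_smoothFun g) _ _).continuous.smul continuous_const))
    (isWeakDeriv_of_contDiff _ (contDiff_smoothFun g) c _)

/-- The Sobolev norm of a smooth function is controlled by its derivatives on `Ω`. -/
lemma exists_norm_smoothSobolev_le (s : ℕ) (p : ℝ≥0∞) [Fact (1 ≤ p)] (c : E k) :
    ∃ C : ℝ, 0 < C ∧ ∀ (g : smoothFun d) (M : ℝ), 0 ≤ M →
      (∀ (α : MultiIndex d s), ∀ x ∈ Ω, |multiDeriv α.exponents g.1 x| ≤ M) →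
      ‖smoothSobolev hΩ s p c g‖ ≤ C * M := by
  have := isFiniteMeasure_restrict_of_isBounded hΩ
  set V : ℝ := (measureUnivNNReal (volume.restrict (Ω : Set (E d))) : ℝ) ^ p.toReal⁻¹ with hV
  have hV0 : 0 ≤ V := by positivity
  -- The summand 1 keeps the constant positive even for `c = 0`; later tolerances are divided by it.
  refine ⟨Fintype.card (MultiIndex d s) * (V * ‖c‖) + 1, by positivity, fun g M hM h => ?_⟩
  calc ‖smoothSobolev hΩ s p c g‖ ≤ ∑ α, ‖Sobolev.weakDeriv (smoothSobolev hΩ s p c g) α‖ :=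
        Sobolev.norm_le_sum _
    _ ≤ ∑ α : MultiIndex d s, V * (M * ‖c‖) := by
        refine Finset.sum_le_sum fun α _ => ?_
        refine Lp.norm_le_of_ae_bound (p := p) (by positivity) ?_
        filter_upwards [weakDeriv_smoothSobolev (p := p) hΩ c g α,
          ae_restrict_mem Ω.isOpen.measurableSet] with x hx hm
        rw [hx, norm_smul]
        exact mul_le_mul_of_nonneg_right (h α x hm) (norm_nonneg c)
    _ = Fintype.card (MultiIndex d s) * (V * ‖c‖) * M := by
        rw [Finset.sum_const, Finset.card_univ, nsmul_eq_mul]; ring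
    _ ≤ _ := by nlinarith

end SmoothFunctions

/-! ### Smooth dependence on parameters in the Sobolev norm -/

section Parameters

variable {d : ℕ} {Ω : TopologicalSpace.Opens (E d)} (hΩ : Bornology.IsBounded (Ω : Set (E d)))
  {s : ℕ} {p : ℝ≥0∞} [Fact (1 ≤ p)] {k : ℕ}
  {P : Type*} [NormedAddCommGroup P] [NormedSpace ℝ P]

/-- The slice `x ↦ h (q, x)` of a smooth function of a parameter `q` and of `x`. -/
def slice (h : P × E d → ℝ) (hh : ContDiff ℝ ∞ h) (q : P) : smoothFun d :=
  ⟨fun x => h (q, x), hh.comp (contDiff_const.prodMk contDiff_id)⟩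

/-- Derivatives in `x` alone become derivatives of the joint function, hence are jointly continuous
in `(q, x)` and commute with derivatives in the parameter. -/
lemma multiDeriv_slice {h : P × E d → ℝ} (hh : ContDiff ℝ ∞ h) (q : P) (α : Fin d → ℕ) (x : E d) :
    multiDeriv α (slice h hh q).1 x =
      iterDirDeriv (fun i => ((0 : P), stdVec d i)) α h (q, x) := by
  have h1 := iterDirDeriv_comp_affine hh (q, (0 : E d)) (ContinuousLinearMap.inr ℝ P (E d))
    (stdVec d) α
  have h2 : (slice h hh q).1 =
      fun x => h ((q, (0 : E d)) + ContinuousLinearMap.inr ℝ P (E d) x) := by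
    ext x; simp [slice]
  rw [multiDeriv_eq_iterDirDeriv, h2, h1]
  simp

/-- A smooth function of a parameter and of `x` gives a continuous map from the parameters to the
Sobolev space. -/
lemma continuous_smoothSobolev_slice {h : P × E d → ℝ} (hh : ContDiff ℝ ∞ h) (c : E k) :
    Continuous fun q => smoothSobolev hΩ s p c (slice h hh q) := by
  obtain ⟨C, hC, hbound⟩ := exists_norm_smoothSobolev_le hΩ s p c
  have : CompactSpace (closure (Ω : Set (E d))) := isCompact_iff_compactSpace.1 hΩ.isCompact_closure
  have hcont (α : MultiIndex d s) : Continuous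
      (iterDirDeriv (fun i => ((0 : P), stdVec d i)) α.exponents h) :=
    (contDiff_iterDirDeriv hh _ _).continuous
  -- Currying turns joint continuity into continuity for the supremum norm over the compact closure
  -- of `Ω`.
  let F (α : MultiIndex d s) : C(P, C(closure (Ω : Set (E d)), ℝ)) := ContinuousMap.curry
    ⟨fun z => iterDirDeriv (fun i => ((0 : P), stdVec d i)) α.exponents h (z.1, z.2.1),
      (hcont α).comp (by fun_prop)⟩
  rw [continuous_iff_continuousAt]
  intro q₀
  rw [ContinuousAt, tendsto_iff_norm_sub_tendsto_zero]
  have hlim : Filter.Tendsto (fun q => C * ∑ α, ‖F α q - F α q₀‖) (nhds q₀) (nhds 0) := by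
    have : Continuous fun q => C * ∑ α, ‖F α q - F α q₀‖ := by fun_prop
    have h0 := this.tendsto q₀
    simpa using h0
  refine squeeze_zero (fun _ => norm_nonneg _) (fun q => ?_) hlim
  rw [← map_sub]
  refine hbound _ _ (by positivity) fun α x hx => ?_
  have e : multiDeriv α.exponents (slice h hh q - slice h hh q₀).1 x =
      (F α q - F α q₀) ⟨x, subset_closure hx⟩ := by
    rw [multiDeriv_sub, multiDeriv_slice, multiDeriv_slice]
    rfl
  rw [e]
  refine ((F α q - F α q₀).norm_coe_le_norm _).trans ?_
  exact Finset.single_le_sum (f := fun α => ‖F α q - F α q₀‖) (fun _ _ => norm_nonneg _)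
    (Finset.mem_univ α)

/-- The derivative in `t` of a smooth function of `(t, q, x)`. -/
abbrev timeDeriv (h : (ℝ × P) × E d → ℝ) : (ℝ × P) × E d → ℝ := dirDeriv ((1, 0), 0) h

lemma hasDerivAt_time {h : (ℝ × P) × E d → ℝ} (hh : ContDiff ℝ ∞ h) (t : ℝ) (q : P) (x : E d) :
    HasDerivAt (fun t => h ((t, q), x)) (timeDeriv h ((t, q), x)) t := by
  have h1 : HasDerivAt (fun t : ℝ => ((t, q), x)) (((1 : ℝ), (0 : P)), (0 : E d)) t :=
    ((hasDerivAt_id t).prodMk (hasDerivAt_const t q)).prodMk (hasDerivAt_const t x)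
  exact ((hh.differentiable (by simp)) ((t, q), x)).hasFDerivAt.comp_hasDerivAt t h1

/-- The difference quotients in `t` of a smooth function of `(t, q, x)` converge in the Sobolev
norm, uniformly for `q` in a compact set. -/
lemma exists_norm_differenceQuotient_le {h : (ℝ × P) × E d → ℝ} (hh : ContDiff ℝ ∞ h) (c : E k)
    {S : Set P} (hS : IsCompact S) {ε : ℝ} (hε : 0 < ε) :
    ∃ t : ℝ, 0 < t ∧ ∀ q ∈ S,
      ‖t⁻¹ • (smoothSobolev hΩ s p c (slice h hh (t, q)) - smoothSobolev hΩ s p c (slice h hh (0, q)))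
        - smoothSobolev hΩ s p c (slice (timeDeriv h) (contDiff_dirDeriv hh _) (0, q))‖ ≤ ε := by
  obtain ⟨C, hC, hbound⟩ := exists_norm_smoothSobolev_le hΩ s p c
  have : CompactSpace (closure (Ω : Set (E d))) := isCompact_iff_compactSpace.1 hΩ.isCompact_closure
  have : CompactSpace S := isCompact_iff_compactSpace.1 hS
  let D (α : MultiIndex d s) (f : (ℝ × P) × E d → ℝ) :=
    iterDirDeriv (fun i => ((0 : ℝ × P), stdVec d i)) α.exponents f
  have hDs (α : MultiIndex d s) : ContDiff ℝ ∞ (D α h) := contDiff_iterDirDeriv hh _ _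
  have hcomm (α : MultiIndex d s) : timeDeriv (D α h) = D α (timeDeriv h) :=
    dirDeriv_iterDirDeriv hh _ _ _
  have hcont (α : MultiIndex d s) : Continuous (timeDeriv (D α h)) :=
    (contDiff_dirDeriv (hDs α) _).continuous
  -- With `S` moved into the compact factor, continuity at time 0 is uniform in `q` and `x`
  -- simultaneously.
  let F (α : MultiIndex d s) : C(ℝ, C(S × closure (Ω : Set (E d)), ℝ)) := ContinuousMap.curry
    ⟨fun z => timeDeriv (D α h) ((z.1, z.2.1.1), z.2.2.1), (hcont α).comp (by fun_prop)⟩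
  have hlim : Filter.Tendsto (fun t => C * ∑ α, ‖F α t - F α 0‖) (nhds 0) (nhds 0) := by
    have : Continuous fun t => C * ∑ α, ‖F α t - F α 0‖ := by fun_prop
    simpa using this.tendsto 0
  obtain ⟨δ, hδ, hball⟩ := Metric.eventually_nhds_iff.1 (hlim.eventually (gt_mem_nhds hε))
  refine ⟨δ / 2, by positivity, fun q hq => ?_⟩
  set t := δ / 2 with ht
  have ht0 : 0 < t := by positivity
  rw [← map_sub, ← map_smul, ← map_sub]
  have hM : (0 : ℝ) ≤ ε / C := by positivity
  refine (hbound _ (ε / C) hM fun α x hx => ?_).trans_eq (by field_simp)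
  have e : multiDeriv α.exponents (t⁻¹ • (slice h hh (t, q) - slice h hh (0, q)) -
      slice (timeDeriv h) (contDiff_dirDeriv hh _) (0, q)).1 x =
      t⁻¹ * (D α h ((t, q), x) - D α h ((0, q), x)) - timeDeriv (D α h) ((0, q), x) := by
    rw [multiDeriv_sub, multiDeriv_smul, multiDeriv_sub, multiDeriv_slice, multiDeriv_slice,
      multiDeriv_slice, hcomm]
  rw [e]
  -- The mean value inequality is applied after subtracting the tangent at time 0. The remaining
  -- function has derivative at most `ε / C` on `[0, t]`.
  have hder (τ : ℝ) : HasDerivAt (fun τ => D α h ((τ, q), x) - τ * timeDeriv (D α h) ((0, q), x))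
      (timeDeriv (D α h) ((τ, q), x) - timeDeriv (D α h) ((0, q), x)) τ := by
    have := (hasDerivAt_time (hDs α) τ q x).sub
      ((hasDerivAt_id τ).mul_const (timeDeriv (D α h) ((0, q), x)))
    rw [one_mul] at this
    exact this
  have hmv := Convex.norm_image_sub_le_of_norm_deriv_le (𝕜 := ℝ) (s := Icc 0 t) (x := 0) (y := t)
    (f := fun τ => D α h ((τ, q), x) - τ * timeDeriv (D α h) ((0, q), x)) (C := ε / C)
    (fun τ _ => (hder τ).differentiableAt)
    (fun τ hτ => by
      rw [(hder τ).deriv]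
      have h1 : ‖timeDeriv (D α h) ((τ, q), x) - timeDeriv (D α h) ((0, q), x)‖ ≤
          ‖F α τ - F α 0‖ :=
        (F α τ - F α 0).norm_coe_le_norm (⟨q, hq⟩, ⟨x, subset_closure hx⟩)
      have h2 : ‖F α τ - F α 0‖ ≤ ∑ α, ‖F α τ - F α 0‖ :=
        Finset.single_le_sum (f := fun α => ‖F α τ - F α 0‖) (fun _ _ => norm_nonneg _)
          (Finset.mem_univ α)
      have h3 : C * ∑ α, ‖F α τ - F α 0‖ < ε := hball (by
        rw [Real.dist_eq, sub_zero, abs_of_nonneg hτ.1]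
        exact hτ.2.trans_lt (by rw [ht]; linarith))
      rw [le_div_iff₀ hC]
      nlinarith)
    (convex_Icc 0 t) (left_mem_Icc.2 ht0.le) (right_mem_Icc.2 ht0.le)
  have e2 : t⁻¹ * (D α h ((t, q), x) - D α h ((0, q), x)) - timeDeriv (D α h) ((0, q), x) =
      t⁻¹ * (D α h ((t, q), x) - t * timeDeriv (D α h) ((0, q), x) -
        (D α h ((0, q), x) - 0 * timeDeriv (D α h) ((0, q), x))) := by
    field_simp; ring
  rw [e2, abs_mul, abs_of_pos (inv_pos.2 ht0)]
  rw [Real.norm_eq_abs, sub_zero, Real.norm_eq_abs, abs_of_pos ht0] at hmv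
  calc _ ≤ t⁻¹ * (ε / C * t) := by gcongr
    _ = ε / C := by field_simp

end Parameters

/-! ### Weak derivatives of first order, product rule and supports -/

section WeakDerivatives

variable {d k : ℕ} {Ω : TopologicalSpace.Opens (E d)} {p : ℝ≥0∞}

lemma multiDeriv_zero (φ : E d → ℝ) : multiDeriv 0 φ = φ := iterDirDeriv_zero _ _

lemma multiDeriv_single {φ : E d → ℝ} (hφ : ContDiff ℝ ∞ φ) (i : Fin d) :
    multiDeriv (Pi.single i 1) φ = partialDeriv i φ := by
  have := iterDirDeriv_add_single hφ (stdVec d) 0 i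
  rw [zero_add, iterDirDeriv_zero] at this
  exact this

lemma multiDeriv_add_single {φ : E d → ℝ} (hφ : ContDiff ℝ ∞ φ) (α : Fin d → ℕ) (i : Fin d) :
    multiDeriv (α + Pi.single i 1) φ = partialDeriv i (multiDeriv α φ) := by
  rw [multiDeriv_eq_iterDirDeriv, iterDirDeriv_add_single hφ, ← dirDeriv_iterDirDeriv hφ]
  rfl

/-- `f` vanishes off `S` and lies in `W^{s,p}(Ω)`, where membership is expressed by iterated weak
derivatives of first order. -/
def IsSobolevSupportedOn (Ω : TopologicalSpace.Opens (E d)) (p : ℝ≥0∞) (S : Set (E d)) :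
    ℕ → (E d → E k) → Prop
  | 0, f => MemLp f p (volume.restrict (Ω : Set (E d))) ∧ ∀ x ∉ S, f x = 0
  | s + 1, f => (MemLp f p (volume.restrict (Ω : Set (E d))) ∧ ∀ x ∉ S, f x = 0) ∧
      ∀ i, ∃ g, IsSobolevSupportedOn Ω p S s g ∧ IsWeakDeriv (Ω : Set (E d)) (Pi.single i 1) f g

namespace IsSobolevSupportedOn

variable {S T : Set (E d)} {s : ℕ} {f g : E d → E k}

lemma memLp (h : IsSobolevSupportedOn Ω p S s f) : MemLp f p (volume.restrict (Ω : Set (E d))) := by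
  cases s with
  | zero => exact h.1
  | succ s => exact h.1.1

lemma eq_zero (h : IsSobolevSupportedOn Ω p S s f) {x : E d} (hx : x ∉ S) : f x = 0 := by
  cases s with
  | zero => exact h.2 x hx
  | succ s => exact h.1.2 x hx

lemma mono (h : IsSobolevSupportedOn Ω p S s f) (hST : S ⊆ T) : IsSobolevSupportedOn Ω p T s f := by
  induction s generalizing f with
  | zero => exact ⟨h.1, fun x hx => h.2 x fun hx' => hx (hST hx')⟩
  | succ s ih =>
    refine ⟨⟨h.1.1, fun x hx => h.1.2 x fun hx' => hx (hST hx')⟩, fun i => ?_⟩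
    obtain ⟨g, hg, hw⟩ := h.2 i
    exact ⟨g, ih hg, hw⟩

lemma of_succ (h : IsSobolevSupportedOn Ω p S (s + 1) f) : IsSobolevSupportedOn Ω p S s f := by
  induction s generalizing f with
  | zero => exact h.1
  | succ s ih =>
    refine ⟨h.1, fun i => ?_⟩
    obtain ⟨g, hg, hw⟩ := h.2 i
    exact ⟨g, ih hg, hw⟩

end IsSobolevSupportedOn

lemma IsTestFunction.integrable_smul_of_memLp (hp : 1 ≤ p) {φ : E d → ℝ}
    (h : IsTestFunction (Ω : Set (E d)) φ) {f : E d → E k}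
    (hf : MemLp f p (volume.restrict (Ω : Set (E d)))) :
    Integrable (fun x => φ x • f x) (volume.restrict (Ω : Set (E d))) :=
  (hf.locallyIntegrable hp).integrable_smul_left_of_hasCompactSupport
    h.contDiff.continuous h.hasCompactSupport

lemma IsWeakDeriv.add_of_memLp (hp : 1 ≤ p) {α : Fin d → ℕ} {f f' g g' : E d → E k}
    (hf : MemLp f p (volume.restrict (Ω : Set (E d))))
    (hf' : MemLp f' p (volume.restrict (Ω : Set (E d))))
    (hg : MemLp g p (volume.restrict (Ω : Set (E d))))
    (hg' : MemLp g' p (volume.restrict (Ω : Set (E d))))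
    (h : IsWeakDeriv (Ω : Set (E d)) α f g) (h' : IsWeakDeriv (Ω : Set (E d)) α f' g') :
    IsWeakDeriv (Ω : Set (E d)) α (f + f') (g + g') := by
  intro φ hφ
  simp only [Pi.add_apply, smul_add]
  rw [integral_add ((hφ.multiDeriv α).integrable_smul_of_memLp hp hf)
    ((hφ.multiDeriv α).integrable_smul_of_memLp hp hf'),
    integral_add (hφ.integrable_smul_of_memLp hp hg) (hφ.integrable_smul_of_memLp hp hg'),
    h φ hφ, h' φ hφ, smul_add]

lemma IsSobolevSupportedOn.add (hp : 1 ≤ p) {S : Set (E d)} {s : ℕ} {f g : E d → E k}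
    (hf : IsSobolevSupportedOn Ω p S s f) (hg : IsSobolevSupportedOn Ω p S s g) :
    IsSobolevSupportedOn Ω p S s (f + g) := by
  have h0 : MemLp (f + g) p (volume.restrict (Ω : Set (E d))) ∧ ∀ x ∉ S, (f + g) x = 0 :=
    ⟨hf.memLp.add hg.memLp, fun x hx => by rw [Pi.add_apply, hf.eq_zero hx, hg.eq_zero hx, add_zero]⟩
  induction s generalizing f g with
  | zero => exact h0
  | succ s ih =>
    refine ⟨h0, fun i => ?_⟩
    obtain ⟨f', hf', hfw⟩ := hf.2 i
    obtain ⟨g', hg', hgw⟩ := hg.2 i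
    refine ⟨f' + g', ih hf' hg' ⟨hf'.memLp.add hg'.memLp, fun x hx => by
      rw [Pi.add_apply, hf'.eq_zero hx, hg'.eq_zero hx, add_zero]⟩,
      hfw.add_of_memLp hp hf.memLp hg.memLp hf'.memLp hg'.memLp hgw⟩

lemma IsTestFunction.mul_smooth {Ω : Set (E d)} {φ ψ : E d → ℝ} (hψ : IsTestFunction Ω ψ)
    (hφ : ContDiff ℝ ∞ φ) : IsTestFunction Ω (fun x => ψ x * φ x) :=
  ⟨hψ.contDiff.mul hφ, hψ.hasCompactSupport.mul_right,
    (tsupport_mul_subset_left (f := ψ) (g := φ)).trans hψ.tsupport_subset⟩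

/-- The product rule for first order weak derivatives. -/
lemma IsWeakDeriv.smooth_smul (hp : 1 ≤ p) {i : Fin d} {f g : E d → E k} {φ : E d → ℝ}
    (hφ : ContDiff ℝ ∞ φ) (hf : MemLp f p (volume.restrict (Ω : Set (E d))))
    (hg : MemLp g p (volume.restrict (Ω : Set (E d))))
    (h : IsWeakDeriv (Ω : Set (E d)) (Pi.single i 1) f g) :
    IsWeakDeriv (Ω : Set (E d)) (Pi.single i 1) (fun x => φ x • f x)
      ((fun x => partialDeriv i φ x • f x) + fun x => φ x • g x) := by
  intro ψ hψ
  have hψφ := hψ.mul_smooth hφ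
  have hψφ' : IsTestFunction (Ω : Set (E d)) fun x => ψ x * partialDeriv i φ x :=
    hψ.mul_smooth (contDiff_dirDeriv hφ (stdVec d i))
  have hψ'φ := (hψ.partialDeriv i).mul_smooth hφ
  have key := h _ hψφ
  rw [multiDeriv_single hψφ.contDiff] at key
  have hprod : partialDeriv i (fun x => ψ x * φ x) =
      fun x => partialDeriv i ψ x * φ x + ψ x * partialDeriv i φ x := by
    ext x
    unfold ANO.partialDeriv
    rw [fderiv_fun_mul (hψ.contDiff.differentiable (by simp) x) (hφ.differentiable (by simp) x)]
    simp
    ring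
  rw [multiDeriv_single hψ.contDiff]
  simp only [hprod, add_smul] at key
  rw [integral_add (hψ'φ.integrable_smul_of_memLp hp hf) (hψφ'.integrable_smul_of_memLp hp hf)]
    at key
  simp only [Pi.add_apply, smul_add, smul_smul]
  rw [integral_add (hψφ'.integrable_smul_of_memLp hp hf) (hψφ.integrable_smul_of_memLp hp hg)]
  simp only [Finset.sum_pi_single', Finset.mem_univ, if_true, pow_one, neg_smul, one_smul,
    neg_add] at key ⊢
  rw [← key]
  abel

/-- Iterating the first-order product rule avoids the general Leibniz formula; this is the reason
for describing the Sobolev space recursively. -/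
lemma IsSobolevSupportedOn.smooth_smul (hp : 1 ≤ p) {s : ℕ} {f : E d → E k} {φ : E d → ℝ}
    (hf : IsSobolevSupportedOn Ω p univ s f) (hφ : ContDiff ℝ ∞ φ) (hc : HasCompactSupport φ) :
    IsSobolevSupportedOn Ω p (tsupport φ) s (fun x => φ x • f x) := by
  have h0 {φ : E d → ℝ} (hφ : ContDiff ℝ ∞ φ) (hc : HasCompactSupport φ) {f : E d → E k}
      (hf : MemLp f p (volume.restrict (Ω : Set (E d)))) :
      MemLp (fun x => φ x • f x) p (volume.restrict (Ω : Set (E d))) ∧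
        ∀ x ∉ tsupport φ, φ x • f x = 0 := by
    obtain ⟨C, hC⟩ := hφ.continuous.bounded_above_of_compact_support hc
    refine ⟨?_, fun x hx => by rw [image_eq_zero_of_notMem_tsupport hx, zero_smul]⟩
    refine MemLp.of_le_mul hf (hφ.continuous.aestronglyMeasurable.smul hf.1) (c := C) ?_
    filter_upwards with x
    rw [norm_smul]
    exact mul_le_mul_of_nonneg_right (hC x) (norm_nonneg _)
  induction s generalizing f φ with
  | zero => exact h0 hφ hc hf.1
  | succ s ih =>
    refine ⟨h0 hφ hc hf.memLp, fun i => ?_⟩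
    obtain ⟨g, hg, hw⟩ := hf.2 i
    refine ⟨_, ?_, hw.smooth_smul hp hφ hf.memLp hg.memLp⟩
    exact ((ih hf.of_succ (contDiff_dirDeriv hφ (stdVec d i))
      (hasCompactSupport_dirDeriv hc (stdVec d i))).mono (tsupport_fderiv_apply_subset ℝ _)).add hp
      (ih hg hφ hc)

/-- If `g` is the weak derivative `∂ᵢ f`, testing this relation with `D^β φ` shows that the weak
derivative of `f` of order `β + eᵢ` is the weak derivative `D^β g`. The converse below uses the same
test function. -/
lemma isSobolevSupportedOn_of_weakDeriv {s : ℕ} {f : E d → E k}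
    (hf : MemLp f p (volume.restrict (Ω : Set (E d))))
    (h : ∀ α : Fin d → ℕ, ∑ i, α i ≤ s → ∃ g, MemLp g p (volume.restrict (Ω : Set (E d))) ∧
      IsWeakDeriv (Ω : Set (E d)) α f g) : IsSobolevSupportedOn Ω p univ s f := by
  induction s generalizing f with
  | zero => exact ⟨hf, fun x hx => absurd (mem_univ x) hx⟩
  | succ s ih =>
    refine ⟨⟨hf, fun x hx => absurd (mem_univ x) hx⟩, fun i => ?_⟩
    obtain ⟨g, hg, hw⟩ := h (Pi.single i 1) (by simp)
    refine ⟨g, ih hg fun β hβ => ?_, hw⟩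
    obtain ⟨g', hg', hw'⟩ := h (β + Pi.single i 1) (by rw [sum_add_single]; omega)
    refine ⟨g', hg', fun φ hφ => ?_⟩
    have h1 := hw _ (hφ.multiDeriv β)
    rw [multiDeriv_single (hφ.multiDeriv β).contDiff, ← multiDeriv_add_single hφ.contDiff,
      hw' φ hφ, sum_add_single, pow_succ'] at h1
    simp only [Finset.sum_pi_single', Finset.mem_univ, if_true, pow_one, neg_mul, one_mul,
      neg_smul, one_smul, neg_inj] at h1
    exact h1.symm

lemma IsSobolevSupportedOn.exists_weakDeriv {S : Set (E d)} {s : ℕ} {f : E d → E k}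
    (h : IsSobolevSupportedOn Ω p S s f) (α : Fin d → ℕ) (hα : ∑ i, α i ≤ s) :
    ∃ g, MemLp g p (volume.restrict (Ω : Set (E d))) ∧ (∀ x ∉ S, g x = 0) ∧
      IsWeakDeriv (Ω : Set (E d)) α f g := by
  induction α using multiIndex_induction generalizing f s with
  | h0 =>
    refine ⟨f, h.memLp, fun x hx => h.eq_zero hx, fun φ _ => ?_⟩
    rw [multiDeriv_zero]
    simp
  | hs α i ih =>
    rw [sum_add_single] at hα
    obtain ⟨s, rfl⟩ : ∃ n, s = n + 1 := ⟨s - 1, by omega⟩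
    obtain ⟨f', hf', hw⟩ := h.2 i
    obtain ⟨g, hg, hgS, hgw⟩ := ih hf' (by omega)
    refine ⟨g, hg, hgS, fun φ hφ => ?_⟩
    have h1 := hw _ (hφ.multiDeriv α)
    rw [multiDeriv_single (hφ.multiDeriv α).contDiff, ← multiDeriv_add_single hφ.contDiff,
      hgw φ hφ] at h1
    rw [h1, sum_add_single, pow_succ', smul_smul]
    simp

end WeakDerivatives

/-! ### The cone condition -/

section LipschitzBoundary

/-- Near each point of its closure, a domain with Lipschitz boundary contains a cone with vertex
at each of its points, the axis of the cones being the same for all points. -/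
lemma HasLipschitzBoundary.exists_cone {d : ℕ} {Ω : Set (E d)} (hΩ : HasLipschitzBoundary Ω)
    (ho : IsOpen Ω) {z : E d} (hz : z ∈ closure Ω) :
    ∃ (e : E d) (r c : ℝ), ‖e‖ ≤ 1 ∧ 0 < r ∧ 0 < c ∧ c ≤ 1 ∧ ∀ x ∈ Ω, ‖x - z‖ < r → ∀ τ : ℝ, 0 < τ →
      τ < r → ∀ y : E d, ‖y - (x + τ • e)‖ ≤ c * τ → y ∈ Ω := by
  by_cases hzΩ : z ∈ Ω
  · obtain ⟨r, hr, hball⟩ := Metric.isOpen_iff.1 ho z hzΩ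
    -- Inside `Ω` a ball suffices, so the degenerate axis 0 is used.
    refine ⟨0, r / 2, 1, by simp, by positivity, one_pos, le_rfl, fun x _ hxz τ _ hτ y hy => hball ?_⟩
    rw [Metric.mem_ball, dist_eq_norm]
    rw [smul_zero, add_zero, one_mul] at hy
    calc ‖y - z‖ = ‖(y - x) + (x - z)‖ := by abel_nf
      _ ≤ ‖y - x‖ + ‖x - z‖ := norm_add_le _ _
      _ < r := by linarith
  · have hzf : z ∈ frontier Ω := by
      rw [ho.frontier_eq]; exact ⟨hz, hzΩ⟩
    obtain ⟨e, he, γ, L, hγ, r, hr, hg⟩ := hΩ z hzf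
    -- Moving by `τ e + w` raises the height by at least `τ - ‖w‖` and the graph by at most `L ‖w‖`,
    -- so an aperture of at most `1 / (L + 1)` keeps the point above the graph. Each of `‖x - z‖`,
    -- `τ` and `‖w‖` is below `r / 3`, so `y` stays in the ball where the graph describes `Ω`.
    refine ⟨e, r / 3, 1 / (L + 2), he.le, by positivity, by positivity, ?_,
      fun x hx hxz τ hτ0 hτ y hy => ?_⟩
    · rw [div_le_one (by positivity)]; linarith [L.coe_nonneg]
    have hL := L.coe_nonneg
    set w := y - (x + τ • e) with hw
    have hy' : y = x + τ • e + w := by rw [hw]; abel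
    have hwτ : (L + 2) * ‖w‖ ≤ τ := by
      have h2 : (0 : ℝ) < L + 2 := by positivity
      have := mul_le_mul_of_nonneg_left hy h2.le
      rwa [← mul_assoc, mul_one_div_cancel h2.ne', one_mul] at this
    have hw0 := norm_nonneg w
    have hxm : x ∈ Metric.ball z r := by
      rw [Metric.mem_ball, dist_eq_norm]; linarith
    have hym : y ∈ Metric.ball z r := by
      rw [Metric.mem_ball, dist_eq_norm]
      calc ‖y - z‖ = ‖(x - z) + τ • e + w‖ := by rw [hy']; abel_nf
        _ ≤ ‖x - z‖ + ‖τ • e‖ + ‖w‖ := norm_add₃_le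
        _ < r := by
          rw [norm_smul, he, Real.norm_eq_abs, abs_of_pos hτ0]
          nlinarith [mul_nonneg hL hw0]
    rw [hg y hym]
    have h1 := (hg x hxm).1 hx
    have hee : inner ℝ e e = (1 : ℝ) := by rw [real_inner_self_eq_norm_sq, he]; norm_num
    have hin : inner ℝ e y = inner ℝ e x + τ + inner ℝ e w := by
      rw [hy', inner_add_right, inner_add_right, inner_smul_right, hee, mul_one]
    have hhor : y - inner ℝ e y • e = (x - inner ℝ e x • e) + (w - inner ℝ e w • e) := by
      rw [hin, hy']; module
    have hdist := hγ.dist_le_mul (y - inner ℝ e y • e) (x - inner ℝ e x • e)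
    have hew : |inner ℝ e w| ≤ ‖w‖ := by
      have := abs_real_inner_le_norm e w
      rwa [he, one_mul] at this
    have hproj : ‖w - inner ℝ e w • e‖ ≤ ‖w‖ := by
      have h2 : ‖w - inner ℝ e w • e‖ ^ 2 = ‖w‖ ^ 2 - (inner ℝ e w) ^ 2 := by
        rw [norm_sub_sq_real, inner_smul_right, norm_smul, he, real_inner_comm, mul_one,
          Real.norm_eq_abs, sq_abs]
        ring
      exact le_of_sq_le_sq (by rw [h2]; nlinarith [sq_nonneg (inner ℝ e w)]) hw0
    rw [hhor, dist_self_add_left, Real.dist_eq] at hdist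
    have h3 := (le_abs_self _).trans (hdist.trans (mul_le_mul_of_nonneg_left hproj hL))
    rw [hhor, hin]
    linarith [(abs_le.1 hew).1]

end LipschitzBoundary

/-! ### Mollification in `L^p` -/

section Mollification

variable {d k : ℕ} {p : ℝ≥0∞}

/-- Translations are continuous in `L^p`. -/
lemma exists_eLpNorm_translate_sub_le (hp1 : 1 ≤ p) (hp : p ≠ ⊤) {g : E d → E k}
    (hg : MemLp g p volume) {ε : ℝ≥0∞} (hε : 0 < ε) :
    ∃ δ : ℝ, 0 < δ ∧ ∀ t : E d, ‖t‖ < δ → eLpNorm (fun x => g (x - t) - g x) p volume ≤ ε := by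
  have : Fact (1 ≤ p) := ⟨hp1⟩
  have : Fact (p ≠ ⊤) := ⟨hp⟩
  -- The action of `DomAddAct.mk (-t)` on `L^p` is translation by `t`, and it is continuous because
  -- `p` is finite.
  let f := hg.toLp g
  have hc : Continuous fun t : E d => (DomAddAct.mk (-t) +ᵥ f : Lp (E k) p (volume : Measure (E d))) :=
    (DomAddAct.continuous_mk.comp continuous_neg).vadd continuous_const
  have h0 : (DomAddAct.mk (-(0 : E d)) +ᵥ f : Lp (E k) p (volume : Measure (E d))) = f := by
    rw [neg_zero]; exact zero_vadd _ f
  have hev : ∀ᶠ t : E d in nhds 0,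
      edist (DomAddAct.mk (-t) +ᵥ f : Lp (E k) p (volume : Measure (E d))) f < ε := by
    have := hc.tendsto 0
    rw [h0] at this
    exact this.eventually (Metric.eball_mem_nhds f hε)
  obtain ⟨δ, hδ, hball⟩ := Metric.eventually_nhds_iff.1 hev
  refine ⟨δ, hδ, fun t ht => ?_⟩
  have h1 := hball (y := t) (by rwa [dist_zero_right])
  rw [Lp.edist_def] at h1
  refine le_trans (le_of_eq (eLpNorm_congr_ae ?_)) h1.le
  have h2 : (DomAddAct.mk (-t) +ᵥ f : Lp (E k) p (volume : Measure (E d))) =ᵐ[volume] fun x => g (-t + x) := by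
    have := DomAddAct.mk_vadd_toLp (p := p) (-t) hg
    rw [show f = hg.toLp g from rfl, this]
    exact MemLp.coeFn_toLp _
  filter_upwards [h2, hg.coeFn_toLp] with x hx hx'
  rw [Pi.sub_apply, hx, hx', neg_add_eq_sub]

/-- A mollification is an average of translates against a probability measure, so its error is at
most the largest error of a translation by less than `δ`. The kernel need not be centred at the
origin, which allows the shifted kernels used below. -/
lemma exists_eLpNorm_mollify_sub_le (hp1 : 1 ≤ p) (hp : p ≠ ⊤) {g : E d → E k}
    (hg : MemLp g p volume) {ε : ℝ≥0∞} (hε : 0 < ε) :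
    ∃ δ : ℝ, 0 < δ ∧ ∀ ρ : E d → ℝ, Continuous ρ → (∀ x, 0 ≤ ρ x) → ∫ x, ρ x = 1 →
      (∀ t, δ ≤ ‖t‖ → ρ t = 0) → eLpNorm (fun x => (∫ y, ρ (x - y) • g y) - g x) p volume ≤ ε := by
  -- A strongly measurable representative makes `g (x - t) - g x` jointly measurable, as the
  -- exchange of integrals requires.
  wlog hgm : StronglyMeasurable g generalizing g
  · obtain ⟨δ, hδ, h⟩ := this (g := hg.1.mk g) (hg.ae_eq hg.1.ae_eq_mk) hg.1.stronglyMeasurable_mk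
    refine ⟨δ, hδ, fun ρ h1 h2 h3 h4 => ?_⟩
    refine le_trans (le_of_eq (eLpNorm_congr_ae ?_)) (h ρ h1 h2 h3 h4)
    filter_upwards [hg.1.ae_eq_mk] with x hx
    rw [hx]
    congr 1
    refine integral_congr_ae ?_
    filter_upwards [hg.1.ae_eq_mk] with y hy
    rw [hy]
  obtain ⟨δ, hδ, htr⟩ := exists_eLpNorm_translate_sub_le hp1 hp hg hε
  refine ⟨δ, hδ, fun ρ hρ hρ0 hρ1 hρδ => ?_⟩
  have hp0 : p ≠ 0 := (zero_lt_one.trans_le hp1).ne'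
  have hpr : 0 < p.toReal := ENNReal.toReal_pos hp0 hp
  have hρc : HasCompactSupport ρ := by
    refine HasCompactSupport.intro (isCompact_closedBall (0 : E d) δ) fun x hx => hρδ x ?_
    rw [mem_closedBall_zero_iff, not_le] at hx
    exact hx.le
  have hρi : Integrable ρ := hρ.integrable_of_hasCompactSupport hρc
  let μ : Measure (E d) := volume.withDensity fun t => ENNReal.ofReal (ρ t)
  have hρm : Measurable fun t => ENNReal.ofReal (ρ t) := hρ.measurable.ennreal_ofReal
  have hμ : IsProbabilityMeasure μ := ⟨by
    rw [withDensity_apply _ MeasurableSet.univ, Measure.restrict_univ,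
      ← ofReal_integral_eq_lintegral_ofReal hρi (Filter.Eventually.of_forall hρ0), hρ1,
      ENNReal.ofReal_one]⟩
  have hloc : LocallyIntegrable g volume := hg.locallyIntegrable hp1
  have hmeas : StronglyMeasurable fun z : E d × E d => g (z.1 - z.2) - g z.1 :=
    (hgm.comp_measurable (measurable_fst.sub measurable_snd)).sub
      (hgm.comp_measurable measurable_fst)
  have hpt (x : E d) : ‖(∫ y, ρ (x - y) • g y) - g x‖ₑ ^ p.toReal ≤
      ∫⁻ t, ‖g (x - t) - g x‖ₑ ^ p.toReal ∂μ := by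
    have e1 : (∫ y, ρ (x - y) • g y) = ∫ t, ρ t • g (x - t) := by
      rw [← integral_sub_left_eq_self (fun t => ρ t • g (x - t)) volume x]
      simp
    have hi : Integrable fun t => ρ t • g (x - t) := by
      have h2 : Integrable fun y => ρ (x - y) • g y :=
        hloc.integrable_smul_left_of_hasCompactSupport (hρ.comp (continuous_const.sub continuous_id))
          (hρc.comp_homeomorph (Homeomorph.subLeft x))
      have h3 := h2.comp_sub_left x
      simpa using h3
    have e2 : (∫ y, ρ (x - y) • g y) - g x = ∫ t, ρ t • (g (x - t) - g x) := by
      simp only [smul_sub]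
      rw [integral_sub hi (hρi.smul_const _), integral_smul_const, hρ1, one_smul, e1]
    have e3 : ‖(∫ y, ρ (x - y) • g y) - g x‖ₑ ≤ ∫⁻ t, ‖g (x - t) - g x‖ₑ ∂μ := by
      have hm : Measurable fun t => ‖g (x - t) - g x‖ₑ :=
        (hmeas.comp_measurable (measurable_prodMk_left (x := x))).enorm
      rw [e2, lintegral_withDensity_eq_lintegral_mul _ hρm hm]
      refine (enorm_integral_le_lintegral_enorm _).trans (le_of_eq ?_)
      refine lintegral_congr fun t => ?_
      rw [enorm_smul, Pi.mul_apply, Real.enorm_eq_ofReal (hρ0 t)]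
    -- Jensen's inequality, in the form that the `L^1` norm is at most the `L^p` norm for a
    -- probability measure.
    have e4 : ∫⁻ t, ‖g (x - t) - g x‖ₑ ∂μ ≤ eLpNorm (fun t => g (x - t) - g x) p μ := by
      rw [← eLpNorm_one_eq_lintegral_enorm]
      exact eLpNorm_le_eLpNorm_of_exponent_le hp1
        (hmeas.comp_measurable measurable_prodMk_left).aestronglyMeasurable
    rw [eLpNorm_eq_lintegral_rpow_enorm_toReal hp0 hp] at e4
    calc _ ≤ ((∫⁻ t, ‖g (x - t) - g x‖ₑ ^ p.toReal ∂μ) ^ (1 / p.toReal)) ^ p.toReal :=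
          ENNReal.rpow_le_rpow (e3.trans e4) hpr.le
      _ = _ := by rw [← ENNReal.rpow_mul, one_div_mul_cancel hpr.ne', ENNReal.rpow_one]
  rw [eLpNorm_eq_lintegral_rpow_enorm_toReal hp0 hp]
  have hfin : ∫⁻ x, ‖(∫ y, ρ (x - y) • g y) - g x‖ₑ ^ p.toReal ≤ ε ^ p.toReal := by
    calc _ ≤ ∫⁻ x, ∫⁻ t, ‖g (x - t) - g x‖ₑ ^ p.toReal ∂μ := lintegral_mono hpt
      _ = ∫⁻ t, ∫⁻ x, ‖g (x - t) - g x‖ₑ ^ p.toReal ∂volume ∂μ := by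
        refine lintegral_lintegral_swap ?_
        exact (hmeas.enorm.pow_const p.toReal).aemeasurable
      _ ≤ ∫⁻ t, ε ^ p.toReal ∂μ := by
        refine lintegral_mono_ae ?_
        have hae : ∀ᵐ t ∂μ, ‖t‖ < δ := by
          rw [ae_withDensity_iff hρm]
          filter_upwards with t ht
          by_contra hcon
          exact ht (by rw [hρδ t (not_lt.1 hcon), ENNReal.ofReal_zero])
        filter_upwards [hae] with t ht
        have := htr t ht
        rw [eLpNorm_eq_lintegral_rpow_enorm_toReal hp0 hp] at this
        have h5 := ENNReal.rpow_le_rpow this hpr.le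
        rwa [← ENNReal.rpow_mul, one_div_mul_cancel hpr.ne', ENNReal.rpow_one] at h5
      _ = ε ^ p.toReal := by simp
  calc _ ≤ (ε ^ p.toReal) ^ (1 / p.toReal) := ENNReal.rpow_le_rpow hfin (by positivity)
    _ = ε := by rw [← ENNReal.rpow_mul, mul_one_div_cancel hpr.ne', ENNReal.rpow_one]

end Mollification

/-! ### Density of smooth functions -/

section Density

variable {d k : ℕ} {Ω : TopologicalSpace.Opens (E d)} {s : ℕ} {p : ℝ≥0∞}

/-- If the kernel `ρ (x - ·)` is supported in `Ω`, or away from the support `S` of `v`, then the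
derivatives of the mollification of `v` at `x` are the mollifications of the weak derivatives. -/
lemma integral_iterDirDeriv_smul_eq {α : Fin d → ℕ} {S : Set (E d)} {v g : E d → E k}
    {ρ : E d → ℝ} (hρ : ContDiff ℝ ∞ ρ) (hρc : HasCompactSupport ρ) {x : E d}
    (hv : ∀ y ∉ S, v y = 0) (hg : ∀ y ∉ S, g y = 0)
    (hw : IsWeakDeriv (Ω : Set (E d)) α v g)
    (hx : tsupport (fun y => ρ (x - y)) ⊆ Ω ∨ Disjoint (tsupport fun y => ρ (x - y)) S) :
    ∫ y, iterDirDeriv (stdVec d) α ρ (x - y) • (Ω : Set (E d)).indicator v y =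
      ∫ y, ρ (x - y) • (Ω : Set (E d)).indicator g y := by
  have hψ : ContDiff ℝ ∞ fun y => ρ (x - y) := hρ.comp (contDiff_const.sub contDiff_id)
  have hD : multiDeriv α (fun y => ρ (x - y)) =
      fun y => (-1 : ℝ) ^ (∑ i, α i) * iterDirDeriv (stdVec d) α ρ (x - y) := by
    have h1 := iterDirDeriv_comp_affine hρ x (-ContinuousLinearMap.id ℝ (E d)) (stdVec d) α
    have h2 := iterDirDeriv_neg_directions hρ (stdVec d) α
    simp only [neg_apply, ContinuousLinearMap.id_apply, ← sub_eq_add_neg]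
      at h1
    rw [multiDeriv_eq_iterDirDeriv, h1, h2]
    rfl
  have hsq : (-1 : ℝ) ^ (∑ i, α i) * (-1 : ℝ) ^ (∑ i, α i) = 1 := by
    rw [← mul_pow]; norm_num
  have hD' (y : E d) : iterDirDeriv (stdVec d) α ρ (x - y) =
      (-1 : ℝ) ^ (∑ i, α i) * multiDeriv α (fun y => ρ (x - y)) y := by
    rw [hD, ← mul_assoc, hsq, one_mul]
  have hind (f : E d → ℝ) (u : E d → E k) :
      ∫ y, f y • (Ω : Set (E d)).indicator u y = ∫ y in (Ω : Set (E d)), f y • u y := by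
    rw [← integral_indicator Ω.isOpen.measurableSet]
    congr 1
    ext1 y
    exact (indicator_smul_apply _ f u y).symm
  rw [hind (fun y => iterDirDeriv (stdVec d) α ρ (x - y)), hind (fun y => ρ (x - y))]
  simp only [hD', mul_smul]
  rw [integral_smul]
  -- In the first case the kernel is an admissible test function; in the second both integrands
  -- vanish identically.
  rcases hx with hx | hx
  · have ht : IsTestFunction (Ω : Set (E d)) fun y => ρ (x - y) :=
      ⟨hψ, hρc.comp_homeomorph (Homeomorph.subLeft x), hx⟩
    rw [hw _ ht, smul_smul, hsq, one_smul]
  · have hz {f : E d → ℝ} (hf : tsupport f ⊆ tsupport fun y => ρ (x - y)) {u : E d → E k}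
        (hu : ∀ y ∉ S, u y = 0) : ∀ y, f y • u y = 0 := by
      intro y
      by_cases hy : y ∈ S
      · rw [image_eq_zero_of_notMem_tsupport fun h => (disjoint_left.1 hx (hf h)) hy, zero_smul]
      · rw [hu y hy, smul_zero]
    simp [hz (tsupport_iterDirDeriv_subset _ (stdVec d) α) hv, hz Subset.rfl hg,
      multiDeriv_eq_iterDirDeriv]

variable [Fact (1 ≤ p)]

lemma Sobolev.weakDeriv_sum {ι : Type*} (t : Finset ι) (u : ι → Sobolev Ω s p k)
    (α : MultiIndex d s) : weakDeriv (∑ j ∈ t, u j) α = ∑ j ∈ t, weakDeriv (u j) α := by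
  have h := congrArg (fun j => j.ofLp α) (map_sum (jet : Sobolev Ω s p k →ₗ[ℝ] _) u t)
  simp only [WithLp.ofLp_sum, Finset.sum_apply] at h
  exact h

/-- The elements of the Sobolev space that are given by smooth functions on `ℝ^d`. -/
def smoothSubmodule (hΩ : Bornology.IsBounded (Ω : Set (E d))) (s : ℕ) (p : ℝ≥0∞) [Fact (1 ≤ p)]
    (k : ℕ) : Submodule ℝ (Sobolev Ω s p k) :=
  ⨆ c : E k, LinearMap.range (smoothSobolev hΩ s p c)

/-- A Sobolev function supported near a point of the closure at which the cone condition holds is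
a limit of smooth functions. -/
lemma mem_closure_smoothSubmodule_of_cone (hΩ : Bornology.IsBounded (Ω : Set (E d))) (hp : p ≠ ⊤)
    {z e : E d} {r c : ℝ} (he : ‖e‖ ≤ 1) (hr : 0 < r) (hc : 0 < c) (hc1 : c ≤ 1)
    (hcone : ∀ x ∈ Ω, ‖x - z‖ < r → ∀ τ : ℝ, 0 < τ → τ < r → ∀ y : E d,
      ‖y - (x + τ • e)‖ ≤ c * τ → y ∈ Ω) {S : Set (E d)} (hS : S ⊆ Metric.ball z (r / 2))
    {v : E d → E k} (hv : IsSobolevSupportedOn Ω p S s v) {ξ : Sobolev Ω s p k}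
    (hξ : (Sobolev.toLp ξ : E d → E k) =ᵐ[volume.restrict (Ω : Set (E d))] v) :
    ξ ∈ closure (smoothSubmodule hΩ s p k : Set (Sobolev Ω s p k)) := by
  have hp1 : 1 ≤ p := Fact.out
  rw [Metric.mem_closure_iff]
  intro ε hε
  choose g hg hgS hgw using fun α : MultiIndex d s => hv.exists_weakDeriv α.exponents α.2
  have hgi (α : MultiIndex d s) : MemLp ((Ω : Set (E d)).indicator (g α)) p volume :=
    (memLp_indicator_iff_restrict Ω.isOpen.measurableSet).2 (hg α)
  have hvi : MemLp ((Ω : Set (E d)).indicator v) p volume :=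
    (memLp_indicator_iff_restrict Ω.isOpen.measurableSet).2 hv.memLp
  set ε' : ℝ := ε / (Fintype.card (MultiIndex d s) + 1) with hε'
  have hε'0 : 0 < ε' := by positivity
  choose δ hδ hmol using fun α =>
    exists_eLpNorm_mollify_sub_le hp1 hp (hgi α) (ENNReal.ofReal_pos.2 hε'0)
  -- The kernel will vanish at distance `2 * τ` from the origin, which must be within every
  -- mollification radius `δ α`. The bound `r / 4` keeps the kernel away from `S` when `x` is at
  -- distance at least `r` from `z`.
  obtain ⟨τ, ⟨hτδ, hτr⟩, hτ0⟩ : ∃ τ : ℝ, ((∀ α, 2 * τ < δ α) ∧ τ < r / 4) ∧ 0 < τ := by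
    have h1 : ∀ᶠ τ : ℝ in nhdsWithin 0 (Ioi 0), (∀ α, 2 * τ < δ α) ∧ τ < r / 4 := by
      refine Filter.Eventually.filter_mono nhdsWithin_le_nhds ?_
      refine (Filter.eventually_all.2 fun α => ?_).and (gt_mem_nhds (by positivity))
      have : Filter.Tendsto (fun τ : ℝ => 2 * τ) (nhds 0) (nhds 0) := by
        have h := (continuous_const_mul (2 : ℝ)).tendsto 0
        rwa [mul_zero] at h
      exact this.eventually (gt_mem_nhds (hδ α))
    exact (h1.and self_mem_nhdsWithin).exists
  have hcτ : c * τ ≤ τ := by nlinarith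
  let b : ContDiffBump (0 : E d) := ⟨c * τ / 2, c * τ, by positivity, by
    have : 0 < c * τ := by positivity
    linarith⟩
  -- The shift centres `y ↦ ρ (x - y)` at `x + τ e` with radius `c τ`, so that its support is in the
  -- cone at `x`.
  let ρ : E d → ℝ := fun t => b.normed volume (t + τ • e)
  have hρs : ContDiff ℝ ∞ ρ := b.contDiff_normed.comp (contDiff_id.add contDiff_const)
  have hρ0 (t : E d) : 0 ≤ ρ t := b.nonneg_normed _
  have hρ1 : ∫ t, ρ t = 1 := by
    rw [← b.integral_normed (μ := volume)]
    exact integral_add_right_eq_self (b.normed volume) (τ • e)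
  have hτe : ‖τ • e‖ ≤ τ := by
    rw [norm_smul, Real.norm_eq_abs, abs_of_pos hτ0]; nlinarith
  have hρsupp (t : E d) (ht : ρ t ≠ 0) : ‖t + τ • e‖ < c * τ := by
    have : t + τ • e ∈ Function.support (b.normed volume) := ht
    rw [b.support_normed_eq, mem_ball_zero_iff] at this
    exact this
  have hρz (t : E d) (ht : 2 * τ ≤ ‖t‖) : ρ t = 0 := by
    by_contra hne
    have h1 := hρsupp t hne
    have h2 : ‖t‖ ≤ ‖t + τ • e‖ + ‖τ • e‖ := by
      calc ‖t‖ = ‖(t + τ • e) - τ • e‖ := by rw [add_sub_cancel_right]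
        _ ≤ _ := norm_sub_le _ _
    linarith
  have hρc : HasCompactSupport ρ := by
    refine HasCompactSupport.intro (isCompact_closedBall (0 : E d) (2 * τ)) fun x hx => hρz x ?_
    rw [mem_closedBall_zero_iff, not_le] at hx
    exact hx.le
  have hts (x : E d) : tsupport (fun y => ρ (x - y)) ⊆ {y | ‖y - (x + τ • e)‖ ≤ c * τ} := by
    refine closure_minimal (fun y hy => ?_)
      (isClosed_le (by fun_prop) continuous_const)
    have := hρsupp (x - y) hy
    rw [mem_ofPred_eq, ← norm_neg, show -(y - (x + τ • e)) = x - y + τ • e by abel]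
    exact this.le
  have hloc (j : Fin k) :
      LocallyIntegrable (fun y => (Ω : Set (E d)).indicator v y j) volume :=
    (hvi.continuousLinearMap_comp (EuclideanSpace.proj (𝕜 := ℝ) j)).locallyIntegrable hp1
  let w (j : Fin k) : smoothFun d :=
    ⟨fun x => ∫ y, ρ (x - y) * (Ω : Set (E d)).indicator v y j,
      contDiff_convolution hρs hρc (hloc j)⟩
  refine ⟨∑ j, smoothSobolev hΩ s p (stdVec k j) (w j), Submodule.sum_mem _ fun j _ =>
    Submodule.mem_iSup_of_mem (stdVec k j) ⟨w j, rfl⟩, ?_⟩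
  have hpoint (α : MultiIndex d s) (x : E d) (hx : x ∈ Ω) :
      ∑ j, multiDeriv α.exponents (w j).1 x • stdVec k j =
        ∫ y, ρ (x - y) • (Ω : Set (E d)).indicator (g α) y := by
    -- Near `z` the cone condition places the kernel in `Ω`. Farther away the kernel misses `S`,
    -- since `r / 2 + c τ + τ < r`.
    have hd : tsupport (fun y => ρ (x - y)) ⊆ Ω ∨ Disjoint (tsupport fun y => ρ (x - y)) S := by
      by_cases hxr : ‖x - z‖ < r
      · exact Or.inl fun y hy => hcone x hx hxr τ hτ0 (by linarith) y (hts x hy)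
      · refine Or.inr (disjoint_left.2 fun y hy hyS => hxr ?_)
        have h1 := hts x hy
        have h2 := hS hyS
        rw [mem_ofPred_eq] at h1
        rw [Metric.mem_ball, dist_eq_norm] at h2
        calc ‖x - z‖ = ‖(y - z) - (y - (x + τ • e)) - τ • e‖ := by congr 1; abel
          _ ≤ ‖y - z‖ + ‖y - (x + τ • e)‖ + ‖τ • e‖ :=
            (norm_sub_le _ _).trans (add_le_add_left (norm_sub_le _ _) _)
          _ < r := by linarith
    rw [← integral_iterDirDeriv_smul_eq hρs hρc (fun y hy => hv.eq_zero hy) (hgS α) (hgw α) hd]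
    have hInt : Integrable fun y => iterDirDeriv (stdVec d) α.exponents ρ (x - y) •
        (Ω : Set (E d)).indicator v y :=
      (hvi.locallyIntegrable hp1).integrable_smul_left_of_hasCompactSupport
        ((contDiff_iterDirDeriv hρs _ _).continuous.comp (continuous_const.sub continuous_id))
        ((hasCompactSupport_iterDirDeriv hρc _ _).comp_homeomorph (Homeomorph.subLeft x))
    ext j
    have h1 : ∫ y, iterDirDeriv (stdVec d) α.exponents ρ (x - y) *
        (Ω : Set (E d)).indicator v y j = (∫ y, iterDirDeriv (stdVec d) α.exponents ρ (x - y) •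
          (Ω : Set (E d)).indicator v y) j :=
      (EuclideanSpace.proj (𝕜 := ℝ) j).integral_comp_comm hInt
    rw [← h1]
    have h2 := congrFun (iterDirDeriv_convolution hρs hρc (hloc j) (stdVec d) α.exponents) x
    simp only [WithLp.ofLp_sum, Finset.sum_apply, PiLp.smul_apply, smul_eq_mul,
      PiLp.single_apply, mul_ite, mul_one, mul_zero, Finset.sum_ite_eq, Finset.mem_univ,
      if_true]
    exact h2
  have hnorm (α : MultiIndex d s) : ‖Sobolev.weakDeriv
      (ξ - ∑ j, smoothSobolev hΩ s p (stdVec k j) (w j)) α‖ ≤ ε' := by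
    rw [Sobolev.weakDeriv_sub, Sobolev.weakDeriv_sum, ← norm_neg, neg_sub, Lp.norm_def]
    refine ENNReal.toReal_le_of_le_ofReal hε'0.le ?_
    refine le_trans ?_ (hmol α ρ hρs.continuous hρ0 hρ1 fun t ht => hρz t ((hτδ α).le.trans ht))
    refine le_trans (le_of_eq (eLpNorm_congr_ae ?_))
      (eLpNorm_mono_measure _ (Measure.restrict_le_self (s := (Ω : Set (E d)))))
    have hall : ∀ᵐ x ∂(volume.restrict (Ω : Set (E d))), ∀ j : Fin k,
        (Sobolev.weakDeriv (smoothSobolev hΩ s p (stdVec k j) (w j)) α : E d → E k) x =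
          multiDeriv α.exponents (w j).1 x • stdVec k j :=
      ae_all_iff.2 fun j => weakDeriv_smoothSobolev hΩ (stdVec k j) (w j) α
    filter_upwards [hall, Lp.coeFn_sub
      (∑ j, Sobolev.weakDeriv (smoothSobolev hΩ s p (stdVec k j) (w j)) α) (Sobolev.weakDeriv ξ α),
      Lp.coeFn_fun_finsetSum Finset.univ
        fun j => Sobolev.weakDeriv (smoothSobolev hΩ s p (stdVec k j) (w j)) α,
      Sobolev.weakDeriv_ae_eq hξ (hg α) (hgw α), ae_restrict_mem Ω.isOpen.measurableSet]
      with x h1 h2 h3 h4 hx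
    rw [h2, Pi.sub_apply, h3, h4, indicator_of_mem hx, ← hpoint α x hx]
    congr 1
    exact Finset.sum_congr rfl fun j _ => h1 j
  rw [dist_eq_norm]
  calc _ ≤ ∑ α, ‖Sobolev.weakDeriv (ξ - ∑ j, smoothSobolev hΩ s p (stdVec k j) (w j)) α‖ :=
        Sobolev.norm_le_sum _
    _ ≤ ∑ α : MultiIndex d s, ε' := Finset.sum_le_sum fun α _ => hnorm α
    _ = Fintype.card (MultiIndex d s) * ε' := by simp
    _ < (Fintype.card (MultiIndex d s) + 1) * ε' := by linarith
    _ = ε := by rw [hε']; field_simp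

open scoped Manifold in
/-- Smooth functions on `ℝ^d` are dense in the Sobolev spaces of a bounded domain with Lipschitz
boundary. -/
theorem closure_smoothSubmodule (hΩ : Bornology.IsBounded (Ω : Set (E d)))
    (hLip : HasLipschitzBoundary (Ω : Set (E d))) (hp : p ≠ ⊤) :
    (smoothSubmodule hΩ s p k).topologicalClosure = ⊤ := by
  classical
  have hp1 : 1 ≤ p := Fact.out
  rw [eq_top_iff]
  intro ξ _
  choose! e r c he hr hc hc1 hcone using
    fun (z : E d) (hz : z ∈ closure (Ω : Set (E d))) => hLip.exists_cone Ω.isOpen hz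
  obtain ⟨t, ht, hcover⟩ := hΩ.isCompact_closure.elim_nhds_subcover
    (fun z => Metric.ball z (r z / 2)) fun z hz => Metric.ball_mem_nhds z (half_pos (hr z hz))
  -- Half radii leave room for the shifted kernels, as `mem_closure_smoothSubmodule_of_cone`
  -- demands.
  obtain ⟨φ, hφ⟩ := SmoothPartitionOfUnity.exists_isSubordinate 𝓘(ℝ, E d)
    (s := closure (Ω : Set (E d))) isClosed_closure (fun z : t => Metric.ball z.1 (r z.1 / 2))
    (fun _ => Metric.isOpen_ball) (by
      intro x hx
      obtain ⟨z, hz, hxz⟩ := mem_iUnion₂.1 (hcover hx)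
      exact mem_iUnion.2 ⟨⟨z, hz⟩, hxz⟩)
  have hu : IsSobolevSupportedOn Ω p univ s (Sobolev.toLp ξ : E d → E k) := by
    refine isSobolevSupportedOn_of_weakDeriv (Lp.memLp _) fun α hα => ?_
    have hlt (i : Fin d) : α i < s + 1 :=
      Nat.lt_succ_of_le ((Finset.single_le_sum (fun _ _ => Nat.zero_le _)
        (Finset.mem_univ i)).trans hα)
    let α' : MultiIndex d s := ⟨fun i => ⟨α i, hlt i⟩, hα⟩
    exact ⟨Sobolev.weakDeriv ξ α', Lp.memLp _, Sobolev.isWeakDeriv_weakDeriv ξ α'⟩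
  have hφs (z : t) : ContDiff ℝ ∞ (φ z) := contMDiff_iff_contDiff.1 (φ z).contMDiff
  have hφc (z : t) : HasCompactSupport (φ z) :=
    (isCompact_closedBall z.1 (r z.1 / 2)).of_isClosed_subset (isClosed_tsupport _)
      ((hφ z).trans Metric.ball_subset_closedBall)
  have hv (z : t) := hu.smooth_smul hp1 (hφs z) (hφc z)
  let η (z : t) : Sobolev Ω s p k := Sobolev.mk _ (hv z).memLp fun α => by
    obtain ⟨g, hg, _, hw⟩ := (hv z).exists_weakDeriv α.exponents α.2
    exact ⟨g, hg, hw⟩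
  have hη (z : t) : (Sobolev.toLp (η z) : E d → E k) =ᵐ[volume.restrict (Ω : Set (E d))]
      fun x => φ z x • (Sobolev.toLp ξ : E d → E k) x := Sobolev.toLp_mk _ _
  have hsum : ξ = ∑ z, η z := by
    refine Sobolev.ext_ae ?_
    rw [map_sum]
    filter_upwards [ae_all_iff.2 hη, Lp.coeFn_fun_finsetSum Finset.univ fun z => Sobolev.toLp (η z),
      ae_restrict_mem Ω.isOpen.measurableSet] with x h1 h2 hx
    rw [h2, Finset.sum_congr rfl fun z _ => h1 z, ← Finset.sum_smul, ← finsum_eq_sum_of_fintype,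
      φ.sum_eq_one (subset_closure hx), one_smul]
  rw [hsum]
  refine Submodule.sum_mem _ fun z _ => ?_
  have hz := ht z.1 z.2
  exact mem_closure_smoothSubmodule_of_cone hΩ hp (he _ hz) (hr _ hz) (hc _ hz) (hc1 _ hz)
    (hcone _ hz) (hφ z) (hv z) (hη z)

end Density

/-! ### Density of polynomials -/

section Polynomials

variable {d k : ℕ}

/-- The coordinate functions on `ℝ^d`. -/
def coord (i : Fin d) : E d → ℝ := fun x => x i

/-- The monomials on `ℝ^d`. -/
def monomialFun (d : ℕ) : Submonoid (E d → ℝ) := Submonoid.closure (range coord)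

/-- The polynomial functions on `ℝ^d`. -/
def polyFun (d : ℕ) : Subalgebra ℝ (E d → ℝ) := Algebra.adjoin ℝ (range coord)

lemma contDiff_coord (i : Fin d) : ContDiff ℝ ∞ (coord i) :=
  (EuclideanSpace.proj (𝕜 := ℝ) i : E d →L[ℝ] ℝ).contDiff

lemma contDiff_of_mem_monomialFun {m : E d → ℝ} (hm : m ∈ monomialFun d) : ContDiff ℝ ∞ m := by
  induction hm using Submonoid.closure_induction with
  | mem x hx => obtain ⟨i, rfl⟩ := hx; exact contDiff_coord i
  | one => exact contDiff_const
  | mul x y _ _ hx hy => exact hx.mul hy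

lemma polyFun_toSubmodule (d : ℕ) :
    Subalgebra.toSubmodule (polyFun d) = Submodule.span ℝ (monomialFun d : Set (E d → ℝ)) :=
  Algebra.adjoin_eq_span ℝ _

lemma polyFun_le_smoothFun (d : ℕ) : Subalgebra.toSubmodule (polyFun d) ≤ smoothFun d := by
  rw [polyFun_toSubmodule, Submodule.span_le]
  exact fun m hm => contDiff_of_mem_monomialFun hm

lemma coord_mem_polyFun (i : Fin d) : coord i ∈ polyFun d := Algebra.subset_adjoin ⟨i, rfl⟩

/-- Functions of two variables of the form `(x, y) ↦ m x * a y`, with `m` a polynomial and `a`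
continuous. -/
def splitFun (d : ℕ) : Set (E d → E d → ℝ) :=
  {F | ∃ m ∈ polyFun d, ∃ a : E d → ℝ, Continuous a ∧ F = fun x y => m x * a y}

lemma mul_mem_span_splitFun {F G : E d → E d → ℝ} (hF : F ∈ Submodule.span ℝ (splitFun d))
    (hG : G ∈ Submodule.span ℝ (splitFun d)) : F * G ∈ Submodule.span ℝ (splitFun d) := by
  have h := Submodule.mul_mem_mul hF hG
  rw [Submodule.span_mul_span] at h
  refine Submodule.span_mono ?_ h
  rintro _ ⟨_, ⟨m, hm, a, ha, rfl⟩, _, ⟨m', hm', a', ha', rfl⟩, rfl⟩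
  refine ⟨m * m', mul_mem hm hm', fun y => a y * a' y, ha.mul ha', ?_⟩
  ext x y
  simp only [Pi.mul_apply]
  ring

lemma pow_mem_span_splitFun {F : E d → E d → ℝ} (hF : F ∈ Submodule.span ℝ (splitFun d)) (n : ℕ) :
    F ^ n ∈ Submodule.span ℝ (splitFun d) := by
  induction n with
  | zero =>
    refine Submodule.subset_span ⟨1, one_mem _, fun _ => 1, continuous_const, ?_⟩
    ext x y; simp
  | succ n ih => rw [pow_succ]; exact mul_mem_span_splitFun ih hF

/-- Integrating out `y` leaves the polynomial factors in `x`. Integrability is proved alongside so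
that the integral of a sum can be split in the induction. -/
lemma integral_mem_polyFun {F : E d → E d → ℝ} (hF : F ∈ Submodule.span ℝ (splitFun d))
    {f : E d → ℝ} (hf : Continuous f) (hc : HasCompactSupport f) :
    (∀ x, Integrable fun y => F x y * f y) ∧ (fun x => ∫ y, F x y * f y) ∈ polyFun d := by
  induction hF using Submodule.span_induction with
  | mem F hF =>
    obtain ⟨m, hm, a, ha, rfl⟩ := hF
    have hi : Integrable fun y => a y * f y :=
      (ha.mul hf).integrable_of_hasCompactSupport hc.mul_left
    simp only [mul_assoc]
    refine ⟨fun x => hi.const_mul _, ?_⟩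
    have : (fun x => ∫ y, m x * (a y * f y)) = (∫ y, a y * f y) • m := by
      ext x
      rw [integral_const_mul, Pi.smul_apply, smul_eq_mul, mul_comm]
    rw [this]
    exact (polyFun d).smul_mem hm _
  | zero =>
    simp only [Pi.zero_apply, zero_mul, integral_zero]
    exact ⟨fun _ => integrable_zero _ _ _, zero_mem (polyFun d)⟩
  | add F G _ _ h1 h2 =>
    simp only [Pi.add_apply, add_mul]
    refine ⟨fun x => (h1.1 x).add (h2.1 x), ?_⟩
    have : (fun x => ∫ y, F x y * f y + G x y * f y) =
        (fun x => ∫ y, F x y * f y) + fun x => ∫ y, G x y * f y := by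
      ext x
      exact integral_add (h1.1 x) (h2.1 x)
    rw [this]
    exact add_mem h1.2 h2.2
  | smul a F _ h1 =>
    simp only [Pi.smul_apply, smul_eq_mul, mul_assoc]
    refine ⟨fun x => (h1.1 x).const_mul a, ?_⟩
    have : (fun x => ∫ y, a * (F x y * f y)) = a • fun x => ∫ y, F x y * f y := by
      ext x
      rw [integral_const_mul]; rfl
    rw [this]
    exact (polyFun d).smul_mem h1.2 _

/-- The base of the Landau kernel of radius `R`. -/
def landauBase (R : ℝ) (z : E d) : ℝ := 1 - ‖z‖ ^ 2 / R ^ 2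

/-- The squared norm is a polynomial in the coordinates of `x` and `y`. Hence all powers of the
kernel yield polynomials after convolution. -/
lemma landauBase_sub_mem (R : ℝ) :
    (fun x y : E d => landauBase R (x - y)) ∈ Submodule.span ℝ (splitFun d) := by
  have h1 : (fun _ _ : E d => (1 : ℝ)) ∈ Submodule.span ℝ (splitFun d) :=
    pow_mem_span_splitFun (zero_mem _) 0
  have hx (i : Fin d) : (fun x _ : E d => x i) ∈ Submodule.span ℝ (splitFun d) :=
    Submodule.subset_span ⟨coord i, coord_mem_polyFun i, fun _ => 1, continuous_const, by simp [coord]⟩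
  have hy (i : Fin d) : (fun _ y : E d => y i) ∈ Submodule.span ℝ (splitFun d) :=
    Submodule.subset_span ⟨1, one_mem _, coord i, (contDiff_coord i).continuous, by simp [coord]⟩
  have hs (i : Fin d) : ((fun x _ : E d => x i) - fun _ y : E d => y i) ^ 2 ∈
      Submodule.span ℝ (splitFun d) := pow_mem_span_splitFun (sub_mem (hx i) (hy i)) 2
  have key : (fun x y : E d => landauBase R (x - y)) = (fun _ _ : E d => (1 : ℝ)) -
      (R ^ 2)⁻¹ • ∑ i, ((fun x _ : E d => x i) - fun _ y : E d => y i) ^ 2 := by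
    ext x y
    simp only [landauBase, EuclideanSpace.real_norm_sq_eq, PiLp.sub_apply, Pi.sub_apply,
      Pi.smul_apply, Finset.sum_apply, Pi.pow_apply, smul_eq_mul]
    ring
  rw [key]
  exact sub_mem h1 (Submodule.smul_mem _ _ (Submodule.sum_mem _ fun i _ => hs i))

variable {Ω : TopologicalSpace.Opens (E d)}

/-- Smooth functions are limits of polynomials, together with their derivatives up to a given order
and uniformly on bounded sets. -/
lemma exists_polyFun_near (hΩ : Bornology.IsBounded (Ω : Set (E d))) (s : ℕ) {f : E d → ℝ}
    (hf : ContDiff ℝ ∞ f) (hc : HasCompactSupport f) {ε : ℝ} (hε : 0 < ε) :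
    ∃ P ∈ polyFun d, ∀ (α : MultiIndex d s), ∀ x ∈ Ω,
      |multiDeriv α.exponents P x - multiDeriv α.exponents f x| ≤ ε := by
  have : CompactSpace (closure (Ω : Set (E d))) := isCompact_iff_compactSpace.1 hΩ.isCompact_closure
  -- For `x ∈ Ω`, `f (x - y) ≠ 0` forces `‖y‖ ≤ R`. The integral over the whole space, which is a
  -- polynomial, thus equals the one over the ball, where the kernel is nonnegative.
  obtain ⟨R, hR0, hR⟩ : ∃ R : ℝ, 0 < R ∧ ∀ x ∈ closure (Ω : Set (E d)) ∪ tsupport f, ‖x‖ ≤ R / 2 := by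
    obtain ⟨C, hC⟩ := (hΩ.isCompact_closure.union hc).isBounded.exists_norm_le
    exact ⟨2 * (|C| + 1), by positivity, fun x hx => by linarith [hC x hx, le_abs_self C]⟩
  have hκc : Continuous (landauBase R : E d → ℝ) := by unfold landauBase; fun_prop
  set B := Metric.closedBall (0 : E d) R with hB
  let A (n : ℕ) : ℝ := (∫ y in B, landauBase R y ^ n)⁻¹
  let G (α : MultiIndex d s) : C(E d, C(closure (Ω : Set (E d)), ℝ)) := ContinuousMap.curry
    ⟨fun z => multiDeriv α.exponents f (z.2.1 - z.1),
      (contDiff_iterDirDeriv hf _ _).continuous.comp (by fun_prop)⟩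
  -- The base has its unique maximum on the ball at 0, so its normalised powers concentrate there.
  -- Taking values in the continuous functions on the closure of `Ω` makes the convergence uniform
  -- in `x`.
  have hlim (α : MultiIndex d s) : Filter.Tendsto
      (fun n : ℕ => A n • ∫ y in B, landauBase R y ^ n • G α y) Filter.atTop (nhds (G α 0)) := by
    refine tendsto_setIntegral_pow_smul_of_unique_maximum_of_isCompact_of_continuousOn
      (isCompact_closedBall 0 R) hκc.continuousOn (fun y _ hy => ?_) (fun y hy => ?_) ?_ ?_
      (G α).continuous.continuousOn
    · have : 0 < ‖y‖ ^ 2 / R ^ 2 := by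
        have := norm_pos_iff.2 hy
        positivity
      simp only [landauBase, norm_zero]
      simpa using this
    · rw [mem_closedBall_zero_iff] at hy
      have : ‖y‖ ^ 2 / R ^ 2 ≤ 1 := by
        rw [div_le_one (by positivity)]
        exact pow_le_pow_left₀ (norm_nonneg _) hy 2
      simp only [landauBase]; linarith
    · simp [landauBase]
    · refine subset_closure (mem_interior_iff_mem_nhds.2 (Metric.closedBall_mem_nhds _ hR0))
  have hev : ∀ᶠ n : ℕ in Filter.atTop, ∀ α : MultiIndex d s,
      ‖(A n • ∫ y in B, landauBase R y ^ n • G α y) - G α 0‖ < ε := by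
    refine Filter.eventually_all.2 fun α => ?_
    have := (tendsto_iff_norm_sub_tendsto_zero.1 (hlim α)).eventually (gt_mem_nhds hε)
    exact this
  obtain ⟨n, hn⟩ := hev.exists
  have hκn : Continuous fun y : E d => landauBase R y ^ n := hκc.pow n
  have hpoly : (fun x => ∫ y, f (x - y) * landauBase R y ^ n) ∈ polyFun d := by
    have h := (integral_mem_polyFun (pow_mem_span_splitFun (landauBase_sub_mem R) n)
      hf.continuous hc).2
    convert h using 2 with x
    rw [← integral_sub_left_eq_self _ volume x]
    simp only [sub_sub_cancel, Pi.pow_apply]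
    congr 1; ext y; ring
  refine ⟨A n • fun x => ∫ y, f (x - y) * landauBase R y ^ n, (polyFun d).smul_mem hpoly _,
    fun α x hx => ?_⟩
  have hD : multiDeriv α.exponents (A n • fun x => ∫ y, f (x - y) * landauBase R y ^ n) x =
      (A n • ∫ y in B, landauBase R y ^ n • G α y) ⟨x, subset_closure hx⟩ := by
    have h1 := iterDirDeriv_smul (contDiff_convolution hf hc hκn.locallyIntegrable) (A n)
      (stdVec d) α.exponents
    rw [multiDeriv_eq_iterDirDeriv, h1,
      iterDirDeriv_convolution hf hc hκn.locallyIntegrable, Pi.smul_apply,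
      ContinuousMap.smul_apply]
    congr 1
    have hInt : IntegrableOn (fun y => landauBase R y ^ n • G α y) B :=
      (hκn.smul (G α).continuous).continuousOn.integrableOn_compact (isCompact_closedBall 0 R)
    rw [ContinuousMap.integral_apply hInt, ← integral_indicator Metric.isClosed_closedBall.measurableSet]
    congr 1
    ext y
    by_cases hy : y ∈ B
    · rw [indicator_of_mem hy, mul_comm]; rfl
    · rw [indicator_of_notMem hy, image_eq_zero_of_notMem_tsupport (f := iterDirDeriv _ _ f),
        zero_mul]
      intro hmem
      have h2 := hR (x - y) (Or.inr (tsupport_iterDirDeriv_subset f (stdVec d) _ hmem))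
      have h3 := hR x (Or.inl (subset_closure hx))
      refine hy (mem_closedBall_zero_iff.2 ?_)
      calc ‖y‖ = ‖x - (x - y)‖ := by rw [sub_sub_cancel]
        _ ≤ ‖x‖ + ‖x - y‖ := norm_sub_le _ _
        _ ≤ R := by linarith
  have h0 : multiDeriv α.exponents f x = G α 0 ⟨x, subset_closure hx⟩ := by
    change _ = multiDeriv α.exponents f (x - 0)
    rw [sub_zero]
  rw [hD, h0, ← ContinuousMap.sub_apply]
  exact ((ContinuousMap.norm_coe_le_norm _ _).trans (hn α).le)

/-- Polynomials are dense in the Sobolev spaces of a bounded domain with Lipschitz boundary. -/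
theorem submodule_eq_top_of_monomials {s : ℕ} {p : ℝ≥0∞} [Fact (1 ≤ p)] (hp : p ≠ ⊤)
    (hΩ : Bornology.IsBounded (Ω : Set (E d))) (hLip : HasLipschitzBoundary (Ω : Set (E d)))
    {V : Submodule ℝ (Sobolev Ω s p k)} (hV : IsClosed (V : Set (Sobolev Ω s p k)))
    (h : ∀ (c : E k) (m : smoothFun d), m.1 ∈ monomialFun d → smoothSobolev hΩ s p c m ∈ V) :
    V = ⊤ := by
  rw [eq_top_iff, ← closure_smoothSubmodule hΩ hLip hp]
  refine Submodule.topologicalClosure_minimal _ (iSup_le fun c => ?_) hV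
  have hpoly (P : E d → ℝ) (hP : P ∈ Submodule.span ℝ (monomialFun d : Set (E d → ℝ)))
      (hP' : P ∈ smoothFun d) : smoothSobolev hΩ s p c ⟨P, hP'⟩ ∈ V := by
    induction hP using Submodule.span_induction with
    | mem m hm => exact h c ⟨m, hP'⟩ hm
    | zero => exact (map_zero (smoothSobolev hΩ s p c)).symm ▸ V.zero_mem
    | add f g hf hg ihf ihg =>
      rw [← polyFun_toSubmodule] at hf hg
      exact (map_add (smoothSobolev hΩ s p c) ⟨f, polyFun_le_smoothFun d hf⟩
        ⟨g, polyFun_le_smoothFun d hg⟩).symm ▸ V.add_mem (ihf _) (ihg _)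
    | smul a f hf ihf =>
      rw [← polyFun_toSubmodule] at hf
      exact (map_smul (smoothSobolev hΩ s p c) a ⟨f, polyFun_le_smoothFun d hf⟩).symm ▸
        V.smul_mem a (ihf _)
  rintro _ ⟨g, rfl⟩
  obtain ⟨C, hC⟩ := hΩ.exists_norm_le
  -- Multiplying by a cutoff equal to 1 on `Ω` gives compact support without changing the Sobolev
  -- function.
  let b : ContDiffBump (0 : E d) := ⟨|C| + 1, |C| + 2, by positivity, by linarith⟩
  have hb1 (x : E d) (hx : x ∈ Ω) : b x = 1 := by
    refine b.one_of_mem_closedBall (mem_closedBall_zero_iff.2 ?_)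
    change ‖x‖ ≤ |C| + 1
    linarith [hC x hx, le_abs_self C]
  let f : smoothFun d := ⟨fun x => b x * g.1 x, b.contDiff.mul (contDiff_smoothFun g)⟩
  have hfc : HasCompactSupport f.1 := b.hasCompactSupport.mul_right
  have hfg : smoothSobolev hΩ s p c g = smoothSobolev hΩ s p c f := by
    refine Sobolev.ext_ae ?_
    filter_upwards [toLp_smoothSobolev (s := s) (p := p) hΩ c g,
      toLp_smoothSobolev (s := s) (p := p) hΩ c f,
      ae_restrict_mem Ω.isOpen.measurableSet] with x h1 h2 hx
    rw [h1, h2]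
    simp only [f, hb1 x hx, one_mul]
  rw [hfg, ← SetLike.mem_coe, ← hV.closure_eq]
  refine Metric.mem_closure_iff.2 fun ε hε => ?_
  obtain ⟨M, hM0, hM⟩ := exists_norm_smoothSobolev_le hΩ s p c
  obtain ⟨P, hP, hPf⟩ := exists_polyFun_near hΩ s (contDiff_smoothFun f) hfc
    (ε := ε / (2 * M)) (by positivity)
  have hPs : P ∈ smoothFun d := polyFun_le_smoothFun d hP
  refine ⟨_, hpoly P (by rw [← polyFun_toSubmodule]; exact hP) hPs, ?_⟩
  rw [dist_comm, dist_eq_norm, ← map_sub]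
  refine (hM _ (ε / (2 * M)) (by positivity) fun α x hx => ?_).trans_lt ?_
  · rw [multiDeriv_sub]
    exact hPf α x hx
  · have : M * (ε / (2 * M)) = ε / 2 := by field_simp
    linarith

end Polynomials

/-! ### Derivatives of a smooth function that is not a polynomial -/

section Activation

/-- By induction the derivative of `f` is a polynomial, and `f` differs from an antiderivative of it
by a constant. -/
lemma exists_polynomial_of_iteratedDeriv_eq_zero {n : ℕ} {f : ℝ → ℝ} (hf : ContDiff ℝ ∞ f)
    (h : ∀ t, iteratedDeriv n f t = 0) : ∃ P : Polynomial ℝ, ∀ t, f t = P.eval t := by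
  induction n generalizing f with
  | zero => exact ⟨0, fun t => by simpa using h t⟩
  | succ n ih =>
    have hf' : ContDiff ℝ ∞ (deriv f) := (contDiff_infty_iff_deriv.1 hf).2
    obtain ⟨P, hP⟩ := ih hf' fun t => by rw [← iteratedDeriv_succ']; exact h t
    obtain ⟨Q, hQ⟩ : ∃ Q : Polynomial ℝ, Q.derivative = P := by
      clear hP
      induction P using Polynomial.induction_on' with
      | add p q hp hq =>
        obtain ⟨P, rfl⟩ := hp
        obtain ⟨Q, rfl⟩ := hq
        exact ⟨P + Q, Polynomial.derivative_add⟩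
      | monomial n a =>
        refine ⟨Polynomial.monomial (n + 1) (a / (n + 1)), ?_⟩
        rw [Polynomial.derivative_monomial]
        congr 1
        push_cast
        field_simp
    have hconst (t : ℝ) : f t - Q.eval t = f 0 - Q.eval 0 := by
      refine is_const_of_deriv_eq_zero (f := fun t => f t - Q.eval t)
        ((hf.differentiable (by simp)).sub Q.differentiable) (fun x => ?_) t 0
      rw [deriv_fun_sub ((hf.differentiable (by simp)) x) Q.differentiableAt, Q.deriv, hQ, hP,
        sub_self]
    exact ⟨Q + Polynomial.C (f 0 - Q.eval 0), fun t => by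
      rw [Polynomial.eval_add, Polynomial.eval_C, ← hconst t]; ring⟩

lemma exists_iteratedDeriv_ne_zero {σ : ℝ → ℝ} (hσ : ContDiff ℝ ∞ σ)
    (hpoly : ¬ ∃ P : Polynomial ℝ, ∀ t, σ t = P.eval t) (n : ℕ) :
    ∃ b, iteratedDeriv n σ b ≠ 0 := by
  by_contra! h
  exact hpoly (exists_polynomial_of_iteratedDeriv_eq_zero hσ h)

lemma contDiff_iteratedDeriv {σ : ℝ → ℝ} (hσ : ContDiff ℝ ∞ σ) (n : ℕ) :
    ContDiff ℝ ∞ (iteratedDeriv n σ) := by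
  rw [iteratedDeriv_eq_iterate]
  exact hσ.iterate_deriv n

lemma hasDerivAt_iteratedDeriv {σ : ℝ → ℝ} (hσ : ContDiff ℝ ∞ σ) (n : ℕ) (t : ℝ) :
    HasDerivAt (iteratedDeriv n σ) (iteratedDeriv (n + 1) σ t) t := by
  rw [iteratedDeriv_succ]
  exact ((contDiff_iteratedDeriv hσ n).differentiable (by simp) t).hasDerivAt

end Activation

/-! ### Features: continuity and separation of points -/

section Features

variable {d k : ℕ} {Ω : TopologicalSpace.Opens (E d)} {σ : ℝ → ℝ}

lemma dotProduct_eq_inner (w y : E d) : (w : Fin d → ℝ) ⬝ᵥ (y : Fin d → ℝ) = inner ℝ w y := by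
  simp [PiLp.inner_apply, dotProduct, mul_comm]

lemma dotProduct_sumElim (a : Fin k ⊕ Fin d → ℝ) (u : E k) (y : E d) :
    a ⬝ᵥ Sum.elim u y = ∑ i, a (Sum.inl i) * u i + ∑ i, a (Sum.inr i) * y i := by
  simp [dotProduct, Fintype.sum_sum_type]

/-- A neuron of the lifting layer, averaged over `Ω` and passed through a neuron of the hidden
layer. -/
structure Feature (k d : ℕ) where
  outerBias : ℝ
  outerWeight : ℝ
  innerWeight : Fin k ⊕ Fin d → ℝ
  innerBias : ℝ

/-- The average of a neuron of the lifting layer over `Ω`. -/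
def neuronAverage (σ : ℝ → ℝ) (Ω : Set (E d)) (a : Fin k ⊕ Fin d → ℝ) (b : ℝ) (u : E d → E k) : ℝ :=
  ⨍ y in Ω, σ (a ⬝ᵥ Sum.elim (u y) y + b)

/-- The value of a feature at the function `u`. -/
def Feature.eval (φ : Feature k d) (σ : ℝ → ℝ) (Ω : Set (E d)) (u : E d → E k) : ℝ :=
  σ (φ.outerWeight * neuronAverage σ Ω φ.innerWeight φ.innerBias u + φ.outerBias)

lemma LipschitzWith.abs_le_add {C : ℝ≥0} (hσ : LipschitzWith C σ) (t : ℝ) :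
    |σ t| ≤ |σ 0| + C * |t| := by
  have h := hσ.dist_le_mul t 0
  rw [Real.dist_eq, Real.dist_eq, sub_zero] at h
  have h2 : |σ t| ≤ |σ t - σ 0| + |σ 0| := by
    calc |σ t| = |(σ t - σ 0) + σ 0| := by rw [sub_add_cancel]
      _ ≤ _ := abs_add_le _ _
  linarith

/-- A Lipschitz function grows at most linearly, which is harmless on a finite measure space. -/
lemma integrable_comp_of_lipschitz {C : ℝ≥0} (hσ : LipschitzWith C σ) {μ : Measure (E d)}
    [IsFiniteMeasure μ] {f : E d → ℝ} (hf : Integrable f μ) : Integrable (fun y => σ (f y)) μ := by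
  refine Integrable.mono' (g := fun y => |σ 0| + C * |f y|)
    ((integrable_const _).add (hf.abs.const_mul _))
    (hσ.continuous.comp_aestronglyMeasurable hf.1) ?_
  filter_upwards with y
  exact LipschitzWith.abs_le_add hσ (f y)

lemma integrable_restrict_of_continuous (hΩ : Bornology.IsBounded (Ω : Set (E d))) {g : E d → ℝ}
    (hg : Continuous g) : Integrable g (volume.restrict (Ω : Set (E d))) :=
  (hg.continuousOn.integrableOn_compact hΩ.isCompact_closure).mono_set subset_closure

lemma integrable_dotProduct (hΩ : Bornology.IsBounded (Ω : Set (E d))) {u : E d → E k}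
    (hu : Integrable u (volume.restrict (Ω : Set (E d)))) (a : Fin k ⊕ Fin d → ℝ) (b : ℝ) :
    Integrable (fun y => a ⬝ᵥ Sum.elim (u y) y + b) (volume.restrict (Ω : Set (E d))) := by
  have := isFiniteMeasure_restrict_of_isBounded hΩ
  simp only [dotProduct_sumElim, add_assoc]
  refine Integrable.add (integrable_finsetSum _ fun i _ => Integrable.const_mul ?_ _)
    (integrable_restrict_of_continuous hΩ (by fun_prop))
  exact (EuclideanSpace.proj (𝕜 := ℝ) i).integrable_comp hu

lemma norm_dotProduct_sub_le (a : Fin k ⊕ Fin d → ℝ) (u v : E k) (y : E d) :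
    |a ⬝ᵥ Sum.elim u y - a ⬝ᵥ Sum.elim v y| ≤ (∑ i, |a (Sum.inl i)|) * ‖u - v‖ := by
  rw [dotProduct_sumElim, dotProduct_sumElim, add_sub_add_right_eq_sub, ← Finset.sum_sub_distrib,
    Finset.sum_mul]
  refine (Finset.abs_sum_le_sum_abs _ _).trans (Finset.sum_le_sum fun i _ => ?_)
  rw [← mul_sub, abs_mul]
  refine mul_le_mul_of_nonneg_left ?_ (abs_nonneg _)
  exact PiLp.norm_apply_le (u - v) i

lemma integrable_of_Lp (hΩ : Bornology.IsBounded (Ω : Set (E d))) {p : ℝ≥0∞} [Fact (1 ≤ p)]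
    (u : LpOn Ω p k) : Integrable u (volume.restrict (Ω : Set (E d))) := by
  have := isFiniteMeasure_restrict_of_isBounded hΩ
  exact (Lp.memLp u).integrable Fact.out

lemma exists_integral_norm_le (hΩ : Bornology.IsBounded (Ω : Set (E d))) (p : ℝ≥0∞) [Fact (1 ≤ p)]
    (k : ℕ) : ∃ D : ℝ, 0 ≤ D ∧ ∀ u : LpOn Ω p k, ∫ y in (Ω : Set (E d)), ‖u y‖ ≤ D * ‖u‖ := by
  have := isFiniteMeasure_restrict_of_isBounded hΩ
  set M := (volume.restrict (Ω : Set (E d))) univ ^ (1 / (1 : ℝ≥0∞).toReal - 1 / p.toReal) with hM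
  have hMt : M ≠ ⊤ := by
    refine ENNReal.rpow_ne_top_of_nonneg ?_ (measure_ne_top _ _)
    rcases eq_or_ne p ⊤ with rfl | hp
    · simp
    · have h1 : 1 ≤ p.toReal := by
        have := ENNReal.toReal_mono hp (Fact.out : 1 ≤ p)
        simpa using this
      rw [ENNReal.toReal_one, sub_nonneg, one_div_one]
      exact (div_le_one (by linarith)).2 h1
  refine ⟨M.toReal, ENNReal.toReal_nonneg, fun u => ?_⟩
  rw [integral_norm_eq_lintegral_enorm (Lp.aestronglyMeasurable u),
    ← eLpNorm_one_eq_lintegral_enorm, mul_comm, Lp.norm_def, ← ENNReal.toReal_mul]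
  refine ENNReal.toReal_mono (ENNReal.mul_ne_top (Lp.eLpNorm_ne_top u) hMt) ?_
  exact eLpNorm_le_eLpNorm_mul_rpow_measure_univ Fact.out (Lp.aestronglyMeasurable u)

/-- The average is Lipschitz in `u` for the `L^1` norm, which on a bounded domain is dominated by
the `L^p` norm and so by the Sobolev norm. -/
lemma continuous_neuronAverage (hΩ : Bornology.IsBounded (Ω : Set (E d))) {C : ℝ≥0}
    (hσ : LipschitzWith C σ) {s : ℕ} {p : ℝ≥0∞} [Fact (1 ≤ p)] (a : Fin k ⊕ Fin d → ℝ) (b : ℝ) :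
    Continuous fun u : Sobolev Ω s p k => neuronAverage σ Ω a b (Sobolev.toLp u : E d → E k) := by
  have := isFiniteMeasure_restrict_of_isBounded hΩ
  obtain ⟨D, hD0, hD⟩ := exists_integral_norm_le hΩ p k
  set V := (volume.restrict (Ω : Set (E d))).real univ with hV
  have hV0 : 0 ≤ V⁻¹ := inv_nonneg.2 measureReal_nonneg
  set A := ∑ i, |a (Sum.inl i)| with hA
  have hA0 : 0 ≤ A := Finset.sum_nonneg fun _ _ => abs_nonneg _
  refine LipschitzWith.continuous (K := (V⁻¹ * (C * A * D)).toNNReal)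
    (LipschitzWith.of_dist_le_mul fun u v => ?_)
  rw [Real.coe_toNNReal _ (by positivity), Real.dist_eq]
  have hi (u : Sobolev Ω s p k) := integrable_comp_of_lipschitz hσ
    (integrable_dotProduct hΩ (integrable_of_Lp hΩ (Sobolev.toLp u)) a b)
  unfold neuronAverage
  rw [average_eq, average_eq, ← smul_sub, ← integral_sub (hi u) (hi v), smul_eq_mul, abs_mul,
    abs_of_nonneg hV0, mul_assoc]
  refine mul_le_mul_of_nonneg_left ?_ hV0
  calc |∫ y in (Ω : Set (E d)), (σ (a ⬝ᵥ Sum.elim (Sobolev.toLp u y) y + b) -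
        σ (a ⬝ᵥ Sum.elim (Sobolev.toLp v y) y + b))|
      ≤ ∫ y in (Ω : Set (E d)), C * A * ‖Sobolev.toLp (u - v) y‖ := by
        rw [← Real.norm_eq_abs]
        refine norm_integral_le_of_norm_le ((integrable_of_Lp hΩ _).norm.const_mul _) ?_
        rw [map_sub]
        filter_upwards [Lp.coeFn_sub (Sobolev.toLp u) (Sobolev.toLp v)] with y hy
        rw [hy, Pi.sub_apply]
        have h1 := hσ.dist_le_mul (a ⬝ᵥ Sum.elim (Sobolev.toLp u y) y + b)
          (a ⬝ᵥ Sum.elim (Sobolev.toLp v y) y + b)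
        rw [Real.dist_eq, Real.dist_eq, add_sub_add_right_eq_sub] at h1
        rw [Real.norm_eq_abs, mul_assoc]
        exact h1.trans (mul_le_mul_of_nonneg_left (norm_dotProduct_sub_le a _ _ y) C.coe_nonneg)
    _ = C * A * ∫ y in (Ω : Set (E d)), ‖Sobolev.toLp (u - v) y‖ := integral_const_mul _ _
    _ ≤ C * A * (D * ‖Sobolev.toLp (u - v)‖) :=
        mul_le_mul_of_nonneg_left (hD _) (by positivity)
    _ ≤ C * A * (D * dist u v) := by
        rw [dist_eq_norm]
        gcongr
        exact Sobolev.norm_toLp_le _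
    _ = C * A * D * dist u v := by ring

lemma Feature.continuous_eval (φ : Feature k d) (hΩ : Bornology.IsBounded (Ω : Set (E d))) {C : ℝ≥0}
    (hσ : LipschitzWith C σ) {s : ℕ} {p : ℝ≥0∞} [Fact (1 ≤ p)] :
    Continuous fun u : Sobolev Ω s p k => φ.eval σ Ω (Sobolev.toLp u : E d → E k) :=
  hσ.continuous.comp ((continuous_const.mul (continuous_neuronAverage hΩ hσ _ _)).add
    continuous_const)

lemma integrable_continuous_mul (hΩ : Bornology.IsBounded (Ω : Set (E d))) {g h : E d → ℝ}
    (hg : Continuous g) (hh : Integrable h (volume.restrict (Ω : Set (E d)))) :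
    Integrable (fun y => g y * h y) (volume.restrict (Ω : Set (E d))) := by
  obtain ⟨C, hC⟩ := exists_bound_of_continuous hΩ hg
  refine hh.bdd_mul hg.aestronglyMeasurable (c := C) ?_
  filter_upwards [ae_restrict_mem Ω.isOpen.measurableSet] with y hy
  exact hC y (subset_closure hy)

/-- An integrable function orthogonal to all polynomials vanishes. -/
lemma ae_eq_zero_of_integral_polyFun_mul (hΩ : Bornology.IsBounded (Ω : Set (E d))) {h : E d → ℝ}
    (hh : Integrable h (volume.restrict (Ω : Set (E d))))
    (h0 : ∀ P ∈ polyFun d, ∫ y in (Ω : Set (E d)), P y * h y = 0) :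
    h =ᵐ[volume.restrict (Ω : Set (E d))] 0 := by
  have key := Ω.isOpen.ae_eq_zero_of_integral_contDiff_smul_eq_zero
    (μ := volume.restrict (Ω : Set (E d))) (hh.locallyIntegrable.locallyIntegrableOn _) (by
      intro φ h1 h2 h3
      simp only [smul_eq_mul]
      by_contra hne
      set I := ∫ y in (Ω : Set (E d)), |h y| with hI
      have hI0 : 0 ≤ I := integral_nonneg fun _ => abs_nonneg _
      have hpos : 0 < |∫ y in (Ω : Set (E d)), φ y * h y| := abs_pos.2 hne
      -- Since `P` is orthogonal to `h`, the integral of `φ h` is at most the sup distance of `P`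
      -- and `φ` times `I`; this tolerance makes it smaller than itself.
      obtain ⟨P, hP, hPφ⟩ := exists_polyFun_near hΩ 0 h1 h2
        (ε := |∫ y in (Ω : Set (E d)), φ y * h y| / (2 * (I + 1))) (by positivity)
      have hPc : Continuous P := (show ContDiff ℝ ∞ P from polyFun_le_smoothFun d hP).continuous
      have e1 : ∫ y in (Ω : Set (E d)), φ y * h y =
          -∫ y in (Ω : Set (E d)), (P y - φ y) * h y := by
        simp only [sub_mul]
        rw [integral_sub (integrable_continuous_mul hΩ hPc hh)
          (integrable_continuous_mul hΩ h1.continuous hh), h0 P hP]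
        ring
      have e2 : |∫ y in (Ω : Set (E d)), φ y * h y| ≤
          |∫ y in (Ω : Set (E d)), φ y * h y| / (2 * (I + 1)) * I := by
        conv_lhs => rw [e1, abs_neg]
        rw [hI, ← integral_const_mul]
        refine (Real.norm_eq_abs _).symm.trans_le
          (norm_integral_le_of_norm_le (hh.abs.const_mul _) ?_)
        filter_upwards [ae_restrict_mem Ω.isOpen.measurableSet] with y hy
        rw [norm_mul, Real.norm_eq_abs, Real.norm_eq_abs]
        refine mul_le_mul_of_nonneg_right ?_ (abs_nonneg _)
        have h4 := hPφ (MultiIndex.zero d 0) y hy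
        have h5 : (MultiIndex.zero d 0).exponents = 0 := by
          ext i; simp [MultiIndex.zero, MultiIndex.exponents]
        rwa [h5, multiDeriv_zero, multiDeriv_zero] at h4
      have e3 : |∫ y in (Ω : Set (E d)), φ y * h y| / (2 * (I + 1)) * I <
          |∫ y in (Ω : Set (E d)), φ y * h y| := by
        rw [div_mul_eq_mul_div, div_lt_iff₀ (by positivity)]
        nlinarith
      linarith)
  filter_upwards [key, ae_restrict_mem Ω.isOpen.measurableSet] with y hy hm
  exact hy hm

/-- An integrable function orthogonal to all ridge functions `y ↦ σ' (⟪w, y⟫ + b)` vanishes. -/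
lemma ae_eq_zero_of_integral_ridge_mul (hΩ : Bornology.IsBounded (Ω : Set (E d)))
    (hσ : ContDiff ℝ ∞ σ) (hpoly : ¬ ∃ P : Polynomial ℝ, ∀ t, σ t = P.eval t) {h : E d → ℝ}
    (hh : Integrable h (volume.restrict (Ω : Set (E d))))
    (h0 : ∀ (w : E d) (b : ℝ),
      ∫ y in (Ω : Set (E d)), iteratedDeriv 1 σ (inner ℝ w y + b) * h y = 0) :
    h =ᵐ[volume.restrict (Ω : Set (E d))] 0 := by
  -- Differentiating the vanishing integral along the `i`-th coordinate of `w` multiplies the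
  -- integrand by `yᵢ` and raises the order of the derivative of `σ`. The order depends on `m` only,
  -- so `w` and `b` stay free.
  have hmono (m : E d → ℝ) (hm : m ∈ monomialFun d) : ∃ n, ∀ (w : E d) (b : ℝ),
      ∫ y in (Ω : Set (E d)), m y * iteratedDeriv n σ (inner ℝ w y + b) * h y = 0 := by
    induction hm using Submonoid.closure_induction_right with
    | one => exact ⟨1, fun w b => by simpa using h0 w b⟩
    | mul_right m hm c hc ih =>
      obtain ⟨i, rfl⟩ := hc
      obtain ⟨n, hn⟩ := ih
      have hmc : Continuous m := (contDiff_of_mem_monomialFun hm).continuous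
      refine ⟨n + 1, fun w b => ?_⟩
      have hcn (n : ℕ) : Continuous (iteratedDeriv n σ) := (contDiff_iteratedDeriv hσ n).continuous
      let F' : ℝ → E d → ℝ := fun t y =>
        m y * (coord i y * iteratedDeriv (n + 1) σ (inner ℝ w y + t * coord i y + b)) * h y
      have hci : Continuous (coord i : E d → ℝ) := (contDiff_coord i).continuous
      obtain ⟨B, hB⟩ := ((isCompact_Icc (a := (-1 : ℝ)) (b := 1)).prod
        hΩ.isCompact_closure).exists_bound_of_continuousOn (f := fun z : ℝ × E d =>
          m z.2 * (coord i z.2 *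
            iteratedDeriv (n + 1) σ (inner ℝ w z.2 + z.1 * coord i z.2 + b)))
        (by
          have := hcn (n + 1)
          exact Continuous.continuousOn (by fun_prop))
      have hder := (hasDerivAt_integral_of_dominated_loc_of_deriv_le
        (μ := volume.restrict (Ω : Set (E d))) (x₀ := (0 : ℝ)) (s := Icc (-1) 1)
        (F := fun t y => m y * iteratedDeriv n σ (inner ℝ w y + t * coord i y + b) * h y)
        (F' := F') (bound := fun y => B * |h y|)
        (Icc_mem_nhds (by norm_num) (by norm_num))
        (Filter.Eventually.of_forall fun t =>
          (integrable_continuous_mul hΩ (by have := hcn n; fun_prop) hh).1)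
        (integrable_continuous_mul hΩ (by have := hcn n; fun_prop) hh)
        (integrable_continuous_mul hΩ (by have := hcn (n + 1); fun_prop) hh).1
        (by
          filter_upwards [ae_restrict_mem Ω.isOpen.measurableSet] with y hy t ht
          rw [norm_mul, Real.norm_eq_abs (h y)]
          exact mul_le_mul_of_nonneg_right (hB (t, y) ⟨ht, subset_closure hy⟩) (abs_nonneg _))
        (hh.abs.const_mul B)
        (by
          filter_upwards with y t _
          have e1 : HasDerivAt (fun t => inner ℝ w y + t * coord i y + b) (coord i y) t := by
            simpa using (((hasDerivAt_id t).mul_const (coord i y)).const_add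
              (inner ℝ w y)).add_const b
          have e2 := (((hasDerivAt_iteratedDeriv hσ n
            (inner ℝ w y + t * coord i y + b)).comp t e1).const_mul (m y)).mul_const (h y)
          exact e2.congr_deriv (by simp only [F']; ring))).2
      have hzero : (fun t : ℝ => ∫ y in (Ω : Set (E d)),
          m y * iteratedDeriv n σ (inner ℝ w y + t * coord i y + b) * h y) = fun _ => 0 := by
        ext t
        have := hn (w + t • stdVec d i) b
        rw [← this]
        congr 1; ext y
        rw [inner_add_left, inner_smul_left]
        simp [coord, EuclideanSpace.inner_single_left]
      rw [hzero] at hder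
      have := hder.unique (hasDerivAt_const 0 0)
      rw [← this]
      congr 1; ext y
      simp only [F', Pi.mul_apply, zero_mul, add_zero]
      ring
  refine ae_eq_zero_of_integral_polyFun_mul hΩ hh fun P hP => ?_
  replace hP : P ∈ Subalgebra.toSubmodule (polyFun d) := hP
  rw [polyFun_toSubmodule] at hP
  have hcont {P : E d → ℝ} (hP : P ∈ Submodule.span ℝ (monomialFun d : Set (E d → ℝ))) :
      Continuous P := by
    rw [← polyFun_toSubmodule] at hP
    exact (show ContDiff ℝ ∞ P from polyFun_le_smoothFun d hP).continuous
  induction hP using Submodule.span_induction with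
  | mem m hm =>
    obtain ⟨n, hn⟩ := hmono m hm
    -- For `w = 0` the factor coming from `σ` is a constant, nonzero for this `b`.
    obtain ⟨b, hb⟩ := exists_iteratedDeriv_ne_zero hσ hpoly n
    have h1 := hn 0 b
    simp only [inner_zero_left, zero_add] at h1
    have h2 : ∫ y in (Ω : Set (E d)), m y * iteratedDeriv n σ b * h y =
        iteratedDeriv n σ b * ∫ y in (Ω : Set (E d)), m y * h y := by
      rw [← integral_const_mul]
      congr 1; ext y; ring
    rw [h2] at h1
    exact (mul_eq_zero.1 h1).resolve_left hb
  | zero => simp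
  | add f g hf hg ihf ihg =>
    simp only [Pi.add_apply, add_mul]
    rw [integral_add (integrable_continuous_mul hΩ (hcont hf) hh)
      (integrable_continuous_mul hΩ (hcont hg) hh), ihf, ihg, add_zero]
  | smul a f hf ihf =>
    simp only [Pi.smul_apply, smul_eq_mul, mul_assoc]
    rw [integral_const_mul, ihf, mul_zero]

/-- Linearises a neuron in its input. As `f` is merely integrable, domination comes from the
Lipschitz bound `C * |f y|`. -/
lemma hasDerivAt_integral_neuron (hΩ : Bornology.IsBounded (Ω : Set (E d)))
    (hσ : ContDiff ℝ ∞ σ) {C : ℝ≥0} (hσL : LipschitzWith C σ) {f : E d → ℝ}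
    (hf : Integrable f (volume.restrict (Ω : Set (E d)))) (w : E d) (b : ℝ) :
    HasDerivAt (fun t : ℝ => ∫ y in (Ω : Set (E d)), σ (t * f y + inner ℝ w y + b))
      (∫ y in (Ω : Set (E d)), iteratedDeriv 1 σ (inner ℝ w y + b) * f y) 0 := by
  have := isFiniteMeasure_restrict_of_isBounded hΩ
  have hInt (t : ℝ) : Integrable (fun y => σ (t * f y + inner ℝ w y + b))
      (volume.restrict (Ω : Set (E d))) := by
    refine integrable_comp_of_lipschitz hσL ?_
    simp only [add_assoc]
    exact (hf.const_mul t).add (integrable_restrict_of_continuous hΩ (by fun_prop))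
  have hc1 : Continuous (iteratedDeriv 1 σ) := (contDiff_iteratedDeriv hσ 1).continuous
  refine (hasDerivAt_integral_of_dominated_loc_of_lip (s := univ) (bound := fun y => C * |f y|)
    Filter.univ_mem (Filter.Eventually.of_forall fun t => (hInt t).1) (hInt 0)
    (integrable_continuous_mul hΩ (by fun_prop) hf).1 ?_ (hf.abs.const_mul _) ?_).2
  · filter_upwards with y
    refine LipschitzWith.lipschitzOnWith (LipschitzWith.of_dist_le_mul fun t t' => ?_)
    refine (hσL.dist_le_mul _ _).trans (le_of_eq ?_)
    rw [Real.coe_nnabs, Real.dist_eq, Real.dist_eq, abs_mul, abs_abs, NNReal.abs_eq,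
      add_sub_add_right_eq_sub, add_sub_add_right_eq_sub, ← sub_mul, abs_mul]
    ring
  · filter_upwards with y
    have e1 : HasDerivAt (fun t : ℝ => t * f y + inner ℝ w y + b) (f y) 0 := by
      simpa using (((hasDerivAt_id (0 : ℝ)).mul_const (f y)).add_const
        (inner ℝ w y)).add_const b
    have e2 := (hasDerivAt_iteratedDeriv hσ 0 (0 * f y + inner ℝ w y + b)).comp 0 e1
    rw [iteratedDeriv_zero] at e2
    exact e2.congr_deriv (by simp)

/-- The features separate the points of the Sobolev space. -/
lemma exists_feature_ne (hΩ : Bornology.IsBounded (Ω : Set (E d)))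
    (hσ : ContDiff ℝ ∞ σ) {C : ℝ≥0} (hσL : LipschitzWith C σ)
    (hpoly : ¬ ∃ P : Polynomial ℝ, ∀ t, σ t = P.eval t) {s : ℕ} {p : ℝ≥0∞} [Fact (1 ≤ p)]
    {u v : Sobolev Ω s p k} (huv : u ≠ v) :
    ∃ φ : Feature k d, φ.eval σ Ω (Sobolev.toLp u : E d → E k) ≠
      φ.eval σ Ω (Sobolev.toLp v : E d → E k) := by
  by_contra! hall
  obtain ⟨t₁, t₂, ht⟩ : ∃ t₁ t₂, σ t₁ ≠ σ t₂ := by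
    by_contra! hc
    exact hpoly ⟨Polynomial.C (σ 0), fun t => by rw [Polynomial.eval_C]; exact hc t 0⟩
  have havg (a : Fin k ⊕ Fin d → ℝ) (b : ℝ) :
      neuronAverage σ Ω a b (Sobolev.toLp u : E d → E k) =
        neuronAverage σ Ω a b (Sobolev.toLp v : E d → E k) := by
    by_contra hne
    set m₁ := neuronAverage σ Ω a b (Sobolev.toLp u : E d → E k)
    set m₂ := neuronAverage σ Ω a b (Sobolev.toLp v : E d → E k)
    have hsub : m₁ - m₂ ≠ 0 := sub_ne_zero.2 hne
    -- The outer weight and bias form the affine map that sends `m₁` to `t₁` and `m₂` to `t₂`, so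
    -- equal features would give `σ t₁ = σ t₂`.
    have h := hall ⟨t₁ - (t₁ - t₂) / (m₁ - m₂) * m₁, (t₁ - t₂) / (m₁ - m₂), a, b⟩
    change σ ((t₁ - t₂) / (m₁ - m₂) * m₁ + (t₁ - (t₁ - t₂) / (m₁ - m₂) * m₁)) =
      σ ((t₁ - t₂) / (m₁ - m₂) * m₂ + (t₁ - (t₁ - t₂) / (m₁ - m₂) * m₁)) at h
    have e1 : (t₁ - t₂) / (m₁ - m₂) * m₁ + (t₁ - (t₁ - t₂) / (m₁ - m₂) * m₁) = t₁ := by ring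
    have e2 : (t₁ - t₂) / (m₁ - m₂) * m₂ + (t₁ - (t₁ - t₂) / (m₁ - m₂) * m₁) = t₂ := by
      field_simp
      ring
    rw [e1, e2] at h
    exact ht h
  have hfin := isFiniteMeasure_restrict_of_isBounded hΩ
  have hInt (a : Fin k ⊕ Fin d → ℝ) (b : ℝ) :
      ∫ y in (Ω : Set (E d)), σ (a ⬝ᵥ Sum.elim (Sobolev.toLp u y) y + b) =
        ∫ y in (Ω : Set (E d)), σ (a ⬝ᵥ Sum.elim (Sobolev.toLp v y) y + b) := by
    have h := havg a b
    unfold neuronAverage at h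
    rw [← measure_smul_average, ← measure_smul_average, h]
  have hcomp (w : Sobolev Ω s p k) (i : Fin k) :
      Integrable (fun y => Sobolev.toLp w y i) (volume.restrict (Ω : Set (E d))) :=
    (EuclideanSpace.proj (𝕜 := ℝ) i).integrable_comp (integrable_of_Lp hΩ (Sobolev.toLp w))
  have hzero (i : Fin k) : (fun y => Sobolev.toLp u y i - Sobolev.toLp v y i)
      =ᵐ[volume.restrict (Ω : Set (E d))] 0 := by
    refine ae_eq_zero_of_integral_ridge_mul hΩ hσ hpoly ((hcomp u i).sub (hcomp v i)) fun w b => ?_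
    have hu := hasDerivAt_integral_neuron hΩ hσ hσL (hcomp u i) w b
    have hv := hasDerivAt_integral_neuron hΩ hσ hσL (hcomp v i) w b
    have hrw (f : Sobolev Ω s p k) (t : ℝ) (y : E d) :
        (Sum.elim (Pi.single i t) (w : Fin d → ℝ) : Fin k ⊕ Fin d → ℝ) ⬝ᵥ
          Sum.elim (Sobolev.toLp f y) y = t * Sobolev.toLp f y i + inner ℝ w y := by
      rw [dotProduct_sumElim, ← dotProduct_eq_inner]
      simp [dotProduct, Pi.single_apply]
    have heq : (fun t : ℝ => ∫ y in (Ω : Set (E d)), σ (t * Sobolev.toLp u y i + inner ℝ w y + b)) =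
        fun t : ℝ => ∫ y in (Ω : Set (E d)), σ (t * Sobolev.toLp v y i + inner ℝ w y + b) := by
      ext t
      have := hInt (Sum.elim (Pi.single i t) (w : Fin d → ℝ)) b
      simp only [hrw] at this
      exact this
    rw [heq] at hu
    have hc1 : Continuous (iteratedDeriv 1 σ) := (contDiff_iteratedDeriv hσ 1).continuous
    simp only [mul_sub]
    rw [integral_sub (integrable_continuous_mul hΩ (by fun_prop) (hcomp u i))
      (integrable_continuous_mul hΩ (by fun_prop) (hcomp v i)), hu.unique hv, sub_self]
  refine huv (Sobolev.ext_ae ?_)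
  filter_upwards [ae_all_iff.2 hzero] with y hy
  ext i
  exact sub_eq_zero.1 (hy i)

end Features

/-! ### Density of tensor products in `C(T, X)` -/

section TensorDensity

variable {T X : Type*} [MetricSpace T] [CompactSpace T] [NormedAddCommGroup X] [NormedSpace ℝ X]

lemma continuous_smul_continuousMap : Continuous fun z : C(T, ℝ) × C(T, X) => z.1 • z.2 := by
  refine ContinuousMap.continuous_of_continuous_uncurry _ ?_
  change Continuous fun z : (C(T, ℝ) × C(T, X)) × T => z.1.1 z.2 • z.1.2 z.2
  fun_prop

/-- A closed subspace of `C(T, X)` that contains all functions `t ↦ q t • ξ` is everything. -/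
lemma submodule_eq_top_of_smul_const {V : Submodule ℝ C(T, X)} (hV : IsClosed (V : Set C(T, X)))
    (h : ∀ (q : C(T, ℝ)) (ξ : X), q • ContinuousMap.const T ξ ∈ V) : V = ⊤ := by
  classical
  rw [eq_top_iff]
  intro F _
  rw [← SetLike.mem_coe, ← hV.closure_eq, Metric.mem_closure_iff]
  intro ε hε
  -- On each set of the cover `F` is within `ε / 2` of its value at the centre; the partition of
  -- unity glues these constants.
  obtain ⟨t, -, hcover⟩ := isCompact_univ.elim_nhds_subcover
    (fun z : T => F ⁻¹' Metric.ball (F z) (ε / 2)) fun z _ =>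
      F.continuous.continuousAt.preimage_mem_nhds (Metric.ball_mem_nhds _ (half_pos hε))
  obtain ⟨φ, hφ⟩ := PartitionOfUnity.exists_isSubordinate (s := (univ : Set T)) isClosed_univ
    (fun z : t => F ⁻¹' Metric.ball (F z.1) (ε / 2))
    (fun z => Metric.isOpen_ball.preimage F.continuous) (by
      intro x hx
      obtain ⟨z, hz, hxz⟩ := mem_iUnion₂.1 (hcover hx)
      exact mem_iUnion.2 ⟨⟨z, hz⟩, hxz⟩)
  refine ⟨∑ z, φ z • ContinuousMap.const T (F z.1), V.sum_mem fun z _ => h _ _, ?_⟩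
  refine lt_of_le_of_lt ?_ (half_lt_self hε)
  rw [ContinuousMap.dist_le (half_pos hε).le]
  intro x
  have hsum : ∑ z, φ z x = 1 := by
    rw [← finsum_eq_sum_of_fintype]; exact φ.sum_eq_one (mem_univ x)
  have e : F x - (∑ z, φ z • ContinuousMap.const T (F z.1)) x =
      ∑ z, φ z x • (F x - F z.1) := by
    simp only [ContinuousMap.sum_apply, ContinuousMap.smul_apply', ContinuousMap.const_apply,
      smul_sub, Finset.sum_sub_distrib, ← Finset.sum_smul, hsum, one_smul]
  rw [dist_eq_norm, e]
  calc _ ≤ ∑ z, ‖φ z x • (F x - F z.1)‖ := norm_sum_le _ _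
    _ ≤ ∑ z, φ z x * (ε / 2) := by
      refine Finset.sum_le_sum fun z _ => ?_
      rw [norm_smul, Real.norm_eq_abs, abs_of_nonneg (φ.nonneg z x)]
      by_cases hz : φ z x = 0
      · simp [hz]
      · refine mul_le_mul_of_nonneg_left ?_ (φ.nonneg z x)
        have := hφ z (subset_tsupport _ hz)
        rw [mem_preimage, Metric.mem_ball, dist_eq_norm] at this
        exact this.le
    _ = ε / 2 := by rw [← Finset.sum_mul, hsum, one_mul]

end TensorDensity

/-! ### Closed subspaces that contain ridge functions -/

section RidgeFunctions

variable {d k : ℕ} {Ω : TopologicalSpace.Opens (E d)} (hΩ : Bornology.IsBounded (Ω : Set (E d)))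
  {s : ℕ} {p : ℝ≥0∞} [Fact (1 ≤ p)] {T : Type*} [MetricSpace T] [CompactSpace T]
  {P : Type*} [NormedAddCommGroup P] [NormedSpace ℝ P]

/-- The map `t ↦ (x ↦ h (y t, x) • c)` into the Sobolev space. -/
def paramMap (c : E k) (h : P × E d → ℝ) (hh : ContDiff ℝ ∞ h) (y : C(T, P)) :
    C(T, Sobolev Ω s p k) :=
  ⟨fun t => smoothSobolev hΩ s p c (slice h hh (y t)),
    (continuous_smoothSobolev_slice hΩ hh c).comp y.continuous⟩

/-- A closed subspace containing a smooth one-parameter family contains its derivative. -/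
lemma smul_paramMap_timeDeriv_mem {V : Submodule ℝ C(T, Sobolev Ω s p k)}
    (hV : IsClosed (V : Set C(T, Sobolev Ω s p k))) (c : E k) {h : (ℝ × P) × E d → ℝ}
    (hh : ContDiff ℝ ∞ h) (q : C(T, ℝ)) (y : C(T, P))
    (hmem : ∀ τ : ℝ, q • paramMap hΩ c h hh ((ContinuousMap.const T τ).prodMk y) ∈ V) :
    q • paramMap hΩ c (timeDeriv h) (contDiff_dirDeriv hh _)
      ((ContinuousMap.const T 0).prodMk y) ∈ V := by
  rw [← SetLike.mem_coe, ← hV.closure_eq, Metric.mem_closure_iff]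
  intro ε hε
  set ε' := ε / (2 * (‖q‖ + 1)) with hε'
  have hε'0 : 0 < ε' := by positivity
  obtain ⟨τ, hτ, hτb⟩ := exists_norm_differenceQuotient_le (s := s) (p := p) hΩ hh c
    (isCompact_range y.continuous) hε'0
  refine ⟨τ⁻¹ • (q • paramMap hΩ c h hh ((ContinuousMap.const T τ).prodMk y) -
    q • paramMap hΩ c h hh ((ContinuousMap.const T 0).prodMk y)),
    V.smul_mem _ (V.sub_mem (hmem _) (hmem _)), ?_⟩
  refine lt_of_le_of_lt ?_ (half_lt_self hε)
  rw [dist_comm, ContinuousMap.dist_le (half_pos hε).le]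
  intro t
  have hb := hτb (y t) ⟨t, rfl⟩
  have e : (τ⁻¹ • (q • paramMap hΩ c h hh ((ContinuousMap.const T τ).prodMk y) -
      q • paramMap hΩ c h hh ((ContinuousMap.const T 0).prodMk y)) : C(T, Sobolev Ω s p k)) t -
      (q • paramMap hΩ c (timeDeriv h) (contDiff_dirDeriv hh _)
        ((ContinuousMap.const T 0).prodMk y)) t =
      q t • (τ⁻¹ • (smoothSobolev hΩ s p c (slice h hh (τ, y t)) -
        smoothSobolev hΩ s p c (slice h hh (0, y t))) -
        smoothSobolev hΩ s p c (slice (timeDeriv h) (contDiff_dirDeriv hh _) (0, y t))) := by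
    change τ⁻¹ • (q t • smoothSobolev hΩ s p c (slice h hh (τ, y t)) -
      q t • smoothSobolev hΩ s p c (slice h hh (0, y t))) - q t • smoothSobolev hΩ s p c
        (slice (timeDeriv h) (contDiff_dirDeriv hh _) (0, y t)) = _
    rw [← smul_sub, smul_comm, ← smul_sub]
  rw [dist_eq_norm, e, norm_smul]
  have hq : ‖q t‖ ≤ ‖q‖ := q.norm_coe_le_norm t
  calc ‖q t‖ * _ ≤ ‖q‖ * ε' := mul_le_mul hq hb (norm_nonneg _) (norm_nonneg _)
    _ ≤ (‖q‖ + 1) * ε' := by nlinarith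
    _ = ε / 2 := by rw [hε']; field_simp

/-- The function `(a, x) ↦ r x * σ⁽ⁿ⁾ (a + ⟪w, x⟫ + b)`. -/
def ridge (σ : ℝ → ℝ) (r : E d → ℝ) (n : ℕ) (w : E d) (b : ℝ) : ℝ × E d → ℝ :=
  fun z => r z.2 * iteratedDeriv n σ (z.1 + inner ℝ w z.2 + b)

lemma contDiff_ridge {σ : ℝ → ℝ} (hσ : ContDiff ℝ ∞ σ) {r : E d → ℝ} (hr : ContDiff ℝ ∞ r)
    (n : ℕ) (w : E d) (b : ℝ) : ContDiff ℝ ∞ (ridge σ r n w b) := by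
  have h1 := contDiff_iteratedDeriv hσ n
  unfold ridge
  exact (hr.comp contDiff_snd).mul
    (h1.comp ((contDiff_fst.add (contDiff_const.inner ℝ contDiff_snd)).add contDiff_const))

variable {σ : ℝ → ℝ} (hσ : ContDiff ℝ ∞ σ)

/-- The map `t ↦ (x ↦ r x * σ⁽ⁿ⁾ (y t + ⟪w, x⟫ + b) • c)` into the Sobolev space. -/
def ridgeMap (c : E k) {r : E d → ℝ} (hr : ContDiff ℝ ∞ r) (n : ℕ) (y : C(T, ℝ)) (w : E d) (b : ℝ) :
    C(T, Sobolev Ω s p k) :=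
  paramMap hΩ c (ridge σ r n w b) (contDiff_ridge hσ hr n w b) y

/-- The derivative of ridge functions in the direction `(y', w')`. -/
lemma smul_ridge_deriv_mem {V : Submodule ℝ C(T, Sobolev Ω s p k)}
    (hV : IsClosed (V : Set C(T, Sobolev Ω s p k))) (c : E k) {r : E d → ℝ} (hr : ContDiff ℝ ∞ r)
    {n : ℕ} {q : C(T, ℝ)} {Y : Submodule ℝ C(T, ℝ)}
    (hmem : ∀ y ∈ Y, ∀ w b, q • ridgeMap hΩ hσ c hr n y w b ∈ V)
    {y y' : C(T, ℝ)} (hy : y ∈ Y) (hy' : y' ∈ Y) (w w' : E d) (b : ℝ)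
    {F : C(T, Sobolev Ω s p k)} {f : T → smoothFun d}
    (hF : ∀ t, F t = smoothSobolev hΩ s p c (f t))
    (hf : ∀ t x, (f t).1 x =
      r x * ((y' t + inner ℝ w' x) * iteratedDeriv (n + 1) σ (y t + inner ℝ w x + b))) :
    q • F ∈ V := by
  -- The ridge function along the line `(y + τ y', w + τ w')`, with `τ` as time and the values of
  -- `y` and `y'` as parameters. Its time derivative at 0 is the function described by `hf`.
  let h : (ℝ × (ℝ × ℝ)) × E d → ℝ := fun z => r z.2 * iteratedDeriv n σ
    (z.1.2.1 + z.1.1 * z.1.2.2 + (inner ℝ w z.2 + z.1.1 * inner ℝ w' z.2) + b)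
  have h1 := contDiff_iteratedDeriv hσ n
  have hh : ContDiff ℝ ∞ h := by
    have hin (v : E d) : ContDiff ℝ ∞ fun z : (ℝ × (ℝ × ℝ)) × E d => (inner ℝ v z.2 : ℝ) :=
      contDiff_const.inner ℝ contDiff_snd
    have h2 := hin w
    have h3 := hin w'
    refine (hr.comp contDiff_snd).mul (h1.comp ?_)
    fun_prop
  have key := smul_paramMap_timeDeriv_mem hΩ hV c hh q (y.prodMk y') (fun τ => by
    have := hmem (y + τ • y') (Y.add_mem hy (Y.smul_mem τ hy')) (w + τ • w') b
    convert this using 2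
    ext1 t
    change smoothSobolev hΩ s p c _ = smoothSobolev hΩ s p c _
    congr 1
    ext x
    change h ((τ, (y t, y' t)), x) = ridge σ r n (w + τ • w') b (y t + τ * y' t, x)
    simp only [h, ridge, inner_add_left, inner_smul_left]
    rfl)
  convert key using 2
  ext1 t
  rw [hF]
  change smoothSobolev hΩ s p c _ = smoothSobolev hΩ s p c _
  congr 1
  ext x
  rw [hf]
  change _ = timeDeriv h ((0, (y t, y' t)), x)
  have e1 := hasDerivAt_time hh 0 (y t, y' t) x
  have e2 : HasDerivAt (fun τ : ℝ => y t + τ * y' t + (inner ℝ w x + τ * inner ℝ w' x) + b)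
      (y' t + inner ℝ w' x) 0 := by
    have a1 := ((hasDerivAt_id (0 : ℝ)).mul_const (y' t)).const_add (y t)
    have a2 := ((hasDerivAt_id (0 : ℝ)).mul_const (inner ℝ w' x : ℝ)).const_add (inner ℝ w x : ℝ)
    exact ((a1.add a2).add_const b).congr_deriv (by simp)
  have e3 := ((hasDerivAt_iteratedDeriv hσ n _).comp 0 e2).const_mul (r x)
  rw [e1.unique e3]
  simp only [zero_mul, add_zero]
  ring

/-- A closed subspace that contains the ridge functions `σ (y t + ⟪w, x⟫ + b) • c` for all `y` in a
point-separating space of functions is everything. -/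
theorem submodule_eq_top_of_ridgeMap {V : Submodule ℝ C(T, Sobolev Ω s p k)}
    (hV : IsClosed (V : Set C(T, Sobolev Ω s p k)))
    (hLip : HasLipschitzBoundary (Ω : Set (E d))) (hp : p ≠ ⊤)
    (hpoly : ¬ ∃ P : Polynomial ℝ, ∀ t, σ t = P.eval t) {Y : Submodule ℝ C(T, ℝ)}
    (hsep : ∀ t t' : T, t ≠ t' → ∃ y ∈ Y, y t ≠ y t')
    (hmem : ∀ (c : E k) (y : C(T, ℝ)), y ∈ Y → ∀ (w : E d) (b : ℝ),
      ridgeMap hΩ hσ c (contDiff_const (c := (1 : ℝ))) 0 y w b ∈ V) : V = ⊤ := by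
  -- The order `n` is chosen before `y`, `w` and `b`. This leaves them free for the next
  -- differentiation, and finally for setting `y = 0`, `w = 0` and choosing `b`.
  have hgood (c : E k) (q : C(T, ℝ)) (hq : q ∈ Submonoid.closure (Y : Set C(T, ℝ))) (m : E d → ℝ)
      (hm : m ∈ monomialFun d) : ∃ n, ∃ hms : ContDiff ℝ ∞ m, ∀ y ∈ Y, ∀ (w : E d) (b : ℝ),
        q • ridgeMap hΩ hσ c hms n y w b ∈ V := by
    induction hq using Submonoid.closure_induction_right with
    | one =>
      induction hm using Submonoid.closure_induction_right with
      | one => exact ⟨0, contDiff_const, fun y hy w b => by rw [one_smul]; exact hmem c y hy w b⟩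
      | mul_right m hm l hl ih =>
        obtain ⟨i, rfl⟩ := hl
        obtain ⟨n, hms, hn⟩ := ih
        refine ⟨n + 1, hms.mul (contDiff_coord i), fun y hy w b => ?_⟩
        refine smul_ridge_deriv_mem hΩ hσ hV c hms hn hy Y.zero_mem w (stdVec d i) b
          (fun t => rfl) fun t x => ?_
        change (m x * coord i x) * iteratedDeriv (n + 1) σ _ = _
        simp only [ContinuousMap.zero_apply, zero_add, EuclideanSpace.inner_single_left, map_one,
          one_mul, coord]
        ring
    | mul_right q hq y' hy' ih =>
      obtain ⟨n, hms, hn⟩ := ih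
      refine ⟨n + 1, hms, fun y hy w b => ?_⟩
      rw [mul_smul]
      refine smul_ridge_deriv_mem hΩ hσ hV c hms hn hy hy' w 0 b
        (f := fun t => y' t • slice (ridge σ m (n + 1) w b) (contDiff_ridge hσ hms _ w b) (y t))
        (fun t => ?_) fun t x => ?_
      · rw [map_smul]; rfl
      · change y' t * (m x * iteratedDeriv (n + 1) σ _) = _
        simp only [inner_zero_left, add_zero]
        ring
  have hmonomial (c : E k) (q : C(T, ℝ)) (hq : q ∈ Submonoid.closure (Y : Set C(T, ℝ)))
      (m : smoothFun d) (hm : m.1 ∈ monomialFun d) :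
      q • ContinuousMap.const T (smoothSobolev hΩ s p c m) ∈ V := by
    obtain ⟨n, hms, hn⟩ := hgood c q hq m.1 hm
    obtain ⟨b, hb⟩ := exists_iteratedDeriv_ne_zero hσ hpoly n
    have h1 := V.smul_mem (iteratedDeriv n σ b)⁻¹ (hn 0 Y.zero_mem 0 b)
    convert h1 using 1
    ext1 t
    change q t • smoothSobolev hΩ s p c m = (iteratedDeriv n σ b)⁻¹ • (q t • smoothSobolev hΩ s p c _)
    rw [smul_comm (iteratedDeriv n σ b)⁻¹ (q t), ← map_smul (smoothSobolev hΩ s p c)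
      (iteratedDeriv n σ b)⁻¹]
    refine congrArg (fun g => q t • smoothSobolev hΩ s p c g) (Subtype.ext (funext fun x => ?_))
    change m.1 x = (iteratedDeriv n σ b)⁻¹ * (m.1 x * iteratedDeriv n σ (0 + inner ℝ (0 : E d) x + b))
    rw [inner_zero_left, zero_add, zero_add]
    field_simp
  refine submodule_eq_top_of_smul_const hV ?_
  have hcont (q : C(T, ℝ)) : Continuous fun ξ : Sobolev Ω s p k => q • ContinuousMap.const T ξ :=
    continuous_smul_continuousMap.comp
      (continuous_const.prodMk ContinuousMap.continuous_const')
  have hall (c : E k) (m : smoothFun d) (hm : m.1 ∈ monomialFun d) (q : C(T, ℝ)) :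
      q • ContinuousMap.const T (smoothSobolev hΩ s p c m) ∈ V := by
    let F := ContinuousMap.const T (smoothSobolev hΩ s p c m)
    -- For fixed `F` the admissible `q` form a closed set containing the algebra generated by `Y`,
    -- which is the span of the products treated above; Stone–Weierstrass then gives every `q`.
    have hclosed : IsClosed {q : C(T, ℝ) | q • F ∈ V} :=
      hV.preimage (continuous_smul_continuousMap.comp (continuous_id.prodMk continuous_const))
    have hsub : (Algebra.adjoin ℝ (Y : Set C(T, ℝ)) : Set C(T, ℝ)) ⊆ {q | q • F ∈ V} := by
      intro q hq
      replace hq : q ∈ Subalgebra.toSubmodule (Algebra.adjoin ℝ (Y : Set C(T, ℝ))) := hq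
      rw [Algebra.adjoin_eq_span] at hq
      induction hq using Submodule.span_induction with
      | mem q hq => exact hmonomial c q hq m hm
      | zero => change (0 : C(T, ℝ)) • F ∈ V; rw [zero_smul]; exact V.zero_mem
      | add q q' _ _ h h' => change (q + q') • F ∈ V; rw [add_smul]; exact V.add_mem h h'
      | smul a q _ h => 
        have e : (a • q) • F = a • (q • F) := by
          ext1 t
          exact smul_assoc a (q t) (F t)
        change (a • q) • F ∈ V
        rw [e]
        exact V.smul_mem a h
    have hSW := ContinuousMap.subalgebra_topologicalClosure_eq_top_of_separatesPoints
      (Algebra.adjoin ℝ (Y : Set C(T, ℝ))) (by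
        intro t t' htt
        obtain ⟨y, hy, hne⟩ := hsep t t' htt
        exact ⟨y, ⟨y, Algebra.subset_adjoin hy, rfl⟩, hne⟩)
    have hq : q ∈ (Algebra.adjoin ℝ (Y : Set C(T, ℝ))).topologicalClosure := by
      rw [hSW]; trivial
    exact closure_minimal hsub hclosed hq
  intro q ξ
  -- With `q` fixed the admissible `ξ` form a closed subspace containing all monomials, so density
  -- of polynomials applies.
  let W : Submodule ℝ (Sobolev Ω s p k) :=
    { carrier := {ξ | q • ContinuousMap.const T ξ ∈ V}
      add_mem' := fun {ξ η} hξ hη => by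
        have := V.add_mem hξ hη
        rw [← smul_add] at this
        exact this
      zero_mem' := by
        have := V.zero_mem
        rw [← smul_zero q] at this
        exact this
      smul_mem' := fun a ξ hξ => by
        have e : q • ContinuousMap.const T (a • ξ) = a • (q • ContinuousMap.const T ξ) := by
          ext1 t
          exact smul_comm (q t) a ξ
        change q • ContinuousMap.const T (a • ξ) ∈ V
        rw [e]
        exact V.smul_mem a hξ }
  have hW : W = ⊤ := submodule_eq_top_of_monomials hp hΩ hLip (hV.preimage (hcont q))
    fun c m hm => hall c m hm q
  have : ξ ∈ W := hW ▸ trivial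
  exact this

end RidgeFunctions

/-! ### Feature networks as averaging neural operators -/

section FeatureNets

variable {d k k' s s' : ℕ} {p p' : ℝ≥0∞} [Fact (1 ≤ p)] [Fact (1 ≤ p')]
  {Ω : TopologicalSpace.Opens (E d)} {σ : ℝ → ℝ}

/-- The function of `x` computed by a neural network with one hidden layer from `x` and the values
at `u` of finitely many features. -/
def featureNet (σ : ℝ → ℝ) (Ω : Set (E d)) {ι κ : Type} [Fintype ι] [Fintype κ]
    (φ : ι → Feature k d) (A : κ → ι → ℝ) (w : κ → E d) (b : κ → ℝ) (c : κ → E k')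
    (u : E d → E k) : E d → E k' :=
  fun x => ∑ j, σ (∑ l, A j l * (φ l).eval σ Ω u + inner ℝ (w j) x + b j) • c j

/-- The operator `Ψ` is given by a network that acts on `x` and on finitely many features. -/
def IsFeatureNet (σ : ℝ → ℝ) (Ψ : Sobolev Ω s p k → Sobolev Ω s' p' k') : Prop :=
  ∃ (ι κ : Type) (_ : Fintype ι) (_ : Fintype κ) (φ : ι → Feature k d) (A : κ → ι → ℝ)
    (w : κ → E d) (b : κ → ℝ) (c : κ → E k'), ∀ u : Sobolev Ω s p k,
    (Sobolev.toLp (Ψ u) : E d → E k') =ᵐ[volume.restrict (Ω : Set (E d))]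
      featureNet σ Ω φ A w b c (Sobolev.toLp u : E d → E k)

/-- The two networks are placed side by side, with zero weights between the blocks. -/
lemma IsFeatureNet.add {Ψ Ψ' : Sobolev Ω s p k → Sobolev Ω s' p' k'} (h : IsFeatureNet σ Ψ)
    (h' : IsFeatureNet σ Ψ') : IsFeatureNet σ (Ψ + Ψ') := by
  obtain ⟨ι, κ, _, _, φ, A, w, b, c, hΨ⟩ := h
  obtain ⟨ι', κ', _, _, φ', A', w', b', c', hΨ'⟩ := h'
  refine ⟨ι ⊕ ι', κ ⊕ κ', inferInstance, inferInstance, Sum.elim φ φ',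
    Sum.elim (fun j => Sum.elim (A j) 0) (fun j => Sum.elim 0 (A' j)), Sum.elim w w',
    Sum.elim b b', Sum.elim c c', fun u => ?_⟩
  rw [Pi.add_apply, map_add]
  filter_upwards [hΨ u, hΨ' u, Lp.coeFn_add (Sobolev.toLp (Ψ u)) (Sobolev.toLp (Ψ' u))]
    with x h1 h2 h3
  rw [h3, Pi.add_apply, h1, h2]
  simp [featureNet, Fintype.sum_sum_type]

lemma IsFeatureNet.const_smul {Ψ : Sobolev Ω s p k → Sobolev Ω s' p' k'} (h : IsFeatureNet σ Ψ)
    (a : ℝ) : IsFeatureNet σ (a • Ψ) := by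
  obtain ⟨ι, κ, _, _, φ, A, w, b, c, hΨ⟩ := h
  refine ⟨ι, κ, inferInstance, inferInstance, φ, A, w, b, fun j => a • c j, fun u => ?_⟩
  rw [Pi.smul_apply, map_smul]
  filter_upwards [hΨ u, Lp.coeFn_smul a (Sobolev.toLp (Ψ u))] with x h1 h2
  rw [h2, Pi.smul_apply, h1]
  simp only [featureNet, Finset.smul_sum]
  exact Finset.sum_congr rfl fun j _ => smul_comm _ _ _

lemma isFeatureNet_zero : IsFeatureNet σ (0 : Sobolev Ω s p k → Sobolev Ω s' p' k') := by
  refine ⟨Empty, Empty, inferInstance, inferInstance, Empty.elim, Empty.elim, Empty.elim,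
    Empty.elim, Empty.elim, fun u => ?_⟩
  rw [Pi.zero_apply, map_zero]
  filter_upwards [Lp.coeFn_zero (E k') p' (volume.restrict (Ω : Set (E d)))] with x hx
  rw [hx]
  simp [featureNet]

/-- Features and neurons may be indexed by the same set `Fin dc`. -/
lemma exists_featureNet_eq_fin {ι κ : Type} [Fintype ι] [Fintype κ]
    (φ : ι → Feature k d) (A : κ → ι → ℝ) (w : κ → E d) (b : κ → ℝ) (c : κ → E k') :
    ∃ (dc : ℕ) (φ' : Fin dc → Feature k d) (A' : Fin dc → Fin dc → ℝ) (w' : Fin dc → E d)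
      (b' : Fin dc → ℝ) (c' : Fin dc → E k'), ∀ u : E d → E k,
      featureNet σ Ω φ A w b c u = featureNet σ Ω φ' A' w' b' c' u := by
  -- The operator has a single width for all its layers, so both families are padded: the new
  -- features receive weight zero and the new neurons have output vector zero.
  let e := Fintype.equivFin (ι ⊕ κ)
  let φ₁ : ι ⊕ κ → Feature k d := Sum.elim φ fun _ => ⟨0, 0, 0, 0⟩
  let A₁ : ι ⊕ κ → ι ⊕ κ → ℝ := Sum.elim 0 fun j => Sum.elim (A j) 0
  let w₁ : ι ⊕ κ → E d := Sum.elim 0 w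
  let b₁ : ι ⊕ κ → ℝ := Sum.elim 0 b
  let c₁ : ι ⊕ κ → E k' := Sum.elim 0 c
  refine ⟨Fintype.card (ι ⊕ κ), φ₁ ∘ e.symm, fun j l => A₁ (e.symm j) (e.symm l), w₁ ∘ e.symm,
    b₁ ∘ e.symm, c₁ ∘ e.symm, fun u => ?_⟩
  ext1 x
  have h1 : featureNet σ Ω φ A w b c u x = featureNet σ Ω φ₁ A₁ w₁ b₁ c₁ u x := by
    simp [featureNet, Fintype.sum_sum_type, φ₁, A₁, w₁, b₁, c₁]
  rw [h1]
  unfold featureNet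
  rw [← e.symm.sum_comp]
  refine Finset.sum_congr rfl fun j _ => ?_
  rw [← e.symm.sum_comp (fun l => A₁ (e.symm j) l * (φ₁ l).eval σ Ω u)]
  rfl

/-- The averaging neural operator, with vanishing weight matrix in the hidden layer, that computes
a feature network. -/
def featureOperator {dc : ℕ} (φ : Fin dc → Feature k d) (A : Fin dc → Fin dc → ℝ)
    (w : Fin dc → E d) (b : Fin dc → ℝ) (c : Fin dc → E k') : AveragingNeuralOperator d k k' dc where
  R := ⟨fun j => (φ j).innerWeight, fun j => (φ j).innerBias,
    Matrix.diagonal fun j => (φ j).outerWeight, 0⟩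
  W := 0
  b := fun j => (φ j).outerBias
  Q := ⟨fun j => Sum.elim (A j) (w j), b, fun i j => c j i, 0⟩

/-- The diagonal outer weights of `R` keep the lifting neurons separate, and `W = 0` leaves only
their averages as input of the hidden layer. Integrability of `u` lets the vector-valued average be
computed componentwise. -/
lemma eval_featureOperator (hΩ : Bornology.IsBounded (Ω : Set (E d))) {C : ℝ≥0}
    (hσ : LipschitzWith C σ) {dc : ℕ} (φ : Fin dc → Feature k d) (A : Fin dc → Fin dc → ℝ)
    (w : Fin dc → E d) (b : Fin dc → ℝ) (c : Fin dc → E k') {u : E d → E k}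
    (hu : Integrable u (volume.restrict (Ω : Set (E d)))) :
    (featureOperator φ A w b c).eval σ Ω u = featureNet σ Ω φ A w b c u := by
  have := isFiniteMeasure_restrict_of_isBounded hΩ
  set N := featureOperator φ A w b c with hN
  have hlift (x : E d) (j : Fin dc) : N.lift σ u x j =
      (φ j).outerWeight * σ ((φ j).innerWeight ⬝ᵥ Sum.elim (u x) x + (φ j).innerBias) := by
    simp only [AveragingNeuralOperator.lift, ShallowNet.eval, hN, featureOperator, add_zero,
      Matrix.mulVec_diagonal]
    rfl
  have hInt : Integrable (N.lift σ u) (volume.restrict (Ω : Set (E d))) := by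
    refine Integrable.of_eval fun j => ?_
    simp only [hlift]
    exact (integrable_comp_of_lipschitz hσ (integrable_dotProduct hΩ hu _ _)).const_mul _
  have havg (j : Fin dc) : (⨍ y in (Ω : Set (E d)), N.lift σ u y) j =
      (φ j).outerWeight * neuronAverage σ Ω (φ j).innerWeight (φ j).innerBias u := by
    have hpj : ∫ y in (Ω : Set (E d)), N.lift σ u y j = (∫ y in (Ω : Set (E d)), N.lift σ u y) j :=
      (ContinuousLinearMap.proj (R := ℝ) (φ := fun _ : Fin dc => ℝ) j).integral_comp_comm hInt
    unfold neuronAverage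
    rw [average_eq, average_eq, Pi.smul_apply, ← hpj]
    simp only [hlift]
    rw [integral_const_mul, smul_eq_mul, smul_eq_mul]
    ring
  have hhidden (x : E d) (j : Fin dc) : N.hidden σ Ω (N.lift σ u) x j = (φ j).eval σ Ω u := by
    simp only [AveragingNeuralOperator.hidden, Pi.add_apply, havg]
    have hW : N.W = 0 := rfl
    have hb : N.b j = (φ j).outerBias := rfl
    rw [hW, hb, Matrix.zero_mulVec, Pi.zero_apply, zero_add, add_comm]
    rfl
  ext x i
  have hQ : (N.eval σ Ω u x) i = ∑ j, c j i * σ (Sum.elim (A j) (w j) ⬝ᵥ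
      Sum.elim (N.hidden σ Ω (N.lift σ u) x) x + b j) + 0 := rfl
  rw [hQ]
  simp only [featureNet, WithLp.ofLp_sum, Finset.sum_apply, PiLp.smul_apply, smul_eq_mul, add_zero]
  refine Finset.sum_congr rfl fun j _ => ?_
  rw [mul_comm, sumElim_dotProduct_sumElim, dotProduct_eq_inner (w j)]
  simp only [dotProduct, hhidden]

lemma IsFeatureNet.isAveragingNeuralOperator (hΩ : Bornology.IsBounded (Ω : Set (E d))) {C : ℝ≥0}
    (hσ : LipschitzWith C σ) {Ψ : Sobolev Ω s p k → Sobolev Ω s' p' k'} (h : IsFeatureNet σ Ψ) :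
    IsAveragingNeuralOperator σ Ψ := by
  obtain ⟨ι, κ, _, _, φ, A, w, b, c, hΨ⟩ := h
  obtain ⟨dc, φ', A', w', b', c', h'⟩ := exists_featureNet_eq_fin (σ := σ) (Ω := Ω) φ A w b c
  refine ⟨dc, featureOperator φ' A' w' b' c', fun u => ?_⟩
  rw [eval_featureOperator hΩ hσ φ' A' w' b' c' (integrable_of_Lp hΩ (Sobolev.toLp u)), ← h']
  exact hΨ u

/-- The restrictions of feature networks to `K`. -/
def featureNetSubmodule (σ : ℝ → ℝ) (K : Set (Sobolev Ω s p k)) :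
    Submodule ℝ C(K, Sobolev Ω s' p' k') where
  carrier := {F | ∃ Ψ : Sobolev Ω s p k → Sobolev Ω s' p' k', IsFeatureNet σ Ψ ∧ ∀ u : K, Ψ u = F u}
  add_mem' := by
    rintro F F' ⟨Ψ, hΨ, hF⟩ ⟨Ψ', hΨ', hF'⟩
    exact ⟨Ψ + Ψ', hΨ.add hΨ', fun u => by rw [Pi.add_apply, hF, hF']; rfl⟩
  zero_mem' := ⟨0, isFeatureNet_zero, fun u => rfl⟩
  smul_mem' := by
    rintro a F ⟨Ψ, hΨ, hF⟩
    exact ⟨a • Ψ, hΨ.const_smul a, fun u => by rw [Pi.smul_apply, hF]; rfl⟩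

/-- Feature networks are dense in the continuous operators on a compact set. -/
theorem closure_featureNetSubmodule (hΩ : Bornology.IsBounded (Ω : Set (E d)))
    (hLip : HasLipschitzBoundary (Ω : Set (E d))) (hp' : p' ≠ ⊤) (hσ : ContDiff ℝ ∞ σ) {C : ℝ≥0}
    (hσL : LipschitzWith C σ) (hpoly : ¬ ∃ P : Polynomial ℝ, ∀ t, σ t = P.eval t)
    (K : Set (Sobolev Ω s p k)) [CompactSpace K] :
    (featureNetSubmodule (s' := s') (p' := p') (k' := k') σ K).topologicalClosure = ⊤ := by
  let feat (φ : Feature k d) : C(K, ℝ) :=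
    ⟨fun u => φ.eval σ Ω (Sobolev.toLp u.1 : E d → E k),
      (φ.continuous_eval hΩ hσL).comp continuous_subtype_val⟩
  refine submodule_eq_top_of_ridgeMap hΩ hσ (Submodule.isClosed_topologicalClosure _) hLip hp' hpoly
    (Y := Submodule.span ℝ (range feat)) (fun u v huv => ?_) fun c y hy w b => ?_
  · obtain ⟨φ, hφ⟩ := exists_feature_ne hΩ hσ hσL hpoly (fun h => huv (Subtype.ext h))
    exact ⟨feat φ, Submodule.subset_span ⟨φ, rfl⟩, hφ⟩
  · refine Submodule.le_topologicalClosure _ ?_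
    -- A finite combination of features is the input of a single neuron, whose weights are the
    -- coefficients.
    obtain ⟨a, rfl⟩ := Finsupp.mem_span_range_iff_exists_finsupp.1 hy
    let v : Sobolev Ω s p k → ℝ := fun u =>
      ∑ φ : a.support, a φ * φ.1.eval σ Ω (Sobolev.toLp u : E d → E k)
    have hr : ContDiff ℝ ∞ (fun _ : E d => (1 : ℝ)) := contDiff_const
    refine ⟨fun u => smoothSobolev hΩ s' p' c
      (slice (ridge σ (fun _ => 1) 0 w b) (contDiff_ridge hσ hr 0 w b) (v u)),
      ⟨a.support, Unit, inferInstance, inferInstance, fun φ => φ.1, fun _ φ => a φ, fun _ => w,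
        fun _ => b, fun _ => c, fun u => ?_⟩, fun u => ?_⟩
    · filter_upwards [toLp_smoothSobolev (s := s') (p := p') hΩ c
        (slice (ridge σ (fun _ => 1) 0 w b) (contDiff_ridge hσ hr 0 w b) (v u))] with x hx
      rw [hx]
      simp [featureNet, slice, ridge, v]
    · have hv : v u = (a.sum fun φ t => t • feat φ) u := by
        rw [Finsupp.sum, ContinuousMap.sum_apply, ← Finset.sum_coe_sort]
        rfl
      beta_reduce
      rw [hv]
      rfl

end FeatureNets

end ANO

end

/-! ### Universal approximation on compact sets -/

theorem theorem2 (σ : ℝ → ℝ) (hσ_smooth : ContDiff ℝ ∞ σ)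
    (hσ_lip : ∃ C : ℝ≥0, LipschitzWith C σ)
    (hσ_nonpoly : ¬ ∃ P : Polynomial ℝ, ∀ t : ℝ, σ t = P.eval t)
    {d : ℕ} (Ω : TopologicalSpace.Opens (ANO.E d))
    (hΩ_bdd : Bornology.IsBounded (Ω : Set (ANO.E d)))
    (hΩ_lip : ANO.HasLipschitzBoundary (Ω : Set (ANO.E d)))
    (k k' s s' : ℕ) (p p' : ℝ≥0∞) [Fact (1 ≤ p)] [Fact (1 ≤ p')] (hp : p ≠ ⊤) (hp' : p' ≠ ⊤)
    (Ψdag : ANO.Sobolev Ω s p k → ANO.Sobolev Ω s' p' k') (hΨdag : Continuous Ψdag)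
    (K : Set (ANO.Sobolev Ω s p k)) (hK : IsCompact K)
    (hK_bdd : ∃ M : ℝ≥0, ∀ u ∈ K,
      eLpNorm (ANO.Sobolev.toLp u) ⊤ (volume.restrict (Ω : Set (ANO.E d))) ≤ M)
    (ε : ℝ) (hε : 0 < ε) :
    ∃ Ψ : ANO.Sobolev Ω s p k → ANO.Sobolev Ω s' p' k',
      ANO.IsAveragingNeuralOperator σ Ψ ∧ ∀ u ∈ K, ‖Ψdag u - Ψ u‖ ≤ ε := by
  obtain ⟨C, hσL⟩ := hσ_lip
  have : CompactSpace K := isCompact_iff_compactSpace.1 hK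
  let F : C(K, ANO.Sobolev Ω s' p' k') := ⟨fun u => Ψdag u, hΨdag.comp continuous_subtype_val⟩
  have hF : F ∈ (ANO.featureNetSubmodule (s' := s') (p' := p') (k' := k') σ K).topologicalClosure := by
    rw [ANO.closure_featureNetSubmodule hΩ_bdd hΩ_lip hp' hσ_smooth hσL hσ_nonpoly K]
    trivial
  obtain ⟨G, ⟨Ψ, hΨ, hG⟩, hFG⟩ := Metric.mem_closure_iff.1 hF ε hε
  refine ⟨Ψ, hΨ.isAveragingNeuralOperator hΩ_bdd hσL, fun u hu => ?_⟩
  have h := (ContinuousMap.dist_le hε.le).1 hFG.le ⟨u, hu⟩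
  rw [← hG, dist_eq_norm] at h
  exact h
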